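/- Let $Q=(0,1)^3$ and $r=|x|$. For $\gamma\in\mathbb{R}$ and $s\in\mathbb{N}$ put, with weak derivatives on $Q$, $$|w|_{\mathcal K^s_\gamma(Q)}=\Big(\sum_{|\alpha|=s}\|r^{s-\gamma}\partial^\alpha w\|_{L^2(Q)}^2\Big)^{1/2},\qquad \|w\|_{\mathcal J^s_\gamma(Q)}=\Big(\sum_{|\alpha|\le s}\|r^{s-\gamma}\partial^\alpha w\|_{L^2(Q)}^2\Big)^{1/2}.$$ For $C,A>0$ and real $\mathfrak d\ge1$, let $\mathcal J^\varpi_\gamma(Q;C,A,\mathfrak d)$ be the set of functions $w$ such that, for all integers $s>\gamma-3/2$, $\|w\|_{\mathcal J^s_\gamma(Q)}<\infty$ and $|w|_{\mathcal K^s_\gamma(Q)}\le CA^s(s!)^{\mathfrak d}$. Let $\Gamma$ be the union of the three faces $\{x_i=1\}$ of $Q$, and let $H^1_\Gamma(Q)$ be the space of functions in $H^1(Q)$ with zero trace on $\Gamma$ (it contains $H^1_0(Q)$). For $\ell\ge1$ let $\mathbf x_{i,j,k}=2^{-\ell}(i,j,k)$, let $\phi_{i,j,k}$ be the continuous nodal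 Lagrange function of $\mathbf x_{i,j,k}$, piecewise trilinear on the uniform mesh of $Q$ of size $2^{-\ell}$, and let $X^\ell=\mathrm{span}\{\phi_{i,j,k}:0\le i,j,k\le 2^\ell-1\}$. To $v\in X^\ell$ belongs the coefficient tensor $A_{i,j,k}=v(\mathbf x_{i,j,k})$, $0\le i,j,k\le 2^\ell-1$. Write $i=\overline{i_1\dots i_\ell}$, $j=\overline{j_1\dots j_\ell}$, $k=\overline{k_1\dots k_\ell}$ in binary, most significant digit first. All ranks below are positive integers. We consider three formats. * Classic QTT: $A_{i,j,k}=U^1(i_1)\cdots U^\ell(i_\ell)\,V^1(j_1)\cdots V^\ell(j_\ell)\,W^1(k_1)\cdots W^\ell(k_\ell)$, where the $3\ell$ cores map $\{0,1\}$ to real matrices of compatible sizes, the first with one row and the last with one column. * Transposed order QTT: $A_{i,j,k}=U^1(\overline{i_1j_1k_1})\cdots U^\ell(\overline{i_\ell j_\ell k_\ell})$, where the cores map $\{0,\dots,7\}$ to real matrices of compatible sizes, the first with one row and the last with one column. * Tucker-QTT: $A_{i,j,k}=\sum_{\beta_1,\beta_2,\beta_3=1}^{R_1,R_2,R_3}G_{\beta_1\beta_2\beta_3}\,U_{\beta_1}(i)\,V_{\beta_2}(j)\,W_{\beta_3}(k)$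 with $G\in\mathbb{R}^{R_1\times R_2\times R_3}$, where $U_{\beta_1}(i)$ is the $\beta_1$-th entry of $U^1(i_1)\cdots U^\ell(i_\ell)\in\mathbb{R}^{R_1\times1}$, the cores mapping $\{0,1\}$ to real matrices of compatible sizes, and likewise for $V$ and $W$. The number $N_{\mathrm{dof}}$ of degrees of freedom of a representation is the total number of entries of all its cores (including $G$ for Tucker-QTT). **Theorem.** Let $\gamma>3/2$, $C_u>0$, $A_u>0$, $\mathfrak d\ge1$, $0<\epsilon_0<1$, and let $u\in\mathcal J^\varpi_\gamma(Q;C_u,A_u,\mathfrak d)\cap H^1_\Gamma(Q)$. Then, for each of the three formats, there is a constant $C>0$ such that for all $0<\epsilon\le\epsilon_0$ there exist an integer $\ell\ge1$ and $v\in X^\ell$ with $$\|u-v\|_{H^1(Q)}\le\epsilon$$ whose coefficient tensor has a representation in that format with $$N_{\mathrm{dof}}\le C|\log\epsilon|^{\kappa},\qquad \kappa=\begin{cases}4\mathfrak d+3&\text{classic QTT},\\6\mathfrak d+1&\text{transposed order QTT},\\3\mathfrak d+3&\text{Tucker-QTT}.\end{cases}$$ -/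

import Mathlib

open MeasureTheory Filter Topology
open scoped ENNReal ContDiff

noncomputable section

namespace QTTApprox

/-- Three-dimensional Euclidean space; `‖x‖` is the distance of `x` from the origin. -/
abbrev E3 : Type := EuclideanSpace ℝ (Fin 3)

/-- The open unit cube `Q = (0,1)^3`. -/
def Q : Set E3 := {x | ∀ i, x i ∈ Set.Ioo (0 : ℝ) 1}

/-! ### Weak derivatives and weighted Sobolev spaces on `Q` -/

/-- The classical partial derivative in direction `i`. -/
def partialDeriv (i : Fin 3) (f : E3 → ℝ) : E3 → ℝ :=
  fun x => fderiv ℝ f x (EuclideanSpace.single i 1)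

/-- The classical derivative `∂^α` for a multi-index `α` (used on smooth functions only). -/
def multiDeriv (α : Fin 3 → ℕ) (f : E3 → ℝ) : E3 → ℝ :=
  (partialDeriv 0)^[α 0] ((partialDeriv 1)^[α 1] ((partialDeriv 2)^[α 2] f))

/-- `g` is a weak derivative `∂^α u` on `Q`. -/
structure HasWeakDeriv (α : Fin 3 → ℕ) (u g : E3 → ℝ) : Prop where
  locInt_fun : LocallyIntegrableOn u Q
  locInt_deriv : LocallyIntegrableOn g Q
  integral_eq : ∀ φ : E3 → ℝ, ContDiff ℝ ∞ φ → HasCompactSupport φ → tsupport φ ⊆ Q →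
    ∫ x in Q, u x * multiDeriv α φ x = (-1) ^ (∑ i, α i) * ∫ x in Q, g x * φ x

/-- The weighted norm `‖r^b ∂^α u‖_{L²(Q)}`, where `r = |x|` and `∂^α u` is the weak derivative.
Weak derivatives agree almost everywhere, so the infimum runs over equal values; it is `∞` if `u`
has no weak derivative `∂^α u` on `Q`. -/
def weightedNorm (b : ℝ) (α : Fin 3 → ℕ) (u : E3 → ℝ) : ℝ≥0∞ :=
  ⨅ (g : E3 → ℝ) (_ : HasWeakDeriv α u g),
    eLpNorm (fun x => ‖x‖ ^ b * g x) 2 (volume.restrict Q)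

/-- The seminorm `|u|_{K^s_γ(Q)} = (∑_{|α| = s} ‖r^{s-γ} ∂^α u‖²)^{1/2}`. -/
def kSeminorm (s : ℕ) (γ : ℝ) (u : E3 → ℝ) : ℝ≥0∞ :=
  (∑ α ∈ Finset.Nat.antidiagonalTuple 3 s, weightedNorm (s - γ) α u ^ 2) ^ (1 / 2 : ℝ)

/-- The norm `‖u‖_{J^s_γ(Q)} = (∑_{|α| ≤ s} ‖r^{s-γ} ∂^α u‖²)^{1/2}`. -/
def jNorm (s : ℕ) (γ : ℝ) (u : E3 → ℝ) : ℝ≥0∞ :=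
  (∑ k ∈ Finset.range (s + 1), ∑ α ∈ Finset.Nat.antidiagonalTuple 3 k,
    weightedNorm (s - γ) α u ^ 2) ^ (1 / 2 : ℝ)

/-- The norm `‖u‖_{H¹(Q)} = (∑_{|α| ≤ 1} ‖∂^α u‖²)^{1/2}`. -/
def h1Norm (u : E3 → ℝ) : ℝ≥0∞ :=
  (∑ k ∈ Finset.range 2, ∑ α ∈ Finset.Nat.antidiagonalTuple 3 k,
    weightedNorm 0 α u ^ 2) ^ (1 / 2 : ℝ)

/-- The non-homogeneous weighted Gevrey class `J^ϖ_γ(Q; C, A, 𝔡)`. The orders `s` are those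
with `s > γ - 3/2`, that is, all `s ≥ 1` if `3/2 < γ < 5/2`. -/
structure MemGevreyClass (γ C A 𝔡 : ℝ) (u : E3 → ℝ) : Prop where
  jNorm_lt_top : ∀ s : ℕ, γ - 3 / 2 < s → jNorm s γ u < ⊤
  kSeminorm_le : ∀ s : ℕ, γ - 3 / 2 < s →
    kSeminorm s γ u ≤ ENNReal.ofReal (C * A ^ s * (s.factorial : ℝ) ^ 𝔡)

/-- The point with `i`-th coordinate `1` and remaining coordinates `y`; these points, for
`y ∈ (0,1)^2`, form the open face `{x_i = 1}` of the cube. -/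
def facePoint (i : Fin 3) (y : Fin 2 → ℝ) : E3 :=
  WithLp.toLp 2 (i.insertNth (α := fun _ => ℝ) 1 y)

/-- The space `H¹_Γ(Q)` of functions in `H¹(Q)` with zero trace on `Γ`, the union of the three
faces `{x_i = 1}`. The trace is the `L²(Γ)`-limit of the restrictions to `Γ` of smooth functions
that converge to `u` in `H¹(Q)`. -/
structure MemH1Gamma (u : E3 → ℝ) : Prop where
  h1Norm_lt_top : h1Norm u < ⊤
  trace_eq_zero : ∃ φ : ℕ → E3 → ℝ, (∀ n, ContDiff ℝ ∞ (φ n)) ∧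
    Tendsto (fun n => h1Norm (u - φ n)) atTop (𝓝 0) ∧
    ∀ i : Fin 3, Tendsto
      (fun n => eLpNorm (fun y => φ n (facePoint i y)) 2
        (volume.restrict {y : Fin 2 → ℝ | ∀ j, y j ∈ Set.Ioo (0 : ℝ) 1}))
      atTop (𝓝 0)

/-! ### The `ℚ₁` finite element space on the uniform mesh of size `2^{-ℓ}` -/

/-- Three-way arrays of size `2^ℓ × 2^ℓ × 2^ℓ`. -/
abbrev Tensor3 (ℓ : ℕ) : Type := Fin (2 ^ ℓ) → Fin (2 ^ ℓ) → Fin (2 ^ ℓ) → ℝ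

/-- The mesh node `x_{i,j,k} = 2^{-ℓ} (i, j, k)`. -/
def node (ℓ i j k : ℕ) : E3 :=
  WithLp.toLp 2 ![(i : ℝ) / 2 ^ ℓ, (j : ℝ) / 2 ^ ℓ, (k : ℝ) / 2 ^ ℓ]

/-- The univariate nodal hat function at `2^{-ℓ} i`. -/
def hat (ℓ i : ℕ) (t : ℝ) : ℝ := max 0 (1 - |2 ^ ℓ * t - i|)

/-- The continuous, piecewise trilinear nodal Lagrange function of the node `x_{i,j,k}`. -/
def lagrange (ℓ i j k : ℕ) (x : E3) : ℝ := hat ℓ i (x 0) * hat ℓ j (x 1) * hat ℓ k (x 2)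

/-- The finite element space `X^ℓ`, spanned by the Lagrange functions of the nodes
`x_{i,j,k}` with `0 ≤ i, j, k ≤ 2^ℓ - 1`. -/
def feSpace (ℓ : ℕ) : Submodule ℝ (E3 → ℝ) :=
  Submodule.span ℝ {f | ∃ i j k : Fin (2 ^ ℓ), f = lagrange ℓ i j k}

/-- The analysis operator: the coefficient tensor `v(x_{i,j,k})` of `v ∈ X^ℓ`. -/
def analysis (ℓ : ℕ) (v : E3 → ℝ) : Tensor3 ℓ := fun i j k => v (node ℓ i j k)

/-! ### Tensor trains and quantized tensor formats -/

/-- A train of `d` cores `U^1, …, U^d` with mode size `n` and ranks `r_0, …, r_d`; the `k`-th core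
maps a mode index to an `r_{k-1} × r_k` matrix (positions are counted from `0` here). -/
structure TensorTrain (d n : ℕ) where
  rank : Fin (d + 1) → ℕ
  rank_pos : ∀ k, 0 < rank k
  core : (k : Fin d) → Fin n → Matrix (Fin (rank k.castSucc)) (Fin (rank k.succ)) ℝ

/-- The matrix product `U^1(i_1) ⋯ U^d(i_d)`, of size `r_0 × r_d`. -/
def TensorTrain.eval {d n : ℕ} (T : TensorTrain d n) (i : Fin d → Fin n) :
    Matrix (Fin (T.rank 0)) (Fin (T.rank (Fin.last d))) ℝ :=
  Fin.induction (motive := fun k => Matrix (Fin (T.rank 0)) (Fin (T.rank k)) ℝ) 1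
    (fun k P => P * T.core k (i k)) (Fin.last d)

/-- The number of entries of all the cores. -/
def TensorTrain.numParams {d n : ℕ} (T : TensorTrain d n) : ℕ :=
  ∑ k : Fin d, n * T.rank k.castSucc * T.rank k.succ

/-- The index with binary digits `i_1 … i_m`, most significant digit first. -/
def digits {m : ℕ} (i : Fin m → Fin 2) : Fin (2 ^ m) := finFunctionFinEquiv (i ∘ Fin.rev)

/-- `A` admits a classic QTT decomposition with `N` parameters: a train of `3ℓ` cores with
`r_0 = r_{3ℓ} = 1` for the ordering `i_1, …, i_ℓ, j_1, …, j_ℓ, k_1, …, k_ℓ` of the digits. -/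
def AdmitsQTT (ℓ : ℕ) (A : Tensor3 ℓ) (N : ℕ) : Prop :=
  ∃ T : TensorTrain (ℓ + ℓ + ℓ) 2, T.rank 0 = 1 ∧ T.rank (Fin.last _) = 1 ∧ T.numParams = N ∧
    ∀ (i j k : Fin ℓ → Fin 2) a b,
      A (digits i) (digits j) (digits k) = T.eval (Fin.append (Fin.append i j) k) a b

/-- `A` admits a transposed order QTT decomposition with `N` parameters: a train of `ℓ` cores with
`r_0 = r_ℓ = 1` and mode size `8`, the `n`-th mode index having binary digits `i_n j_n k_n`. -/
def AdmitsQT3 (ℓ : ℕ) (A : Tensor3 ℓ) (N : ℕ) : Prop :=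
  ∃ T : TensorTrain ℓ (2 ^ 3), T.rank 0 = 1 ∧ T.rank (Fin.last _) = 1 ∧ T.numParams = N ∧
    ∀ (i j k : Fin ℓ → Fin 2) a b,
      A (digits i) (digits j) (digits k) = T.eval (fun n => digits ![i n, j n, k n]) a b

/-- `A` admits a Tucker-QTT decomposition with `N` parameters: a Tucker core `G` of size
`R_1 × R_2 × R_3` and Tucker factors given by trains of `ℓ` cores, of first rank `R_1`, `R_2`,
`R_3` respectively and last rank `1`. -/
def AdmitsTQTT (ℓ : ℕ) (A : Tensor3 ℓ) (N : ℕ) : Prop :=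
  ∃ (U V W : TensorTrain ℓ 2)
    (G : Fin (U.rank 0) → Fin (V.rank 0) → Fin (W.rank 0) → ℝ),
    U.rank (Fin.last _) = 1 ∧ V.rank (Fin.last _) = 1 ∧ W.rank (Fin.last _) = 1 ∧
    U.rank 0 * V.rank 0 * W.rank 0 + U.numParams + V.numParams + W.numParams = N ∧
    ∀ (i j k : Fin ℓ → Fin 2) a b c,
      A (digits i) (digits j) (digits k) =
        ∑ β₁, ∑ β₂, ∑ β₃, G β₁ β₂ β₃ * U.eval i β₁ a * V.eval j β₂ b * W.eval k β₃ c

/-- The three quantized tensor formats: classic QTT, transposed order QTT, Tucker-QTT. -/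
inductive Format
  | qtt
  | qt3
  | tqtt

/-- `A` admits a representation in the given format with `N` degrees of freedom. -/
def Format.Admits (F : Format) (ℓ : ℕ) (A : Tensor3 ℓ) (N : ℕ) : Prop :=
  match F with
  | .qtt => AdmitsQTT ℓ A N
  | .qt3 => AdmitsQT3 ℓ A N
  | .tqtt => AdmitsTQTT ℓ A N

/-- The exponent `κ` in the bound on the number of degrees of freedom. -/
def Format.kappa (F : Format) (𝔡 : ℝ) : ℝ :=
  match F with
  | .qtt => 4 * 𝔡 + 3
  | .qt3 => 6 * 𝔡 + 1
  | .tqtt => 3 * 𝔡 + 3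

end QTTApprox

end

/-! Let h = 2^-ℓ and r = |x|. Weakening the weights to the critical exponent 3/2 and scaling, the
derivatives of order s ≥ 2 are at most C A^s (s!)^𝔡 / r^s pointwise, and the gradient is at most C /
r. These bounds are scale invariant. Cut the dyadic shell of nodes with 2^M ≤ max(i,j,k) < 2^(M+1)
into blocks of side 2^(M-K). A block is smaller than its distance from the origin by a factor 2^-K,
so a Taylor polynomial of degree below s at its corner is wrong by at most C (3A/2^K)^s (s!)^(𝔡-1).
This is below C 2^-s once 2^K is of order s^(𝔡-1) (`blockTaylor_error`, `taylor_factor_le`). With s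
= 2ℓ the error is C h², which survives the factor 1/h that difference quotients cost. Interpolation
of the gradient costs h/r² away from the origin and 1/r in the cell at the origin. Both are below a
multiple of h^(1/4) r^(-5/4), which is square integrable in dimension three
(`exists_interpolation_bound`). The H¹ error is therefore of order h^(1/4), and ℓ of order |log ε|
suffices.

The array so obtained is polynomial on blocks (`IsBlockPoly`). A tensor train exists as soon as all
unfoldings have small rank (`exists_train`), and an unfolding has small rank because fixing some
digits leaves a function that is polynomial on the level sets of a label with few values
(`IsBlockPoly.comp_mem_span`). With D = 2^(K+1) s, of order ℓ^𝔡, the ranks are of order ℓ D² for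
classic QTT, D³ for transposed order and ℓ D for the Tucker factors. The entries then number ℓ³D⁴,
ℓD⁶ and ℓ³D³ up to constants, which gives the three exponents.

Since u is only weakly differentiable, it is first replaced by a smooth w: the cube is shrunk into
its interior and u is averaged there (`exists_smooth_approx`). This keeps every weighted bound up to
a fixed factor, so the constants do not depend on how close w is to u, and that distance can be
chosen after ℓ. A Sobolev inequality with mixed derivatives on cubes of side x_i/2 yields the
pointwise bounds (`exists_pointwiseBounds`). The zero trace makes w uniformly small on Γ
(`HasPointwiseBounds.face_small`), which justifies zero coefficients there. -/

namespace QTTApprox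

/-! ### Ranks of two-way arrays -/

/-- The two-way array `B` has rank at most `R`. -/
def HasRank {X Y : Type*} (R : ℕ) (B : X → Y → ℝ) : Prop :=
  ∃ (f : Fin R → X → ℝ) (e : Fin R → Y → ℝ), ∀ x y, B x y = ∑ c, f c x * e c y

section HasRank

variable {X Y : Type*} {R R' : ℕ} {B B' : X → Y → ℝ}

/-- The indices of `Fin R` not reached by an embedding of `ι` carry zero factors. -/
lemma HasRank.of_fintype {ι : Type*} [Fintype ι] (f : ι → X → ℝ) (e : ι → Y → ℝ)
    (h : ∀ x y, B x y = ∑ c, f c x * e c y) (hR : Fintype.card ι ≤ R) : HasRank R B := by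
  classical
  obtain ⟨φ⟩ := Function.Embedding.nonempty_of_card_le (α := ι) (β := Fin R) (by simpa using hR)
  refine ⟨Function.extend φ f 0, Function.extend φ e 0, fun x y => ?_⟩
  rw [h]
  refine Fintype.sum_of_injective φ φ.injective _ _ ?_ ?_
  · intro i hi
    rw [Function.extend_apply' _ _ _ (by simpa using hi)]
    simp
  · intro i
    simp [φ.injective.extend_apply]

lemma HasRank.mono (h : HasRank R B) (hR : R ≤ R') : HasRank R' B := by
  obtain ⟨f, e, h⟩ := h
  exact HasRank.of_fintype f e h (by simpa using hR)

lemma HasRank.of_mem_span_right {ι : Type*} [Fintype ι] (e : ι → Y → ℝ)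
    (h : ∀ x, B x ∈ Submodule.span ℝ (Set.range e)) (hR : Fintype.card ι ≤ R) :
    HasRank R B := by
  simp only [Submodule.mem_span_range_iff_exists_fun] at h
  choose c hc using h
  refine HasRank.of_fintype (fun i x => c x i) e (fun x y => ?_) hR
  rw [← hc x]
  simp

lemma HasRank.of_mem_span_left {ι : Type*} [Fintype ι] (e : ι → X → ℝ)
    (h : ∀ y, (fun x => B x y) ∈ Submodule.span ℝ (Set.range e)) (hR : Fintype.card ι ≤ R) :
    HasRank R B := by
  simp only [Submodule.mem_span_range_iff_exists_fun] at h
  choose c hc using h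
  refine HasRank.of_fintype e (fun i y => c y i) (fun x y => ?_) hR
  have := congrFun (hc y) x
  simp only [Finset.sum_apply, Pi.smul_apply, smul_eq_mul] at this
  rw [← this]
  exact Finset.sum_congr rfl fun i _ => mul_comm _ _

lemma HasRank.add (h : HasRank R B) (h' : HasRank R' B') :
    HasRank (R + R') (fun x y => B x y + B' x y) := by
  obtain ⟨f, e, h⟩ := h
  obtain ⟨f', e', h'⟩ := h'
  refine HasRank.of_fintype (ι := Fin R ⊕ Fin R') (Sum.elim f f') (Sum.elim e e')
    (fun x y => ?_) (by simp)
  simp [h, h']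

/-- The rows of an array of rank at most `R` have a spanning family of `R` elements
which are themselves combinations of rows. -/
lemma HasRank.exists_spanning (h : HasRank R B) :
    ∃ e : ℕ → Y → ℝ, (∀ a, e a ∈ Submodule.span ℝ (Set.range B)) ∧
      ∀ x, B x ∈ Submodule.span ℝ (Set.range fun a : Fin R => e a) := by
  classical
  obtain ⟨f, g, h⟩ := h
  set S := Submodule.span ℝ (Set.range B)
  set W := Submodule.span ℝ (Set.range g)
  have hle : S ≤ W := by
    refine Submodule.span_le.2 ?_
    rintro _ ⟨x, rfl⟩
    refine Submodule.mem_span_range_iff_exists_fun ℝ |>.2 ⟨fun c => f c x, ?_⟩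
    ext y
    simp [h]
  have hW : FiniteDimensional ℝ W := FiniteDimensional.span_of_finite ℝ (Set.finite_range g)
  have hS : FiniteDimensional ℝ S := Submodule.finiteDimensional_of_le hle
  have hr : Module.finrank ℝ S ≤ R :=
    (Submodule.finrank_mono hle).trans ((finrank_range_le_card g).trans (by simp))
  let b := Module.finBasis ℝ S
  -- A basis of the row space itself, rather than the given factors, keeps every element a
  -- combination of rows. Indices beyond the dimension get zero.
  let e : ℕ → Y → ℝ := fun a => if h : a < Module.finrank ℝ S then (b ⟨a, h⟩ : Y → ℝ) else 0
  refine ⟨e, fun a => ?_, fun x => ?_⟩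
  · by_cases ha : a < Module.finrank ℝ S
    · simp only [e, ha, dif_pos]
      exact (b ⟨a, ha⟩).2
    · simp only [e, ha, dif_neg, not_false_eq_true]
      exact S.zero_mem
  · have hx : B x ∈ S := Submodule.subset_span ⟨x, rfl⟩
    have hb : (⟨B x, hx⟩ : S) ∈ Submodule.span ℝ (Set.range b) := by
      rw [b.span_eq]; trivial
    have hb' := Submodule.mem_map_of_mem (f := S.subtype) hb
    rw [Submodule.map_span, ← Set.range_comp] at hb'
    refine Submodule.span_mono ?_ hb'
    rintro _ ⟨i, rfl⟩
    refine ⟨⟨i, i.2.trans_le hr⟩, ?_⟩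
    simp [e]

end HasRank

/-! ### Tensor trains from unfolding ranks -/

/-- The string that agrees with `x` before position `q` and with `y` from position `q` on. -/
def mix {d n : ℕ} (q : ℕ) (x y : Fin d → Fin n) : Fin d → Fin n :=
  fun k => if (k : ℕ) < q then x k else y k

/-- Fixing digit `q` moves it from the free suffix to the bound prefix. This turns rows of the
unfolding at `q` into rows of the unfolding at `q + 1`. -/
lemma mix_update {d n : ℕ} (q : Fin d) (x y : Fin d → Fin n) (c : Fin n) :
    mix q x (Function.update y q c) = mix (q + 1) (Function.update x q c) y := by
  funext k
  rcases lt_trichotomy (k : ℕ) q with h | h | h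
  · have hk : k ≠ q := fun e => by simp [e] at h
    simp [mix, h, h.trans (Nat.lt_succ_self _), hk]
  · obtain rfl := Fin.ext h
    simp [mix]
  · have hk : k ≠ q := fun e => by simp [e] at h
    have h1 : ¬ ((k : ℕ) < q) := by omega
    have h2 : ¬ ((k : ℕ) < q + 1) := by omega
    simp [mix, h1, h2, hk]

/-- The train with ranks `ρ` and cores cut out of infinite matrices. -/
def seqTrain (d n : ℕ) (ρ : ℕ → ℕ) (hρ : ∀ k, 0 < ρ k) (M : ℕ → Fin n → ℕ → ℕ → ℝ) :
    TensorTrain d n where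
  rank k := ρ k
  rank_pos k := hρ k
  core k i := Matrix.of fun a b => M k i a b

/-- The product of the first `k` cores, applied to the vector `e k`, does not change with `k`: it is
`e 0` at the start and the full matrix product at the end, where `e d` is the constant 1. -/
lemma seqTrain_eval {d n : ℕ} {ρ : ℕ → ℕ} {hρ : ∀ k, 0 < ρ k} {M : ℕ → Fin n → ℕ → ℕ → ℝ}
    (e : ℕ → ℕ → (Fin d → Fin n) → ℝ)
    (he : ∀ (k : Fin d) (a : ℕ), a < ρ k → ∀ y,
      e k a y = ∑ b : Fin (ρ (k + 1)), M k (y k) a b * e (k + 1) b y)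
    (hlast : ∀ b y, b < ρ d → e d b y = 1) (hd : ρ d = 1) (y : Fin d → Fin n) (a b) :
    (seqTrain d n ρ hρ M).eval y a b = e 0 (a : ℕ) y := by
  have key : ∀ k : Fin (d + 1), ∀ a : Fin (ρ 0), e 0 a y = ∑ c : Fin (ρ k),
      (Fin.induction (motive := fun k => Matrix (Fin ((seqTrain d n ρ hρ M).rank 0))
        (Fin ((seqTrain d n ρ hρ M).rank k)) ℝ) 1
        (fun k P => P * (seqTrain d n ρ hρ M).core k (y k)) k : Matrix (Fin (ρ 0)) (Fin (ρ k)) ℝ)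
        a c * e k c y := by
    intro k a
    induction k using Fin.induction with
    | zero =>
      simp only [Fin.induction_zero]
      change e 0 a y = ∑ c : Fin (ρ 0), (1 : Matrix (Fin (ρ 0)) (Fin (ρ 0)) ℝ) a c * e 0 c y
      simp [Matrix.one_apply]
    | succ k ih =>
      rw [ih]
      simp only [Fin.induction_succ]
      have h1 : ∀ c : Fin (ρ k), e k c y = _ := fun c => he k c c.2 y
      change ∑ c : Fin (ρ k), _ * e k c y = ∑ c : Fin (ρ (k + 1)), (∑ j : Fin (ρ k), _ *
        M k (y k) j c) * e (k + 1) c y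
      simp only [h1, Finset.mul_sum, Finset.sum_mul]
      rw [Finset.sum_comm]
      refine Finset.sum_congr rfl fun c _ => Finset.sum_congr rfl fun j _ => ?_
      rw [mul_assoc]
  have h := key (Fin.last d) a
  have hsub : Subsingleton (Fin (ρ (Fin.last d : Fin (d+1)))) := by
    rw [Fin.val_last, hd]; infer_instance
  rw [h]
  let b' : Fin (ρ (Fin.last d : Fin (d+1))) := b
  rw [Fintype.sum_subsingleton _ b']
  have h1 : e (Fin.last d : Fin (d + 1)) b' y = 1 := hlast _ _ b'.2
  rw [h1, mul_one]
  rfl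

/-- A family of functions of digit strings, all of whose unfoldings have rank at most `R`, is
the family of entries of a tensor train with ranks at most `R`. -/
theorem exists_train {d n R₀ R : ℕ} (hd : 0 < d) (hR₀ : 0 < R₀) (hR : R₀ ≤ R)
    (g : Fin R₀ → (Fin d → Fin n) → ℝ)
    (H : ∀ q, 0 < q → q < d →
      HasRank R (fun (p : Fin R₀ × (Fin d → Fin n)) y => g p.1 (mix q p.2 y))) :
    ∃ (T : TensorTrain d n) (hr : T.rank 0 = R₀), T.rank (Fin.last d) = 1 ∧
      T.numParams ≤ d * (n * R * R) ∧ ∀ y a b, T.eval y a b = g (Fin.cast hr a) y := by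
  classical
  set B : ℕ → (Fin R₀ × (Fin d → Fin n)) → (Fin d → Fin n) → ℝ :=
    fun q p y => g p.1 (mix q p.2 y) with hB
  -- The vectors attached to cut `q`: the given functions at `q = 0`, so that the first rank is
  -- exactly `R₀`; the constant 1 at `q = d`, so that the last rank is 1; in between, a spanning
  -- family of the row space that lies in the row space. The last property is what makes the
  -- recursion for the cores solvable.
  have step : ∀ q : ℕ, ∃ (ρ : ℕ) (e : ℕ → (Fin d → Fin n) → ℝ), 0 < ρ ∧ ρ ≤ R ∧
      (q = 0 → ρ = R₀ ∧ ∀ a : Fin R₀, e a = g a) ∧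
      (q = d → ρ = 1 ∧ e = fun _ _ => 1) ∧
      (q < d → ∀ a < ρ, e a ∈ Submodule.span ℝ (Set.range (B q))) ∧
      (q ≤ d → ∀ p, B q p ∈ Submodule.span ℝ (Set.range fun a : Fin ρ => e a)) := by
    intro q
    rcases Nat.eq_zero_or_pos q with rfl | hq0
    · have hB0 : ∀ p, B 0 p = g p.1 := fun p => by
        funext y
        have : mix 0 p.2 y = y := by funext k; simp [mix]
        simp [hB, this]
      refine ⟨R₀, fun a => if h : a < R₀ then g ⟨a, h⟩ else 0, hR₀, hR, fun _ => ⟨rfl, ?_⟩,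
        fun h => absurd h hd.ne, fun _ a ha => ?_, fun _ p => ?_⟩
      · intro a; simp
      · simp only [ha, dif_pos]
        rcases isEmpty_or_nonempty (Fin d → Fin n) with h0 | ⟨⟨x⟩⟩
        · have : g ⟨a, ha⟩ = 0 := funext fun y => (h0.false y).elim
          rw [this]; exact Submodule.zero_mem _
        · refine Submodule.subset_span ⟨(⟨a, ha⟩, x), hB0 _⟩
      · rw [hB0]
        exact Submodule.subset_span ⟨p.1, by simp⟩
    rcases lt_trichotomy q d with hqd | rfl | hqd
    · obtain ⟨e, he1, he2⟩ := (H q hq0 hqd).exists_spanning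
      exact ⟨R, e, hR₀.trans_le hR, le_rfl, fun h => absurd h hq0.ne', fun h => absurd h hqd.ne,
        fun _ a _ => he1 a, fun _ p => he2 p⟩
    · refine ⟨1, fun _ _ => 1, one_pos, hR₀.trans_le hR, fun h => absurd h hq0.ne',
        fun _ => ⟨rfl, rfl⟩, fun h => absurd h (lt_irrefl _), fun _ p => ?_⟩
      have : B q p = g p.1 p.2 • (fun _ => 1) := by
        funext y
        have : mix q p.2 y = p.2 := by funext k; simp [mix, k.2]
        simp [hB, this]
      rw [this]
      exact Submodule.smul_mem _ _ (Submodule.subset_span ⟨0, rfl⟩)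
    · exact ⟨1, fun _ _ => 1, one_pos, hR₀.trans_le hR, fun h => absurd h hq0.ne',
        fun h => absurd h hqd.ne', fun h => absurd h hqd.not_gt, fun h => absurd h hqd.not_ge⟩
  choose ρ e hρ hρR hzero hlast hmem hspan using step
  -- A row at cut `q` with digit `q` fixed is a row at cut `q + 1`. Hence fixing that digit maps `e
  -- q a` into the span of the vectors of the next cut, and the coefficients are the entries of the
  -- core.
  have trans : ∀ (q : ℕ) (c : Fin n) (a : ℕ), ∃ m : ℕ → ℝ, ∀ hq : q < d, a < ρ q →
      ∀ y, e q a (Function.update y ⟨q, hq⟩ c) =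
        ∑ b : Fin (ρ (q + 1)), m b * e (q + 1) b y := by
    intro q c a
    by_cases hq : q < d
    swap
    · exact ⟨0, fun h => absurd h hq⟩
    by_cases ha : a < ρ q
    swap
    · exact ⟨0, fun _ h => absurd h ha⟩
    let L : ((Fin d → Fin n) → ℝ) →ₗ[ℝ] ((Fin d → Fin n) → ℝ) :=
      LinearMap.funLeft ℝ ℝ (fun y => Function.update y ⟨q, hq⟩ c)
    have h1 : L (e q a) ∈ Submodule.span ℝ (Set.range (B (q + 1))) := by
      have := Submodule.mem_map_of_mem (f := L) (hmem q hq a ha)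
      rw [Submodule.map_span, ← Set.range_comp] at this
      refine Submodule.span_mono ?_ this
      rintro _ ⟨p, rfl⟩
      refine ⟨(p.1, Function.update p.2 ⟨q, hq⟩ c), ?_⟩
      funext y
      simp only [hB, L, Function.comp_apply, LinearMap.funLeft_apply]
      rw [mix_update ⟨q, hq⟩]
    have h2 : L (e q a) ∈
        Submodule.span ℝ (Set.range fun b : Fin (ρ (q + 1)) => e (q + 1) b) := by
      refine (Submodule.span_le.2 ?_) h1
      rintro _ ⟨p, rfl⟩
      exact hspan (q + 1) hq p
    obtain ⟨m, hm⟩ := (Submodule.mem_span_range_iff_exists_fun ℝ).1 h2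
    refine ⟨fun b => if h : b < ρ (q + 1) then m ⟨b, h⟩ else 0, fun _ _ y => ?_⟩
    have := congrFun hm y
    simp only [Finset.sum_apply, Pi.smul_apply, smul_eq_mul, L, LinearMap.funLeft_apply] at this
    rw [← this]
    simp
  choose m hm using trans
  let T := seqTrain d n ρ hρ (fun k c a b => m k c a b)
  have hr : T.rank 0 = R₀ := (hzero 0 rfl).1
  refine ⟨T, hr, ?_, ?_, fun y a b => ?_⟩
  · change ρ _ = 1
    rw [Fin.val_last]
    exact (hlast d rfl).1
  · refine (Finset.sum_le_card_nsmul _ _ (n * R * R) fun k _ => ?_).trans (by simp)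
    exact Nat.mul_le_mul (Nat.mul_le_mul le_rfl (hρR _)) (hρR _)
  · have := seqTrain_eval (hρ := hρ) (M := fun k c a b => m k c a b) e
      (fun k a ha y => ?_) (fun b y _ => by rw [(hlast d rfl).2]) (hlast d rfl).1 y a b
    · refine this.trans ?_
      exact congrFun ((hzero 0 rfl).2 (Fin.cast hr a)) y
    · rw [← hm k (y k) a k.2 ha y]
      simp

end QTTApprox

namespace QTTApprox

lemma HasRank.mul_left {X Y : Type*} {R : ℕ} {B : X → Y → ℝ} (h : HasRank R B) (f : X → ℝ) :
    HasRank R (fun x y => f x * B x y) := by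
  obtain ⟨g, e, h⟩ := h
  refine ⟨fun c x => f x * g c x, e, fun x y => ?_⟩
  simp only [h, Finset.mul_sum, mul_assoc]

/-! ### Binary digits -/

lemma coe_digits_cons {m : ℕ} (c : Fin 2) (i : Fin m → Fin 2) :
    (digits (Fin.cons c i : Fin (m + 1) → Fin 2) : ℕ) = 2 ^ m * c + digits i := by
  simp only [digits, finFunctionFinEquiv_apply]
  rw [Fin.sum_univ_castSucc]
  simp only [Function.comp_apply, Fin.rev_castSucc, Fin.cons_succ, Fin.val_castSucc,
    Fin.rev_last, Fin.cons_zero, Fin.val_last]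
  ring

/-- The most significant digit comes first, so a prefix of length `q` fixes the quotient by `2 ^ (ℓ
- q)` and the suffix fixes the remainder. -/
lemma coe_digits_mix {ℓ : ℕ} (q : ℕ) (x y : Fin ℓ → Fin 2) :
    (digits (mix q x y) : ℕ) = 2 ^ (ℓ - q) * ((digits x : ℕ) / 2 ^ (ℓ - q))
      + (digits y : ℕ) % 2 ^ (ℓ - q) := by
  induction ℓ generalizing q with
  | zero =>
    have h1 : mix q x y = x := Subsingleton.elim _ _
    rw [h1]
    simp [Nat.mod_one]
  | succ ℓ ih =>
    cases q with
    | zero =>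
      have h1 : mix 0 x y = y := by funext k; simp [mix]
      rw [h1, Nat.sub_zero, Nat.div_eq_of_lt (digits x).2, Nat.mod_eq_of_lt (digits y).2]
      simp
    | succ q =>
      obtain ⟨a, x, rfl⟩ : ∃ a x', x = Fin.cons a x' := ⟨x 0, Fin.tail x, (Fin.cons_self_tail x).symm⟩
      obtain ⟨b, y, rfl⟩ : ∃ a x', y = Fin.cons a x' := ⟨y 0, Fin.tail y, (Fin.cons_self_tail y).symm⟩
      have h1 : mix (q + 1) (Fin.cons a x : Fin (ℓ + 1) → Fin 2) (Fin.cons b y)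
          = Fin.cons a (mix q x y) := by
        funext k
        refine Fin.cases ?_ (fun k => ?_) k
        · simp [mix]
        · simp [mix]
      rw [h1, coe_digits_cons, coe_digits_cons, coe_digits_cons, ih, Nat.add_sub_add_right]
      obtain ⟨z, hz⟩ : 2 ^ (ℓ - q) ∣ 2 ^ ℓ := pow_dvd_pow 2 (Nat.sub_le _ _)
      have hp : 0 < 2 ^ (ℓ - q) := by positivity
      generalize 2 ^ (ℓ - q) = w at hz hp ⊢
      generalize (digits x : ℕ) = X
      generalize (digits y : ℕ) = Y
      rw [hz, mul_assoc, mul_assoc, Nat.mul_add_div hp, Nat.mul_add_mod]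
      ring

lemma div_two_pow_lt {N n K : ℕ} (h : N < 2 ^ n) : N / 2 ^ (n - K) < 2 ^ K := by
  rw [Nat.div_lt_iff_lt_mul (by positivity), ← pow_add]
  exact h.trans_le (Nat.pow_le_pow_right two_pos (by omega))

lemma div_two_pow_of_le {a b N : ℕ} (h : a ≤ b) : N / 2 ^ b = N / 2 ^ a / 2 ^ (b - a) := by
  rw [Nat.div_div_eq_div_mul, ← pow_add, Nat.add_sub_cancel' h]

lemma shift_div_two_pow {n K I i : ℕ} :
    (2 ^ n * I + i) / 2 ^ (n - K) = 2 ^ (n - (n - K)) * I + i / 2 ^ (n - K) := by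
  have : 2 ^ n = 2 ^ (n - K) * 2 ^ (n - (n - K)) := by
    rw [← pow_add]; congr 1; omega
  rw [this, mul_assoc, Nat.mul_add_div (by positivity)]

lemma log_shift {n I i : ℕ} (hi : i < 2 ^ n) (hI : I ≠ 0) :
    Nat.log 2 (2 ^ n * I + i) = n + Nat.log 2 I := by
  have h := Nat.log_div_base_pow 2 (2 ^ n * I + i) n
  rw [Nat.mul_add_div (by positivity), Nat.div_eq_of_lt hi, add_zero] at h
  have h2 : n ≤ Nat.log 2 (2 ^ n * I + i) := by
    refine Nat.le_log_of_pow_le one_lt_two ?_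
    calc 2 ^ n = 2 ^ n * 1 := by ring
      _ ≤ 2 ^ n * I := Nat.mul_le_mul le_rfl (Nat.pos_of_ne_zero hI)
      _ ≤ _ := Nat.le_add_right _ _
  omega

/-! ### Block labels -/

/-- The dyadic level of `i` and its position among the blocks of length `2 ^ (level - K)`. -/
def blockLabel (K i : ℕ) : ℕ × ℕ := (Nat.log 2 i, i / 2 ^ (Nat.log 2 i - K))

/-- The blocks at the level of `i` itself are the finest: `2 ^ (log i - K)` divides `2 ^ (M - K)`
for every larger `M`. So the label of one index fixes its block in any triple, whose level is the
maximum of three levels. -/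
lemma blockLabel_div {K M i i' : ℕ} (h : blockLabel K i = blockLabel K i')
    (hM : Nat.log 2 i ≤ M) : i / 2 ^ (M - K) = i' / 2 ^ (M - K) := by
  simp only [blockLabel, Prod.mk.injEq] at h
  obtain ⟨h1, h2⟩ := h
  rw [← h1] at h2
  have : Nat.log 2 i - K ≤ M - K := by omega
  rw [div_two_pow_of_le this, h2, ← div_two_pow_of_le this]

lemma suffix_div {K M n I i i' : ℕ} (h : i / 2 ^ (n - K) = i' / 2 ^ (n - K)) (hM : n ≤ M) :
    (2 ^ n * I + i) / 2 ^ (M - K) = (2 ^ n * I + i') / 2 ^ (M - K) := by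
  have : n - K ≤ M - K := by omega
  rw [div_two_pow_of_le this, div_two_pow_of_le this (N := 2 ^ n * I + i'), shift_div_two_pow,
    shift_div_two_pow, h]

/-- If the prefix `I` is nonzero, it alone determines the level of the whole index, and the blocks
of that level cut the suffix no finer than the blocks of the suffix do. If `I = 0`, the index is the
suffix. -/
lemma blockLabel_suffix {K n I i i' : ℕ} (hi : i < 2 ^ n) (hi' : i' < 2 ^ n)
    (h : blockLabel K i = blockLabel K i') :
    blockLabel K (2 ^ n * I + i) = blockLabel K (2 ^ n * I + i') := by
  rcases eq_or_ne I 0 with rfl | hI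
  · simpa using h
  have hl : Nat.log 2 i ≤ n := by
    rcases eq_or_ne i 0 with rfl | h0
    · simp
    · exact (Nat.log_lt_of_lt_pow h0 hi).le
  have := blockLabel_div h hl
  simp only [blockLabel, log_shift hi hI, log_shift hi' hI, Prod.mk.injEq, true_and]
  exact suffix_div this (Nat.le_add_right _ _)

/-- Below level `K` blocks are single indices, so equal labels mean equal prefixes. From level `K`
on, appending `n` digits multiplies the block length by `2 ^ n` and leaves the block number
unchanged. -/
lemma blockLabel_prefix {K n I I' i : ℕ} (hi : i < 2 ^ n)
    (h : blockLabel K I = blockLabel K I') :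
    blockLabel K (2 ^ n * I + i) = blockLabel K (2 ^ n * I' + i) := by
  simp only [blockLabel, Prod.mk.injEq] at h
  obtain ⟨h1, h2⟩ := h
  rcases lt_or_ge (Nat.log 2 I) K with hK | hK
  · have h3 : Nat.log 2 I - K = 0 := by omega
    rw [← h1, h3] at h2
    simp only [pow_zero, Nat.div_one] at h2
    rw [h2]
  · rcases eq_or_ne I 0 with rfl | hI
    · rw [← h1] at h2
      simp only [Nat.log_zero_right, Nat.zero_sub, pow_zero, Nat.div_one] at h2
      rw [← h2]
    have hI' : I' ≠ 0 := by
      rintro rfl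
      rw [h1] at h2
      simp only [Nat.log_zero_right, Nat.zero_sub, pow_zero, Nat.div_one] at h2
      exact hI h2
    simp only [blockLabel, log_shift hi hI, log_shift hi hI', ← h1, Prod.mk.injEq, true_and]
    rw [← h1] at h2
    have hn : n ≤ n + Nat.log 2 I - K := by omega
    have e1 : n + Nat.log 2 I - K - n = Nat.log 2 I - K := by omega
    rw [div_two_pow_of_le hn, div_two_pow_of_le hn (N := 2 ^ n * I' + i), e1,
      Nat.mul_add_div (by positivity), Nat.mul_add_div (by positivity), Nat.div_eq_of_lt hi,
      add_zero, add_zero, h2]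

lemma blockLabel_snd_lt {K i : ℕ} : (blockLabel K i).2 < 2 ^ (K + 1) := by
  have h := Nat.lt_pow_succ_log_self one_lt_two i
  have := div_two_pow_lt (K := K + 1) h
  simpa [blockLabel, Nat.add_sub_add_right] using this

/-- The block label as an element of a finite type, for `i < 2 ^ ℓ`. -/
def finLabel (ℓ K : ℕ) [NeZero ℓ] (i : ℕ) : Fin ℓ × Fin (2 ^ (K + 1)) :=
  (Fin.ofNat ℓ (blockLabel K i).1, ⟨(blockLabel K i).2, blockLabel_snd_lt⟩)

/-- `Fin.ofNat` reduces the level modulo `ℓ`. Nothing is lost, since an index below `2 ^ ℓ` has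
level below `ℓ`. -/
lemma finLabel_eq {ℓ K : ℕ} [NeZero ℓ] {i i' : ℕ} (hi : i < 2 ^ ℓ) (hi' : i' < 2 ^ ℓ)
    (h : finLabel ℓ K i = finLabel ℓ K i') : blockLabel K i = blockLabel K i' := by
  have hlog : ∀ {i : ℕ}, i < 2 ^ ℓ → Nat.log 2 i < ℓ := by
    intro i hi
    rcases eq_or_ne i 0 with rfl | h0
    · simpa using Nat.pos_of_ne_zero (NeZero.ne ℓ)
    · exact Nat.log_lt_of_lt_pow h0 hi
  simp only [finLabel, Prod.mk.injEq, Fin.ext_iff, Fin.val_ofNat] at h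
  obtain ⟨h1, h2⟩ := h
  refine Prod.ext ?_ h2
  rwa [Nat.mod_eq_of_lt (by exact hlog hi), Nat.mod_eq_of_lt (by exact hlog hi')] at h1

/-! ### Arrays that are polynomial on dyadic blocks -/

/-- The dyadic level of a triple. -/
def level (i j k : ℕ) : ℕ := Nat.log 2 (max i (max j k))

lemma level_eq_max (i j k : ℕ) :
    level i j k = max (Nat.log 2 i) (max (Nat.log 2 j) (Nat.log 2 k)) := by
  rw [level, (Nat.log_monotone (b := 2)).map_max, (Nat.log_monotone (b := 2)).map_max]

/-- `A` is a polynomial of degree less than `s` in each variable on each of the blocks of side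
`2 ^ (M - K)` that make up the dyadic shell of level `M`. -/
def IsBlockPoly (K s : ℕ) (A : ℕ → ℕ → ℕ → ℝ) : Prop :=
  ∃ c : ℕ → ℕ → ℕ → ℕ → Fin s → Fin s → Fin s → ℝ, ∀ i j k M w,
    M = level i j k → w = 2 ^ (M - K) →
    A i j k = ∑ a, ∑ b, ∑ e, c M (i / w) (j / w) (k / w) a b e *
      (((i % w : ℕ) : ℝ) ^ (a : ℕ) * ((j % w : ℕ) : ℝ) ^ (b : ℕ) * ((k % w : ℕ) : ℝ) ^ (e : ℕ))

section LabelSpan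

variable {Y L : Type*}

/-- The polynomials of degree less than `s` in `N`. -/
def polySpan (N : Y → ℕ) (s : ℕ) : Submodule ℝ (Y → ℝ) :=
  Submodule.span ℝ (Set.range fun (t : Fin s) (y : Y) => (N y : ℝ) ^ (t : ℕ))

lemma affine_pow_mem_polySpan {N i : Y → ℕ} {s t : ℕ} (α κ : ℕ) (ht : t < s)
    (h : ∀ y, i y = κ * N y + α) (c : ℝ) :
    (fun y => ((i y : ℝ) + c) ^ t) ∈ polySpan N s := by
  have : (fun y => ((i y : ℝ) + c) ^ t) = ∑ m ∈ Finset.range (t + 1),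
      ((κ : ℝ) ^ m * (α + c) ^ (t - m) * (t.choose m)) • fun y => (N y : ℝ) ^ m := by
    funext y
    simp only [Finset.sum_apply, Pi.smul_apply, smul_eq_mul]
    rw [h y]
    push_cast
    rw [add_assoc, add_pow]
    refine Finset.sum_congr rfl fun m _ => ?_
    ring
  rw [this]
  refine Submodule.sum_mem _ fun m hm => Submodule.smul_mem _ _ (Submodule.subset_span ?_)
  rw [Finset.mem_range] at hm
  exact ⟨⟨m, by omega⟩, rfl⟩

/-- An index that does not vary with `y` only contributes constants, hence degree bound 1 for any
`N`. -/
lemma const_pow_mem_polySpan {i : Y → ℕ} (N : Y → ℕ) {t : ℕ} (h : ∀ y y', i y = i y') (c : ℝ) :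
    (fun y => ((i y : ℝ) + c) ^ t) ∈ polySpan N 1 := by
  rcases isEmpty_or_nonempty Y with hY | ⟨⟨y0⟩⟩
  · have : (fun y => ((i y : ℝ) + c) ^ t) = 0 := funext fun y => (hY.false y).elim
    rw [this]
    exact Submodule.zero_mem _
  · have : (fun y => ((i y : ℝ) + c) ^ t) = ((i y0 : ℝ) + c) ^ t • fun y => (N y : ℝ) ^ 0 := by
      funext y
      simp [h y y0]
    rw [this]
    exact Submodule.smul_mem _ _ (Submodule.subset_span ⟨0, rfl⟩)

/-- Monomials in `N₁, N₂, N₃` restricted to the level sets of the label `β`. -/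
def labelFam [DecidableEq L] (β : Y → L) (N₁ N₂ N₃ : Y → ℕ) (s₁ s₂ s₃ : ℕ)
    (p : L × Fin s₁ × Fin s₂ × Fin s₃) (y : Y) : ℝ :=
  if β y = p.1 then (N₁ y : ℝ) ^ (p.2.1 : ℕ) * (N₂ y : ℝ) ^ (p.2.2.1 : ℕ) *
    (N₃ y : ℝ) ^ (p.2.2.2 : ℕ) else 0

lemma labelFam_mul_mem [DecidableEq L] {β : Y → L} {N₁ N₂ N₃ : Y → ℕ} {s₁ s₂ s₃ : ℕ}
    (a : L) {p₁ p₂ p₃ : Y → ℝ} (h₁ : p₁ ∈ polySpan N₁ s₁) (h₂ : p₂ ∈ polySpan N₂ s₂)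
    (h₃ : p₃ ∈ polySpan N₃ s₃) :
    (fun y => if β y = a then p₁ y * p₂ y * p₃ y else 0) ∈
      Submodule.span ℝ (Set.range (labelFam β N₁ N₂ N₃ s₁ s₂ s₃)) := by
  obtain ⟨c₁, rfl⟩ := (Submodule.mem_span_range_iff_exists_fun ℝ).1 h₁
  obtain ⟨c₂, rfl⟩ := (Submodule.mem_span_range_iff_exists_fun ℝ).1 h₂
  obtain ⟨c₃, rfl⟩ := (Submodule.mem_span_range_iff_exists_fun ℝ).1 h₃
  have : (fun y => if β y = a then (∑ i, c₁ i • fun y => (N₁ y : ℝ) ^ (i : ℕ)) y *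
      (∑ i, c₂ i • fun y => (N₂ y : ℝ) ^ (i : ℕ)) y *
      (∑ i, c₃ i • fun y => (N₃ y : ℝ) ^ (i : ℕ)) y else 0) =
      ∑ i₁, ∑ i₂, ∑ i₃, (c₁ i₁ * c₂ i₂ * c₃ i₃) •
        labelFam β N₁ N₂ N₃ s₁ s₂ s₃ (a, i₁, i₂, i₃) := by
    funext y
    simp only [Finset.sum_apply, Pi.smul_apply, smul_eq_mul, labelFam]
    split_ifs with h
    · rw [Finset.sum_mul_sum, Finset.sum_mul]
      refine Finset.sum_congr rfl fun i _ => ?_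
      rw [Finset.sum_mul_sum]
      refine Finset.sum_congr rfl fun j _ => Finset.sum_congr rfl fun k _ => ?_
      ring
    · simp
  rw [this]
  exact Submodule.sum_mem _ fun i _ => Submodule.sum_mem _ fun j _ => Submodule.sum_mem _
    fun k _ => Submodule.smul_mem _ _ (Submodule.subset_span ⟨_, rfl⟩)

/-- A block polynomial, composed with index functions whose blocks are determined by a label. -/
lemma IsBlockPoly.comp_mem_span [Fintype L] [DecidableEq L] {K s : ℕ} {A : ℕ → ℕ → ℕ → ℝ}
    (hA : IsBlockPoly K s A) (β : Y → L) {i j k : Y → ℕ} {N₁ N₂ N₃ : Y → ℕ} {s₁ s₂ s₃ : ℕ}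
    (hM : ∀ y y', β y = β y' → level (i y) (j y) (k y) = level (i y') (j y') (k y'))
    (hi : ∀ y y', β y = β y' → i y / 2 ^ (level (i y) (j y) (k y) - K) =
      i y' / 2 ^ (level (i y) (j y) (k y) - K))
    (hj : ∀ y y', β y = β y' → j y / 2 ^ (level (i y) (j y) (k y) - K) =
      j y' / 2 ^ (level (i y) (j y) (k y) - K))
    (hk : ∀ y y', β y = β y' → k y / 2 ^ (level (i y) (j y) (k y) - K) =
      k y' / 2 ^ (level (i y) (j y) (k y) - K))
    (h₁ : ∀ t < s, ∀ c : ℝ, (fun y => ((i y : ℝ) + c) ^ t) ∈ polySpan N₁ s₁)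
    (h₂ : ∀ t < s, ∀ c : ℝ, (fun y => ((j y : ℝ) + c) ^ t) ∈ polySpan N₂ s₂)
    (h₃ : ∀ t < s, ∀ c : ℝ, (fun y => ((k y : ℝ) + c) ^ t) ∈ polySpan N₃ s₃) :
    (fun y => A (i y) (j y) (k y)) ∈
      Submodule.span ℝ (Set.range (labelFam β N₁ N₂ N₃ s₁ s₂ s₃)) := by
  classical
  obtain ⟨c, hc⟩ := hA
  -- On one level set of the label all three indices stay in the block of a representative, so a
  -- single polynomial describes the array there.
  have hsplit : (fun y => A (i y) (j y) (k y)) =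
      ∑ a : L, fun y => if β y = a then A (i y) (j y) (k y) else 0 := by
    funext y
    simp
  rw [hsplit]
  refine Submodule.sum_mem _ fun a _ => ?_
  by_cases ha : ∃ y, β y = a
  swap
  · push Not at ha
    have : (fun y => if β y = a then A (i y) (j y) (k y) else 0) = 0 := by
      funext y
      simp [ha y]
    rw [this]
    exact Submodule.zero_mem _
  obtain ⟨y₀, rfl⟩ := ha
  set M := level (i y₀) (j y₀) (k y₀) with hMdef
  set w := 2 ^ (M - K) with hw
  -- Within one block the local coordinate is the index minus the lower corner, a shift that
  -- `polySpan` absorbs.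
  have hmod : ∀ n m : ℕ, n / w = m / w → ((n % w : ℕ) : ℝ) = (n : ℝ) + (-(w * (m / w : ℕ) : ℝ)) := by
    intro n m h
    have := Nat.div_add_mod n w
    rw [h] at this
    have h2 : ((w * (m / w) + n % w : ℕ) : ℝ) = n := by rw [this]
    push_cast at h2 ⊢
    linarith
  have : (fun y => if β y = β y₀ then A (i y) (j y) (k y) else 0) = ∑ a, ∑ b, ∑ e,
      c M (i y₀ / w) (j y₀ / w) (k y₀ / w) a b e • fun y => if β y = β y₀ then
        ((i y : ℝ) + (-(w * (i y₀ / w : ℕ) : ℝ))) ^ (a : ℕ) *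
        ((j y : ℝ) + (-(w * (j y₀ / w : ℕ) : ℝ))) ^ (b : ℕ) *
        ((k y : ℝ) + (-(w * (k y₀ / w : ℕ) : ℝ))) ^ (e : ℕ) else 0 := by
    funext y
    simp only [Finset.sum_apply, Pi.smul_apply, smul_eq_mul]
    split_ifs with h
    · have e0 := hM _ _ h.symm
      have e1 := hi _ _ h.symm
      have e2 := hj _ _ h.symm
      have e3 := hk _ _ h.symm
      rw [hc (i y) (j y) (k y) M w e0 rfl, ← e1, ← e2, ← e3, hmod _ _ e1.symm, hmod _ _ e2.symm,
        hmod _ _ e3.symm]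
    · simp
  rw [this]
  refine Submodule.sum_mem _ fun a _ => Submodule.sum_mem _ fun b _ => Submodule.sum_mem _
    fun e _ => Submodule.smul_mem _ _ ?_
  exact labelFam_mul_mem _ (h₁ a a.2 _) (h₂ b b.2 _) (h₃ e e.2 _)

/-- The three labels determine the level of the triple, which is the maximum of the three levels,
and then by `blockLabel_div` the three block numbers at that level. -/
lemma IsBlockPoly.comp_mem_span_of_blockLabel [Fintype L] [DecidableEq L] {K s : ℕ}
    {A : ℕ → ℕ → ℕ → ℝ}
    (hA : IsBlockPoly K s A) (β : Y → L) {i j k : Y → ℕ} {N₁ N₂ N₃ : Y → ℕ} {s₁ s₂ s₃ : ℕ}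
    (hi : ∀ y y', β y = β y' → blockLabel K (i y) = blockLabel K (i y'))
    (hj : ∀ y y', β y = β y' → blockLabel K (j y) = blockLabel K (j y'))
    (hk : ∀ y y', β y = β y' → blockLabel K (k y) = blockLabel K (k y'))
    (h₁ : ∀ t < s, ∀ c : ℝ, (fun y => ((i y : ℝ) + c) ^ t) ∈ polySpan N₁ s₁)
    (h₂ : ∀ t < s, ∀ c : ℝ, (fun y => ((j y : ℝ) + c) ^ t) ∈ polySpan N₂ s₂)
    (h₃ : ∀ t < s, ∀ c : ℝ, (fun y => ((k y : ℝ) + c) ^ t) ∈ polySpan N₃ s₃) :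
    (fun y => A (i y) (j y) (k y)) ∈
      Submodule.span ℝ (Set.range (labelFam β N₁ N₂ N₃ s₁ s₂ s₃)) := by
  have hlog : ∀ {n m : ℕ}, blockLabel K n = blockLabel K m → Nat.log 2 n = Nat.log 2 m :=
    fun h => congrArg Prod.fst h
  refine hA.comp_mem_span β (fun y y' h => ?_) (fun y y' h => ?_) (fun y y' h => ?_)
    (fun y y' h => ?_) h₁ h₂ h₃
  · rw [level_eq_max, level_eq_max, hlog (hi _ _ h), hlog (hj _ _ h), hlog (hk _ _ h)]
  · exact blockLabel_div (hi _ _ h) (by rw [level_eq_max]; exact le_max_left _ _)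
  · exact blockLabel_div (hj _ _ h) (by rw [level_eq_max]; simp)
  · exact blockLabel_div (hk _ _ h) (by rw [level_eq_max]; simp)

end LabelSpan

end QTTApprox

namespace QTTApprox

/-! ### Rank bounds in the three formats -/

/-- As soon as one prefix is nonzero, the leading digit of the maximum lies among the prefixes, and
the suffixes cannot change the level. -/
lemma const_level {n I J L i j k : ℕ} (hi : i < 2 ^ n) (hj : j < 2 ^ n) (hk : k < 2 ^ n)
    (h : max I (max J L) ≠ 0) :
    level (2 ^ n * I + i) (2 ^ n * J + j) (2 ^ n * L + k) = n + Nat.log 2 (max I (max J L)) := by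
  set N := max (2 ^ n * I + i) (max (2 ^ n * J + j) (2 ^ n * L + k)) with hN
  have hdiv : N / 2 ^ n = max I (max J L) := by
    have hm : Monotone fun m : ℕ => m / 2 ^ n := fun a b hab => Nat.div_le_div_right hab
    have e1 := hm.map_max (a := 2 ^ n * I + i) (b := max (2 ^ n * J + j) (2 ^ n * L + k))
    have e2 := hm.map_max (a := 2 ^ n * J + j) (b := 2 ^ n * L + k)
    have hz : ∀ {I i : ℕ}, i < 2 ^ n → (2 ^ n * I + i) / 2 ^ n = I := fun {I i} hi => by
      rw [Nat.mul_add_div (by positivity), Nat.div_eq_of_lt hi, add_zero]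
    simp only [hz hi, hz hj, hz hk] at e1 e2
    rw [hN, e1, e2]
  have : N = 2 ^ n * max I (max J L) + N % 2 ^ n := by
    conv_lhs => rw [← Nat.div_add_mod N (2 ^ n), hdiv]
  rw [level, ← hN, this, log_shift (Nat.mod_lt _ (by positivity)) h]

section

variable {ℓ K s : ℕ} {A : ℕ → ℕ → ℕ → ℝ}

lemma mod_lt_two_pow (q N : ℕ) : N % 2 ^ (ℓ - q) < 2 ^ (ℓ - q) := Nat.mod_lt _ (by positivity)

lemma mod_lt_two_pow' (q N : ℕ) : N % 2 ^ (ℓ - q) < 2 ^ ℓ :=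
  (mod_lt_two_pow q N).trans_le (Nat.pow_le_pow_right two_pos (Nat.sub_le _ _))

lemma div_lt_two_pow' (q : ℕ) (x : Fin ℓ → Fin 2) : (digits x : ℕ) / 2 ^ (ℓ - q) < 2 ^ ℓ :=
  (Nat.div_le_self _ _).trans_lt (digits x).2

/-- A cut within the digits of one index separates that index into prefix and suffix, the earlier
indices to the left and the later ones to the right. The outer cuts involve one index on their
cheaper side and have rank `ℓ * 2 ^ (K + 1) * s`. The cuts within the digits of `j` are the
expensive ones: there the cheaper description may still involve two indices, which squares `2 ^ (K +
1) * s`. -/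
theorem IsBlockPoly.admitsQTT (hA : IsBlockPoly K s A) (hℓ : 0 < ℓ) (hs : 0 < s) :
    ∃ N, AdmitsQTT ℓ (fun i j k => A i j k) N ∧
      N ≤ (ℓ + ℓ + ℓ) * (2 * (2 * ℓ * (2 ^ (K + 1) * s) ^ 2) * (2 * ℓ * (2 ^ (K + 1) * s) ^ 2)) := by
  classical
  have : NeZero ℓ := ⟨hℓ.ne'⟩
  set D := 2 ^ (K + 1) * s with hD
  set R := 2 * ℓ * D ^ 2 with hR
  have hD1 : 1 ≤ D := Nat.mul_pos (by positivity) hs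
  have hRpos : 1 ≤ R := Nat.mul_pos (Nat.mul_pos two_pos hℓ) (pow_pos hD1 2)
  have hGR : ℓ * 2 ^ (K + 1) * s ≤ R := by
    have : ℓ * 2 ^ (K + 1) * s = ℓ * D := by rw [hD]; ring
    rw [this, hR]
    nlinarith [Nat.mul_le_mul_left ℓ (Nat.mul_le_mul hD1 hD1), Nat.mul_le_mul_left (ℓ * D) hD1]
  let pI : (Fin (ℓ + ℓ + ℓ) → Fin 2) → Fin ℓ → Fin 2 :=
    fun z n => z (Fin.castAdd ℓ (Fin.castAdd ℓ n))
  let pJ : (Fin (ℓ + ℓ + ℓ) → Fin 2) → Fin ℓ → Fin 2 :=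
    fun z n => z (Fin.castAdd ℓ (Fin.natAdd ℓ n))
  let pK : (Fin (ℓ + ℓ + ℓ) → Fin 2) → Fin ℓ → Fin 2 := fun z n => z (Fin.natAdd (ℓ + ℓ) n)
  have mI : ∀ q x y, pI (mix q x y) = mix q (pI x) (pI y) := fun q x y => rfl
  have mJ : ∀ q x y, pJ (mix q x y) = mix (q - ℓ) (pJ x) (pJ y) := fun q x y => by
    funext n
    have : (ℓ + n < q) ↔ ((n : ℕ) < q - ℓ) := by omega
    simp only [pJ, mix, Fin.val_castAdd, Fin.val_natAdd, this]
  have mK : ∀ q x y, pK (mix q x y) = mix (q - (ℓ + ℓ)) (pK x) (pK y) := fun q x y => by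
    funext n
    have : (ℓ + ℓ + n < q) ↔ ((n : ℕ) < q - (ℓ + ℓ)) := by omega
    simp [pK, mix, this]
  have mix0 : ∀ x y : Fin ℓ → Fin 2, mix 0 x y = y := fun x y => by funext k; simp [mix]
  have mixl : ∀ q, ℓ ≤ q → ∀ x y : Fin ℓ → Fin 2, mix q x y = x := fun q hq x y => by
    funext k; simp [mix, k.2.trans_le hq]
  obtain ⟨T, hr, hlast, hN, hT⟩ := exists_train (d := ℓ + ℓ + ℓ) (n := 2) (R₀ := 1) (R := R)
    (by omega) one_pos hRpos
    (fun _ z => A (digits (pI z)) (digits (pJ z)) (digits (pK z))) (fun q hq0 hq => by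
      simp only [mI, mJ, mK]
      -- For a cut within the digits of `i`, the left side is a single prefix, and its label
      -- controls the block of `i`.
      rcases le_or_gt q ℓ with h1 | h1
      · have e1 : q - ℓ = 0 := by omega
        have e2 : q - (ℓ + ℓ) = 0 := by omega
        simp only [e1, e2, mix0, coe_digits_mix]
        refine HasRank.of_mem_span_left _ (fun y => hA.comp_mem_span_of_blockLabel
          (Y := Fin 1 × (Fin (ℓ + ℓ + ℓ) → Fin 2))
          (fun p => finLabel ℓ K ((digits (pI p.2) : ℕ) / 2 ^ (ℓ - q)))
          (N₁ := fun p => (digits (pI p.2) : ℕ) / 2 ^ (ℓ - q)) (N₂ := 0) (N₃ := 0)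
          (s₁ := s) (s₂ := 1) (s₃ := 1) (fun x x' h => ?_) (fun _ _ _ => rfl) (fun _ _ _ => rfl)
          (fun t ht c => affine_pow_mem_polySpan _ _ ht (fun _ => rfl) c)
          (fun t ht c => const_pow_mem_polySpan _ (fun _ _ => rfl) c)
          (fun t ht c => const_pow_mem_polySpan _ (fun _ _ => rfl) c)) ?_
        · exact blockLabel_prefix (mod_lt_two_pow _ _)
            (finLabel_eq (div_lt_two_pow' _ _) (div_lt_two_pow' _ _) h)
        · simpa using hGR
      rcases le_or_gt q (ℓ + ℓ) with h2 | h2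
      · have e2 : q - (ℓ + ℓ) = 0 := by omega
        set q' := q - ℓ
        set n := ℓ - q' with hn
        simp only [e2, mix0, mixl q h1.le, coe_digits_mix]
        have hsum : ℓ * 2 ^ (K + 1) * s + 2 ^ K * (ℓ * 2 ^ (K + 1)) * (s * s) ≤ R := by
          have a1 : ℓ * 2 ^ (K + 1) * s = ℓ * D := by rw [hD]; ring
          have a2 : 2 ^ K * (ℓ * 2 ^ (K + 1)) * (s * s) ≤ ℓ * D ^ 2 := by
            rw [hD]
            calc 2 ^ K * (ℓ * 2 ^ (K + 1)) * (s * s)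
                ≤ 2 ^ (K + 1) * (ℓ * 2 ^ (K + 1)) * (s * s) := by gcongr <;> omega
              _ = _ := by ring
          have a3 : ℓ * D ≤ ℓ * D ^ 2 := by gcongr; nlinarith
          rw [a1, hR]; linarith
        -- If the prefix of `j` is zero, the left side acts through `i` alone. If it is nonzero, the
        -- level of `j` is known from the left; then the right side needs only one of `2 ^ K`
        -- sub-blocks for the suffix of `j`, besides the full label of `k`, with degree `s` in both.
        -- This saves a second factor `ℓ`.
        have hB : (fun (p : Fin 1 × (Fin (ℓ + ℓ + ℓ) → Fin 2)) (y : Fin (ℓ + ℓ + ℓ) → Fin 2) =>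
            A (digits (pI p.2)) (2 ^ n * ((digits (pJ p.2) : ℕ) / 2 ^ n)
              + (digits (pJ y) : ℕ) % 2 ^ n) (digits (pK y))) =
            fun p y => (if (digits (pJ p.2) : ℕ) / 2 ^ n = 0 then 1 else 0) *
              A (digits (pI p.2)) ((digits (pJ y) : ℕ) % 2 ^ n) (digits (pK y)) +
              (if (digits (pJ p.2) : ℕ) / 2 ^ n = 0 then 0 else
              A (digits (pI p.2)) (2 ^ n * ((digits (pJ p.2) : ℕ) / 2 ^ n)
              + (digits (pJ y) : ℕ) % 2 ^ n) (digits (pK y))) := by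
          funext p y
          split_ifs with h
          · rw [h]; simp
          · simp
        rw [hB]
        refine HasRank.mono (HasRank.add (R := ℓ * 2 ^ (K + 1) * s)
          (R' := 2 ^ K * (ℓ * 2 ^ (K + 1)) * (s * s)) (HasRank.mul_left ?_ _) ?_) hsum
        · refine HasRank.of_mem_span_left _ (fun y => hA.comp_mem_span_of_blockLabel
            (Y := Fin 1 × (Fin (ℓ + ℓ + ℓ) → Fin 2))
            (fun p => finLabel ℓ K (digits (pI p.2) : ℕ))
            (N₁ := fun p => (digits (pI p.2) : ℕ)) (N₂ := 0) (N₃ := 0)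
            (s₁ := s) (s₂ := 1) (s₃ := 1) (fun x x' h => ?_) (fun _ _ _ => rfl) (fun _ _ _ => rfl)
            (fun t ht c => affine_pow_mem_polySpan 0 1 ht (fun _ => by simp) c)
            (fun t ht c => const_pow_mem_polySpan _ (fun _ _ => rfl) c)
            (fun t ht c => const_pow_mem_polySpan _ (fun _ _ => rfl) c)) ?_
          · exact finLabel_eq (digits _).2 (digits _).2 h
          · simp
        · refine HasRank.of_mem_span_right (labelFam (L := Fin (2 ^ K) × Fin ℓ × Fin (2 ^ (K + 1)))
            (fun y => (⟨(digits (pJ y) : ℕ) % 2 ^ n / 2 ^ (n - K),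
              div_two_pow_lt (mod_lt_two_pow _ _)⟩, finLabel ℓ K (digits (pK y) : ℕ)))
            0 (fun y => (digits (pJ y) : ℕ) % 2 ^ n) (fun y => (digits (pK y) : ℕ)) 1 s s)
            (fun p => ?_) ?_
          · by_cases h0 : (digits (pJ p.2) : ℕ) / 2 ^ n = 0
            · simp only [h0, if_true]
              exact Submodule.zero_mem _
            simp only [h0, if_false]
            have hlab : ∀ {y y' : Fin (ℓ + ℓ + ℓ) → Fin 2},
                ((⟨(digits (pJ y) : ℕ) % 2 ^ n / 2 ^ (n - K),
                  div_two_pow_lt (mod_lt_two_pow _ _)⟩, finLabel ℓ K (digits (pK y) : ℕ)) :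
                  Fin (2 ^ K) × Fin ℓ × Fin (2 ^ (K + 1))) =
                (⟨(digits (pJ y') : ℕ) % 2 ^ n / 2 ^ (n - K),
                  div_two_pow_lt (mod_lt_two_pow _ _)⟩, finLabel ℓ K (digits (pK y') : ℕ)) →
                (digits (pJ y) : ℕ) % 2 ^ n / 2 ^ (n - K) =
                  (digits (pJ y') : ℕ) % 2 ^ n / 2 ^ (n - K) ∧
                blockLabel K (digits (pK y) : ℕ) = blockLabel K (digits (pK y') : ℕ) := by
              intro y y' h
              simp only [Prod.mk.injEq, Fin.mk.injEq] at h
              exact ⟨h.1, finLabel_eq (digits _).2 (digits _).2 h.2⟩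
            refine hA.comp_mem_span _ (fun y y' h => ?_) (fun _ _ _ => rfl) (fun y y' h => ?_)
              (fun y y' h => ?_)
              (fun t ht c => const_pow_mem_polySpan _ (fun _ _ => rfl) c)
              (fun t ht c => affine_pow_mem_polySpan _ 1 ht (fun _ => by rw [one_mul, add_comm]) c)
              (fun t ht c => affine_pow_mem_polySpan 0 1 ht (fun _ => by simp) c)
            · rw [level_eq_max, level_eq_max, log_shift (mod_lt_two_pow _ _) h0,
                log_shift (mod_lt_two_pow _ _) h0,
                show Nat.log 2 (digits (pK y) : ℕ) = _ from congrArg Prod.fst (hlab h).2]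
              rfl
            · refine suffix_div (hlab h).1 ?_
              rw [level_eq_max, log_shift (mod_lt_two_pow _ _) h0]
              exact le_max_of_le_right (le_max_of_le_left (Nat.le_add_right _ _))
            · refine blockLabel_div (hlab h).2 ?_
              rw [level_eq_max]; simp
          · simp
      -- For a cut within the digits of `k`, the right side is a single suffix, and
      -- `blockLabel_suffix` shows that its label is enough.
      · simp only [mixl q h1.le, mixl (q - ℓ) (by omega), coe_digits_mix]
        set q' := q - (ℓ + ℓ)
        refine HasRank.of_mem_span_right _ (fun p => hA.comp_mem_span_of_blockLabel
          (fun y => finLabel ℓ K ((digits (pK y) : ℕ) % 2 ^ (ℓ - q')))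
          (N₁ := 0) (N₂ := 0) (N₃ := fun y => (digits (pK y) : ℕ) % 2 ^ (ℓ - q'))
          (s₁ := 1) (s₂ := 1) (s₃ := s) (fun _ _ _ => rfl) (fun _ _ _ => rfl) (fun y y' h => ?_)
          (fun t ht c => const_pow_mem_polySpan _ (fun _ _ => rfl) c)
          (fun t ht c => const_pow_mem_polySpan _ (fun _ _ => rfl) c)
          (fun t ht c => affine_pow_mem_polySpan _ 1 ht (fun _ => by rw [one_mul, add_comm]) c)) ?_
        · exact blockLabel_suffix (mod_lt_two_pow _ _) (mod_lt_two_pow _ _)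
            (finLabel_eq (mod_lt_two_pow' _ _) (mod_lt_two_pow' _ _) h)
        · simpa using hGR)
  refine ⟨T.numParams, ⟨T, hr, hlast, rfl, fun i j k a b => ?_⟩, hN⟩
  rw [hT]
  have a1 : pI (Fin.append (Fin.append i j) k) = i := by
    funext n; simp [pI]
  have a2 : pJ (Fin.append (Fin.append i j) k) = j := by
    funext n; simp only [pJ, Fin.append_left, Fin.append_right]
  have a3 : pK (Fin.append (Fin.append i j) k) = k := by
    funext n; simp [pK]
  rw [a1, a2, a3]

/-- If some prefix is nonzero, the prefixes fix the level, and the suffixes only select one of `2 ^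
K` sub-blocks per direction; no level enters the label, hence no factor `ℓ` in the rank. All
positions with zero prefixes share one row, which accounts for the additional 1. -/
theorem IsBlockPoly.admitsQT3 (hA : IsBlockPoly K s A) (hℓ : 0 < ℓ) :
    ∃ N, AdmitsQT3 ℓ (fun i j k => A i j k) N ∧
      N ≤ ℓ * (2 ^ 3 * (1 + (2 ^ K * s) ^ 3) * (1 + (2 ^ K * s) ^ 3)) := by
  classical
  -- Recovers the digits of `i`, `j`, `k` from the digit of base 8. `Fin.rev` undoes the order used
  -- in `digits`.
  let p : Fin 3 → (Fin ℓ → Fin (2 ^ 3)) → Fin ℓ → Fin 2 :=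
    fun m z n => finFunctionFinEquiv.symm (z n) (Fin.rev m)
  have hp : ∀ (m : Fin 3) (i : Fin ℓ → Fin 3 → Fin 2), p m (fun n => digits (i n)) = fun n => i n m := by
    intro m i
    funext n
    simp [p, digits]
  have hm : ∀ m q x y, p m (mix q x y) = mix q (p m x) (p m y) := by
    intro m q x y
    funext n
    simp only [p, mix]
    split_ifs <;> rfl
  obtain ⟨T, hr, hlast, hN, hT⟩ := exists_train (d := ℓ) (n := 2 ^ 3) (R₀ := 1)
    (R := 1 + (2 ^ K * s) ^ 3) hℓ one_pos (by omega)
    (fun _ z => A (digits (p 0 z)) (digits (p 1 z)) (digits (p 2 z))) (fun q hq0 hq => by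
      simp only [hm, coe_digits_mix]
      set n := ℓ - q with hn
      set H : (Fin ℓ → Fin (2 ^ 3)) → ℕ := fun x => max ((digits (p 0 x) : ℕ) / 2 ^ n)
        (max ((digits (p 1 x) : ℕ) / 2 ^ n) ((digits (p 2 x) : ℕ) / 2 ^ n)) with hH
      set β : (Fin ℓ → Fin (2 ^ 3)) → Fin (2 ^ K) × Fin (2 ^ K) × Fin (2 ^ K) := fun y =>
        (⟨(digits (p 0 y) : ℕ) % 2 ^ n / 2 ^ (n - K), div_two_pow_lt (mod_lt_two_pow _ _)⟩,
        ⟨(digits (p 1 y) : ℕ) % 2 ^ n / 2 ^ (n - K), div_two_pow_lt (mod_lt_two_pow _ _)⟩,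
        ⟨(digits (p 2 y) : ℕ) % 2 ^ n / 2 ^ (n - K), div_two_pow_lt (mod_lt_two_pow _ _)⟩) with hβ
      have hB : (fun (x : Fin 1 × (Fin ℓ → Fin (2 ^ 3))) (y : Fin ℓ → Fin (2 ^ 3)) =>
          A (2 ^ n * ((digits (p 0 x.2) : ℕ) / 2 ^ n) + (digits (p 0 y) : ℕ) % 2 ^ n)
            (2 ^ n * ((digits (p 1 x.2) : ℕ) / 2 ^ n) + (digits (p 1 y) : ℕ) % 2 ^ n)
            (2 ^ n * ((digits (p 2 x.2) : ℕ) / 2 ^ n) + (digits (p 2 y) : ℕ) % 2 ^ n)) =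
          fun x y => (if H x.2 = 0 then 1 else 0) * A ((digits (p 0 y) : ℕ) % 2 ^ n)
            ((digits (p 1 y) : ℕ) % 2 ^ n) ((digits (p 2 y) : ℕ) % 2 ^ n) +
          (if H x.2 = 0 then 0 else
            A (2 ^ n * ((digits (p 0 x.2) : ℕ) / 2 ^ n) + (digits (p 0 y) : ℕ) % 2 ^ n)
            (2 ^ n * ((digits (p 1 x.2) : ℕ) / 2 ^ n) + (digits (p 1 y) : ℕ) % 2 ^ n)
            (2 ^ n * ((digits (p 2 x.2) : ℕ) / 2 ^ n) + (digits (p 2 y) : ℕ) % 2 ^ n)) := by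
        funext x y
        split_ifs with h
        · simp only [hH, Nat.max_eq_zero_iff] at h
          rw [h.1, h.2.1, h.2.2]; simp
        · simp
      rw [hB]
      refine HasRank.add ⟨fun _ x => if H x.2 = 0 then 1 else 0,
        fun _ y => A ((digits (p 0 y) : ℕ) % 2 ^ n) ((digits (p 1 y) : ℕ) % 2 ^ n)
          ((digits (p 2 y) : ℕ) % 2 ^ n), fun x y => ?_⟩ ?_
      · rw [Fin.sum_univ_one]
      · refine HasRank.of_mem_span_right (labelFam β (fun y => (digits (p 0 y) : ℕ) % 2 ^ n)
          (fun y => (digits (p 1 y) : ℕ) % 2 ^ n) (fun y => (digits (p 2 y) : ℕ) % 2 ^ n) s s s)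
          (fun x => ?_) (le_of_eq (by simp; ring))
        by_cases h0 : H x.2 = 0
        · simp only [h0, if_true]
          exact Submodule.zero_mem _
        simp only [h0, if_false]
        have hlev : ∀ y : Fin ℓ → Fin (2 ^ 3), level
            (2 ^ n * ((digits (p 0 x.2) : ℕ) / 2 ^ n) + (digits (p 0 y) : ℕ) % 2 ^ n)
            (2 ^ n * ((digits (p 1 x.2) : ℕ) / 2 ^ n) + (digits (p 1 y) : ℕ) % 2 ^ n)
            (2 ^ n * ((digits (p 2 x.2) : ℕ) / 2 ^ n) + (digits (p 2 y) : ℕ) % 2 ^ n) =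
            n + Nat.log 2 (H x.2) := fun y =>
          const_level (mod_lt_two_pow _ _) (mod_lt_two_pow _ _) (mod_lt_two_pow _ _) h0
        have hlab : ∀ {y y'}, β y = β y' → ((digits (p 0 y) : ℕ) % 2 ^ n / 2 ^ (n - K) =
            (digits (p 0 y') : ℕ) % 2 ^ n / 2 ^ (n - K)) ∧
            ((digits (p 1 y) : ℕ) % 2 ^ n / 2 ^ (n - K) =
            (digits (p 1 y') : ℕ) % 2 ^ n / 2 ^ (n - K)) ∧
            ((digits (p 2 y) : ℕ) % 2 ^ n / 2 ^ (n - K) =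
            (digits (p 2 y') : ℕ) % 2 ^ n / 2 ^ (n - K)) := by
          intro y y' h
          simpa only [hβ, Prod.mk.injEq, Fin.mk.injEq] using h
        have haff : ∀ m (t : ℕ), t < s → ∀ c : ℝ, (fun y : Fin ℓ → Fin (2 ^ 3) =>
            (((2 ^ n * ((digits (p m x.2) : ℕ) / 2 ^ n) + (digits (p m y) : ℕ) % 2 ^ n : ℕ) : ℝ)
              + c) ^ t) ∈ polySpan (fun y => (digits (p m y) : ℕ) % 2 ^ n) s := fun m t ht c =>
          affine_pow_mem_polySpan _ 1 ht (fun _ => by rw [one_mul, add_comm]) c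
        refine hA.comp_mem_span β (fun y y' _ => by rw [hlev, hlev]) (fun y y' h => ?_)
          (fun y y' h => ?_) (fun y y' h => ?_) (haff 0) (haff 1) (haff 2)
        · exact suffix_div (hlab h).1 (by rw [hlev]; omega)
        · exact suffix_div (hlab h).2.1 (by rw [hlev]; omega)
        · exact suffix_div (hlab h).2.2 (by rw [hlev]; omega))
  refine ⟨T.numParams, ⟨T, hr, hlast, rfl, fun i j k a b => ?_⟩, hN⟩
  rw [hT, hp, hp, hp]
  rfl

lemma mem_span_labelFam_of_forall {Y L : Type*} [Fintype L] [DecidableEq L] {β : Y → L}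
    {N : Y → ℕ} {s : ℕ} {F : Y → ℝ}
    (h : ∀ y₀, ∃ p ∈ polySpan N s, ∀ y, β y = β y₀ → F y = p y) :
    F ∈ Submodule.span ℝ (Set.range (labelFam β N 0 0 s 1 1)) := by
  have hsplit : F = ∑ a : L, fun y => if β y = a then F y else 0 := by
    funext y
    simp
  rw [hsplit]
  refine Submodule.sum_mem _ fun a _ => ?_
  by_cases ha : ∃ y, β y = a
  · obtain ⟨y₀, rfl⟩ := ha
    obtain ⟨p, hp, hF⟩ := h y₀
    have h1 : (fun _ => (1 : ℝ)) ∈ polySpan (0 : Y → ℕ) 1 :=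
      Submodule.subset_span ⟨0, by simp⟩
    convert labelFam_mul_mem (β := β) (β y₀) hp h1 h1 using 2 with y
    split_ifs with hy
    · simp [hF y hy]
    · rfl
  · push Not at ha
    have : (fun y => if β y = a then F y else 0) = 0 := by
      funext y
      simp [ha y]
    rw [this]
    exact Submodule.zero_mem _

/-- The array lies in the tensor product of three copies of one univariate space, spanned by the
monomials on the label classes, and its coordinates there form the Tucker core. Fixing leading
digits maps this space into functions of the same kind by `blockLabel_suffix`, so no inner rank
exceeds the first one. One train serves all three directions. -/
theorem IsBlockPoly.admitsTQTT (hA : IsBlockPoly K s A) (hℓ : 0 < ℓ) (hs : 0 < s) :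
    ∃ N, AdmitsTQTT ℓ (fun i j k => A i j k) N ∧
      N ≤ (ℓ * 2 ^ (K + 1) * s) ^ 3 +
        3 * (ℓ * (2 * (ℓ * 2 ^ (K + 1) * s) * (ℓ * 2 ^ (K + 1) * s))) := by
  classical
  have : NeZero ℓ := ⟨hℓ.ne'⟩
  set R := ℓ * 2 ^ (K + 1) * s with hR
  have hRpos : 0 < R := Nat.mul_pos (Nat.mul_pos hℓ (by positivity)) hs
  let E : Fin R ≃ (Fin ℓ × Fin (2 ^ (K + 1))) × Fin s :=
    Fintype.equivOfCardEq (by simp [hR])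
  let f : (Fin ℓ × Fin (2 ^ (K + 1))) × Fin s → ℕ → ℝ :=
    fun a i => if finLabel ℓ K i = a.1 then (i : ℝ) ^ (a.2 : ℕ) else 0
  obtain ⟨T, hr, hlast, hN, hT⟩ := exists_train (d := ℓ) (n := 2) (R₀ := R)
    (R := R) hℓ hRpos le_rfl (fun b z => f (E b) (digits z)) (fun q hq0 hq => by
      simp only [coe_digits_mix]
      refine HasRank.of_mem_span_right (labelFam
        (fun y => finLabel ℓ K ((digits y : ℕ) % 2 ^ (ℓ - q)))
        (fun y => (digits y : ℕ) % 2 ^ (ℓ - q)) 0 0 s 1 1) (fun x => ?_)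
        (le_of_eq (by simp [hR]))
      refine mem_span_labelFam_of_forall (fun y₀ => ?_)
      have hlt : ∀ y : Fin ℓ → Fin 2, (2 ^ (ℓ - q) * ((digits x.2 : ℕ) / 2 ^ (ℓ - q)) +
          (digits y : ℕ) % 2 ^ (ℓ - q)) < 2 ^ ℓ := by
        intro y
        rw [← coe_digits_mix]
        exact (digits _).2
      have hlab : ∀ y : Fin ℓ → Fin 2, finLabel ℓ K ((digits y : ℕ) % 2 ^ (ℓ - q)) =
          finLabel ℓ K ((digits y₀ : ℕ) % 2 ^ (ℓ - q)) →
          finLabel ℓ K (2 ^ (ℓ - q) * ((digits x.2 : ℕ) / 2 ^ (ℓ - q)) +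
            (digits y : ℕ) % 2 ^ (ℓ - q)) =
          finLabel ℓ K (2 ^ (ℓ - q) * ((digits x.2 : ℕ) / 2 ^ (ℓ - q)) +
            (digits y₀ : ℕ) % 2 ^ (ℓ - q)) := by
        intro y h
        have := blockLabel_suffix (I := (digits x.2 : ℕ) / 2 ^ (ℓ - q)) (mod_lt_two_pow _ _)
          (mod_lt_two_pow _ _) (finLabel_eq (mod_lt_two_pow' _ _) (mod_lt_two_pow' _ _) h)
        simp only [finLabel, this]
      by_cases h0 : finLabel ℓ K (2 ^ (ℓ - q) * ((digits x.2 : ℕ) / 2 ^ (ℓ - q)) +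
            (digits y₀ : ℕ) % 2 ^ (ℓ - q)) = (E x.1).1
      · refine ⟨_, affine_pow_mem_polySpan (i := fun y => 2 ^ (ℓ - q) *
          ((digits x.2 : ℕ) / 2 ^ (ℓ - q)) + (digits y : ℕ) % 2 ^ (ℓ - q))
          _ 1 (E x.1).2.2 (fun _ => by rw [one_mul, add_comm]) 0, fun y hy => ?_⟩
        simp [f, hlab y hy, h0]
      · refine ⟨0, Submodule.zero_mem _, fun y hy => ?_⟩
        simp [f, hlab y hy, h0])
  let e : Fin (T.rank 0) ≃ (Fin ℓ × Fin (2 ^ (K + 1))) × Fin s := (finCongr hr).trans E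
  have hTe : ∀ y a b, T.eval y a b = f (e a) (digits y) := fun y a b => hT y a b
  have hmem := hA.comp_mem_span_of_blockLabel (Y := Fin (2 ^ ℓ) × Fin (2 ^ ℓ) × Fin (2 ^ ℓ))
    (fun y => (finLabel ℓ K y.1, finLabel ℓ K y.2.1, finLabel ℓ K y.2.2))
    (i := fun y => y.1) (j := fun y => y.2.1) (k := fun y => y.2.2)
    (N₁ := fun y => y.1) (N₂ := fun y => y.2.1) (N₃ := fun y => y.2.2) (s₁ := s) (s₂ := s)
    (s₃ := s)
    (fun y y' h => by
      simp only [Prod.mk.injEq] at h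
      exact finLabel_eq y.1.2 y'.1.2 h.1)
    (fun y y' h => by
      simp only [Prod.mk.injEq] at h
      exact finLabel_eq y.2.1.2 y'.2.1.2 h.2.1)
    (fun y y' h => by
      simp only [Prod.mk.injEq] at h
      exact finLabel_eq y.2.2.2 y'.2.2.2 h.2.2)
    (fun t ht c => affine_pow_mem_polySpan 0 1 ht (fun _ => by simp) c)
    (fun t ht c => affine_pow_mem_polySpan 0 1 ht (fun _ => by simp) c)
    (fun t ht c => affine_pow_mem_polySpan 0 1 ht (fun _ => by simp) c)
  obtain ⟨C, hC⟩ := (Submodule.mem_span_range_iff_exists_fun ℝ).1 hmem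
  refine ⟨_, ⟨T, T, T, fun a b c => C (((e a).1, (e b).1, (e c).1), (e a).2, (e b).2, (e c).2),
    hlast, hlast, hlast, rfl, fun i j k a b c => ?_⟩, ?_⟩
  · have h := congrFun hC (digits i, digits j, digits k)
    simp only [Finset.sum_apply, Pi.smul_apply, smul_eq_mul] at h
    simp only [hTe]
    rw [← h]
    set Φ : (Fin ℓ × Fin (2 ^ (K + 1))) × Fin s → (Fin ℓ × Fin (2 ^ (K + 1))) × Fin s →
      (Fin ℓ × Fin (2 ^ (K + 1))) × Fin s → ℝ := fun α β δ =>
        C ((α.1, β.1, δ.1), α.2, β.2, δ.2) * f α (digits i) * f β (digits j) * f δ (digits k)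
    have hΦ : ∑ a, ∑ b, ∑ c, Φ (e a) (e b) (e c) = ∑ α, ∑ β, ∑ δ, Φ α β δ := by
      rw [← Equiv.sum_comp e (fun α => ∑ β, ∑ δ, Φ α β δ)]
      refine Finset.sum_congr rfl fun a _ => ?_
      rw [← Equiv.sum_comp e (fun β => ∑ δ, Φ (e a) β δ)]
      refine Finset.sum_congr rfl fun b _ => ?_
      rw [← Equiv.sum_comp e (fun δ => Φ (e a) (e b) δ)]
    refine Eq.trans ?_ hΦ.symm
    have hprod : ∑ α, ∑ β, ∑ δ, Φ α β δ = ∑ p : ((Fin ℓ × Fin (2 ^ (K + 1))) × Fin s) ×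
        ((Fin ℓ × Fin (2 ^ (K + 1))) × Fin s) × ((Fin ℓ × Fin (2 ^ (K + 1))) × Fin s),
        Φ p.1 p.2.1 p.2.2 := by
      simp only [Fintype.sum_prod_type]
    rw [hprod]
    -- Regroups three labels and three exponents into one pair of label and exponent per direction.
    let σ : (((Fin ℓ × Fin (2 ^ (K + 1))) × (Fin ℓ × Fin (2 ^ (K + 1))) ×
        (Fin ℓ × Fin (2 ^ (K + 1)))) × Fin s × Fin s × Fin s) ≃
        ((Fin ℓ × Fin (2 ^ (K + 1))) × Fin s) × ((Fin ℓ × Fin (2 ^ (K + 1))) × Fin s) ×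
        ((Fin ℓ × Fin (2 ^ (K + 1))) × Fin s) :=
      ⟨fun p => ((p.1.1, p.2.1), (p.1.2.1, p.2.2.1), (p.1.2.2, p.2.2.2)),
      fun p => ((p.1.1, p.2.1.1, p.2.2.1), p.1.2, p.2.1.2, p.2.2.2), fun _ => rfl, fun _ => rfl⟩
    rw [← Equiv.sum_comp σ]
    refine Finset.sum_congr rfl fun p _ => ?_
    obtain ⟨⟨a₁, a₂, a₃⟩, t₁, t₂, t₃⟩ := p
    simp only [Φ, f, labelFam, σ, Equiv.coe_fn_mk, Prod.mk.injEq]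
    by_cases h₁ : finLabel ℓ K (digits i) = a₁
    · by_cases h₂ : finLabel ℓ K (digits j) = a₂
      · by_cases h₃ : finLabel ℓ K (digits k) = a₃
        · simp [h₁, h₂, h₃, mul_assoc]
        · simp [h₃]
      · simp [h₂]
    · simp [h₁]
  · rw [hr]
    nlinarith [hN]

end

end QTTApprox

namespace QTTApprox

/-! ### Weak derivatives -/

/-- The standard basis vectors. -/
noncomputable abbrev unitVec (i : Fin 3) : E3 := EuclideanSpace.single i 1

lemma multiDeriv_zero (f : E3 → ℝ) : multiDeriv 0 f = f := by
  simp [multiDeriv]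

lemma multiDeriv_single (i : Fin 3) (f : E3 → ℝ) :
    multiDeriv (Pi.single i 1) f = partialDeriv i f := by
  fin_cases i <;> simp [multiDeriv]

lemma antidiagonalTuple_three_one {α : Fin 3 → ℕ}
    (h : α ∈ Finset.Nat.antidiagonalTuple 3 1) : ∃ i, α = Pi.single i 1 := by
  rw [Finset.Nat.mem_antidiagonalTuple, Fin.sum_univ_three] at h
  by_cases h0 : α 0 = 1
  · refine ⟨0, ?_⟩
    funext j
    fin_cases j <;> simp <;> omega
  by_cases h1 : α 1 = 1
  · refine ⟨1, ?_⟩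
    funext j
    fin_cases j <;> simp <;> omega
  · refine ⟨2, ?_⟩
    funext j
    fin_cases j <;> simp <;> omega

lemma contDiff_partialDeriv {f : E3 → ℝ} (hf : ContDiff ℝ ∞ f) (i : Fin 3) :
    ContDiff ℝ ∞ (partialDeriv i f) :=
  (hf.fderiv_right (m := ∞) (by simp)).clm_apply contDiff_const

lemma contDiff_iterate_partialDeriv {f : E3 → ℝ} (hf : ContDiff ℝ ∞ f) (i : Fin 3) (n : ℕ) :
    ContDiff ℝ ∞ ((partialDeriv i)^[n] f) := by
  induction n with
  | zero => simpa
  | succ n ih =>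
    rw [Function.iterate_succ_apply']
    exact contDiff_partialDeriv ih i

lemma contDiff_multiDeriv {f : E3 → ℝ} (hf : ContDiff ℝ ∞ f) (α : Fin 3 → ℕ) :
    ContDiff ℝ ∞ (multiDeriv α f) :=
  contDiff_iterate_partialDeriv (contDiff_iterate_partialDeriv
    (contDiff_iterate_partialDeriv hf _ _) _ _) _ _

lemma tsupport_partialDeriv (f : E3 → ℝ) (i : Fin 3) :
    tsupport (partialDeriv i f) ⊆ tsupport f := by
  refine closure_minimal (fun x hx => ?_) isClosed_closure
  have : fderiv ℝ f x ≠ 0 := by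
    rintro h
    exact hx (by simp [partialDeriv, h])
  exact support_fderiv_subset ℝ this

lemma tsupport_iterate_partialDeriv (f : E3 → ℝ) (i : Fin 3) (n : ℕ) :
    tsupport ((partialDeriv i)^[n] f) ⊆ tsupport f := by
  induction n with
  | zero => simp
  | succ n ih =>
    rw [Function.iterate_succ_apply']
    exact (tsupport_partialDeriv _ _).trans ih

lemma tsupport_multiDeriv (f : E3 → ℝ) (α : Fin 3 → ℕ) :
    tsupport (multiDeriv α f) ⊆ tsupport f :=
  (tsupport_iterate_partialDeriv _ _ _).trans ((tsupport_iterate_partialDeriv _ _ _).trans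
    (tsupport_iterate_partialDeriv _ _ _))

lemma isOpen_Q : IsOpen Q := by
  have : Q = ⋂ i : Fin 3, (fun x : E3 => x i) ⁻¹' Set.Ioo (0 : ℝ) 1 := by
    ext x; simp [Q]
  rw [this]
  exact isOpen_iInter_of_finite fun i => isOpen_Ioo.preimage (by fun_prop)

lemma measurableSet_Q : MeasurableSet Q := isOpen_Q.measurableSet

lemma integrableOn_mul_test {u φ : E3 → ℝ} (hu : LocallyIntegrableOn u Q) (hφ : Continuous φ)
    (hc : HasCompactSupport φ) (hs : tsupport φ ⊆ Q) :
    IntegrableOn (fun x => u x * φ x) Q := by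
  have h1 : IntegrableOn u (tsupport φ) := hu.integrableOn_compact_subset hs hc
  have h2 : IntegrableOn (fun x => u x * φ x) (tsupport φ) :=
    h1.mul_continuousOn hφ.continuousOn hc
  refine Integrable.integrableOn ?_
  refine (integrableOn_iff_integrable_of_support_subset ?_).1 h2
  intro x hx
  refine subset_tsupport _ ?_
  intro h
  exact hx (by simp [h])

lemma HasWeakDeriv.sub {α : Fin 3 → ℕ} {u g u' g' : E3 → ℝ} (h : HasWeakDeriv α u g)
    (h' : HasWeakDeriv α u' g') : HasWeakDeriv α (u - u') (g - g') where
  locInt_fun := h.locInt_fun.sub h'.locInt_fun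
  locInt_deriv := h.locInt_deriv.sub h'.locInt_deriv
  integral_eq φ hφ hc hs := by
    have c1 := (contDiff_multiDeriv hφ α).continuous
    have c2 : HasCompactSupport (multiDeriv α φ) :=
      hc.of_isClosed_subset (isClosed_tsupport _) (tsupport_multiDeriv φ α)
    have c3 := (tsupport_multiDeriv φ α).trans hs
    simp only [Pi.sub_apply, sub_mul]
    rw [integral_sub (integrableOn_mul_test h.locInt_fun c1 c2 c3)
      (integrableOn_mul_test h'.locInt_fun c1 c2 c3), h.integral_eq φ hφ hc hs,
      h'.integral_eq φ hφ hc hs,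
      integral_sub (integrableOn_mul_test h.locInt_deriv hφ.continuous hc hs)
      (integrableOn_mul_test h'.locInt_deriv hφ.continuous hc hs)]
    ring

/-- The fundamental lemma of the calculus of variations, applied to the difference. -/
lemma HasWeakDeriv.ae_unique {α : Fin 3 → ℕ} {u g g' : E3 → ℝ} (h : HasWeakDeriv α u g)
    (h' : HasWeakDeriv α u g') : g =ᵐ[volume.restrict Q] g' := by
  have key : ∀ᵐ x : E3, x ∈ Q → g x - g' x = 0 := by
    refine IsOpen.ae_eq_zero_of_integral_contDiff_smul_eq_zero isOpen_Q
      (h.locInt_deriv.sub h'.locInt_deriv) fun φ hφ hc hs => ?_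
    have e1 := h.integral_eq φ hφ hc hs
    have e2 := h'.integral_eq φ hφ hc hs
    rw [e1] at e2
    have e3 := mul_left_cancel₀ (pow_ne_zero _ (by norm_num)) e2
    have e4 : ∫ x in Q, (g x - g' x) * φ x = 0 := by
      simp only [sub_mul]
      rw [integral_sub (integrableOn_mul_test h.locInt_deriv hφ.continuous hc hs)
        (integrableOn_mul_test h'.locInt_deriv hφ.continuous hc hs), e3, sub_self]
    rw [setIntegral_eq_integral_of_forall_compl_eq_zero] at e4
    · rw [← e4]
      congr 1
      funext x
      simp [mul_comm]
    · intro x hx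
      have : φ x = 0 := image_eq_zero_of_notMem_tsupport fun h => hx (hs h)
      simp [this]
  rw [EventuallyEq, ae_restrict_iff' measurableSet_Q]
  filter_upwards [key] with x hx hQ
  exact sub_eq_zero.1 (hx hQ)

lemma hasWeakDeriv_zero {u : E3 → ℝ} (hu : LocallyIntegrableOn u Q) : HasWeakDeriv 0 u u where
  locInt_fun := hu
  locInt_deriv := hu
  integral_eq φ _ _ _ := by simp [multiDeriv_zero]

/-- Lipschitz functions are differentiable almost everywhere and can be integrated by parts. This
covers the finite element functions, which are only piecewise smooth. -/
lemma hasWeakDeriv_of_lipschitz {C : NNReal} {f : E3 → ℝ} (hf : LipschitzWith C f) (i : Fin 3) :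
    HasWeakDeriv (Pi.single i 1) f (fun x => lineDeriv ℝ f x (unitVec i)) where
  locInt_fun := (hf.continuous.locallyIntegrable).locallyIntegrableOn _
  locInt_deriv := (hf.locallyIntegrable_lineDeriv (unitVec i)).locallyIntegrableOn _
  integral_eq φ hφ hc hs := by
    have hφ1 : ContDiff ℝ 1 φ := hφ.of_le (by simp)
    obtain ⟨D, hD⟩ := hφ1.lipschitzWith_of_hasCompactSupport hc (by simp)
    have key := hf.integral_lineDeriv_mul_eq (μ := volume) hD hc (unitVec i)
    have h1 : ∀ x, lineDeriv ℝ φ x (-unitVec i) = - partialDeriv i φ x := fun x => by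
      rw [((hφ1.differentiable (by simp)) x).lineDeriv_eq_fderiv]
      simp [partialDeriv]
    rw [multiDeriv_single, setIntegral_eq_integral_of_forall_compl_eq_zero,
      setIntegral_eq_integral_of_forall_compl_eq_zero, key]
    · simp only [h1]
      rw [← integral_const_mul]
      congr 1
      funext x
      simp [mul_comm]
    · intro x hx
      have : φ x = 0 := image_eq_zero_of_notMem_tsupport fun h => hx (hs h)
      simp [this]
    · intro x hx
      have : partialDeriv i φ x = 0 := image_eq_zero_of_notMem_tsupport
        fun h => hx (hs (tsupport_partialDeriv _ _ h))
      simp [this]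

/-- The `H¹(Q)` norm is controlled by the `L²(Q)` norms of the function and of weak derivatives. -/
lemma h1Norm_le {u : E3 → ℝ} (hu : LocallyIntegrableOn u Q) {g : Fin 3 → E3 → ℝ}
    (hg : ∀ i, HasWeakDeriv (Pi.single i 1) u (g i)) {δ : ℝ≥0∞}
    (h0 : eLpNorm u 2 (volume.restrict Q) ≤ δ)
    (h1 : ∀ i, eLpNorm (g i) 2 (volume.restrict Q) ≤ δ) : h1Norm u ≤ 2 * δ := by
  have hle : ∀ {α : Fin 3 → ℕ} {g : E3 → ℝ}, HasWeakDeriv α u g →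
      eLpNorm g 2 (volume.restrict Q) ≤ δ → weightedNorm 0 α u ≤ δ := by
    intro α g hg h
    refine (iInf₂_le g hg).trans ?_
    simpa using h
  -- One multi-index of order zero and three of order one, each contributing at most δ², give 4δ² =
  -- (2δ)².
  have hsum : ∑ k ∈ Finset.range 2, ∑ α ∈ Finset.Nat.antidiagonalTuple 3 k,
      weightedNorm 0 α u ^ 2 ≤ (2 * δ) ^ 2 := by
    rw [Finset.sum_range_succ, Finset.sum_range_one]
    have a0 : ∑ α ∈ Finset.Nat.antidiagonalTuple 3 0, weightedNorm 0 α u ^ 2 ≤ δ ^ 2 := by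
      rw [Finset.Nat.antidiagonalTuple_zero_right, Finset.sum_singleton]
      gcongr
      exact hle (hasWeakDeriv_zero hu) h0
    have a1 : ∑ α ∈ Finset.Nat.antidiagonalTuple 3 1, weightedNorm 0 α u ^ 2 ≤ 3 * δ ^ 2 := by
      have hcard : (Finset.Nat.antidiagonalTuple 3 1).card = 3 := by decide
      refine (Finset.sum_le_card_nsmul _ _ (δ ^ 2) fun α hα => ?_).trans (by rw [hcard]; simp)
      obtain ⟨i, rfl⟩ := antidiagonalTuple_three_one hα
      gcongr
      exact hle (hg i) (h1 i)
    calc _ ≤ δ ^ 2 + 3 * δ ^ 2 := add_le_add a0 a1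
      _ = (2 * δ) ^ 2 := by ring
  calc h1Norm u ≤ ((2 * δ) ^ 2) ^ (1 / 2 : ℝ) := by
        unfold h1Norm
        gcongr
    _ = 2 * δ := by
        rw [← ENNReal.rpow_natCast, ← ENNReal.rpow_mul]
        norm_num

/-! ### Functions in the finite element space -/

lemma hat_nonneg (ℓ i : ℕ) (t : ℝ) : 0 ≤ hat ℓ i t := le_max_left _ _

lemma hat_le_one (ℓ i : ℕ) (t : ℝ) : hat ℓ i t ≤ 1 :=
  max_le zero_le_one (by linarith [abs_nonneg (2 ^ ℓ * t - i)])

lemma hat_lipschitz (ℓ i : ℕ) (t t' : ℝ) : |hat ℓ i t - hat ℓ i t'| ≤ 2 ^ ℓ * |t - t'| := by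
  have h1 : |hat ℓ i t - hat ℓ i t'| ≤ |(1 - |2 ^ ℓ * t - i|) - (1 - |2 ^ ℓ * t' - i|)| := by
    unfold hat
    have := abs_max_sub_max_le_abs (1 - |2 ^ ℓ * t - i|) (1 - |2 ^ ℓ * t' - i|) 0
    simpa only [max_comm] using this
  refine h1.trans ?_
  have h2 : (1 - |2 ^ ℓ * t - i|) - (1 - |2 ^ ℓ * t' - i|) =
    |2 ^ ℓ * t' - i| - |2 ^ ℓ * t - i| := by ring
  rw [h2]
  refine (abs_abs_sub_abs_le_abs_sub _ _).trans ?_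
  have h3 : 2 ^ ℓ * t' - i - (2 ^ ℓ * t - i) = 2 ^ ℓ * (t' - t) := by ring
  rw [h3, abs_mul, abs_of_pos (by positivity), abs_sub_comm]

/-- The function of the finite element space with coefficients `A`. -/
noncomputable def feFun (ℓ : ℕ) (A : ℕ → ℕ → ℕ → ℝ) (x : E3) : ℝ :=
  ∑ i : Fin (2 ^ ℓ), ∑ j : Fin (2 ^ ℓ), ∑ k : Fin (2 ^ ℓ), A i j k * lagrange ℓ i j k x

lemma feFun_mem (ℓ : ℕ) (A : ℕ → ℕ → ℕ → ℝ) : feFun ℓ A ∈ feSpace ℓ := by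
  have : feFun ℓ A = ∑ i : Fin (2 ^ ℓ), ∑ j : Fin (2 ^ ℓ), ∑ k : Fin (2 ^ ℓ),
      A i j k • lagrange ℓ i j k := by
    funext x
    simp [feFun]
  rw [this]
  exact Submodule.sum_mem _ fun i _ => Submodule.sum_mem _ fun j _ => Submodule.sum_mem _
    fun k _ => Submodule.smul_mem _ _ (Submodule.subset_span ⟨i, j, k, rfl⟩)

/-- On a mesh interval, a combination of hat functions interpolates linearly. -/
lemma sum_hat {ℓ : ℕ} {f : ℕ → ℝ} (hf : f (2 ^ ℓ) = 0) {I : ℕ} (hI : I < 2 ^ ℓ) {t θ : ℝ}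
    (h0 : 0 ≤ θ) (h1 : θ ≤ 1) (ht : 2 ^ ℓ * t = I + θ) :
    ∑ i : Fin (2 ^ ℓ), f i * hat ℓ i t = (1 - θ) * f I + θ * f (I + 1) := by
  -- Adding the node `2 ^ ℓ`, where `f` vanishes, lets the last mesh interval be treated like the
  -- others.
  have e1 : ∑ i : Fin (2 ^ ℓ), f i * hat ℓ i t =
      ∑ i ∈ Finset.range (2 ^ ℓ + 1), f i * hat ℓ i t := by
    rw [Finset.sum_range_succ, hf, zero_mul, add_zero, Finset.sum_range]
  rw [e1, ← Finset.sum_subset (s₁ := {I, I + 1})]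
  · rw [Finset.sum_pair (by omega)]
    have a1 : hat ℓ I t = 1 - θ := by
      rw [hat, ht, add_sub_cancel_left, abs_of_nonneg h0, max_eq_right (by linarith)]
    have a2 : hat ℓ (I + 1) t = θ := by
      rw [hat, ht]
      push_cast
      rw [show (I : ℝ) + θ - (I + 1) = -(1 - θ) by ring, abs_neg, abs_of_nonneg (by linarith),
        max_eq_right (by linarith)]
      ring
    rw [a1, a2]
    ring
  · intro i hi
    simp only [Finset.mem_insert, Finset.mem_singleton] at hi
    simp only [Finset.mem_range]
    omega
  · intro i _ hi
    simp only [Finset.mem_insert, Finset.mem_singleton, not_or] at hi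
    have : hat ℓ i t = 0 := by
      rw [hat, ht]
      refine max_eq_left ?_
      rcases lt_or_gt_of_ne hi.1 with h | h
      · have : ((i + 1 : ℕ) : ℝ) ≤ I := by exact_mod_cast h
        push_cast at this
        have := le_abs_self ((I : ℝ) + θ - i)
        linarith
      · have h' : I + 2 ≤ i := by omega
        have : ((I + 2 : ℕ) : ℝ) ≤ i := by exact_mod_cast h'
        push_cast at this
        have := neg_abs_le ((I : ℝ) + θ - i)
        linarith
    rw [this, mul_zero]

/-- The trilinear interpolant of the values of `W` at the vertices of a mesh cell. -/
noncomputable def trilin (W : ℕ → ℕ → ℕ → ℝ) (I J L : ℕ) (a b c : ℝ) : ℝ :=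
  (1 - a) * ((1 - b) * ((1 - c) * W I J L + c * W I J (L + 1)) +
    b * ((1 - c) * W I (J + 1) L + c * W I (J + 1) (L + 1))) +
  a * ((1 - b) * ((1 - c) * W (I + 1) J L + c * W (I + 1) J (L + 1)) +
    b * ((1 - c) * W (I + 1) (J + 1) L + c * W (I + 1) (J + 1) (L + 1)))

/-- Extension of the coefficients by zero to all nodes. -/
noncomputable def extendZero (ℓ : ℕ) (A : ℕ → ℕ → ℕ → ℝ) (i j k : ℕ) : ℝ :=
  if i < 2 ^ ℓ ∧ j < 2 ^ ℓ ∧ k < 2 ^ ℓ then A i j k else 0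

/-- `sum_hat` in one variable after the other. The zero extension to index `2 ^ ℓ` encodes the zero
boundary values on Γ. -/
lemma feFun_eq_trilin {ℓ : ℕ} (A : ℕ → ℕ → ℕ → ℝ) {I J L : ℕ} (hI : I < 2 ^ ℓ)
    (hJ : J < 2 ^ ℓ) (hL : L < 2 ^ ℓ) {x : E3} {a b c : ℝ} (ha : a ∈ Set.Icc (0 : ℝ) 1)
    (hb : b ∈ Set.Icc (0 : ℝ) 1) (hc : c ∈ Set.Icc (0 : ℝ) 1) (hx0 : 2 ^ ℓ * x 0 = I + a)
    (hx1 : 2 ^ ℓ * x 1 = J + b) (hx2 : 2 ^ ℓ * x 2 = L + c) :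
    feFun ℓ A x = trilin (extendZero ℓ A) I J L a b c := by
  set W := extendZero ℓ A with hW
  have e : feFun ℓ A x = ∑ i : Fin (2 ^ ℓ), (∑ j : Fin (2 ^ ℓ), (∑ k : Fin (2 ^ ℓ),
      W i j k * hat ℓ k (x 2)) * hat ℓ j (x 1)) * hat ℓ i (x 0) := by
    simp only [feFun, lagrange, Finset.sum_mul]
    refine Finset.sum_congr rfl fun i _ => Finset.sum_congr rfl fun j _ =>
      Finset.sum_congr rfl fun k _ => ?_
    simp only [hW, extendZero, i.2, j.2, k.2, and_self, if_true]
    ring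
  rw [e]
  have s2 : ∀ i j : ℕ, ∑ k : Fin (2 ^ ℓ), W i j k * hat ℓ k (x 2) =
      (1 - c) * W i j L + c * W i j (L + 1) := fun i j =>
    sum_hat (f := fun k => W i j k) (by simp [hW, extendZero]) hL hc.1 hc.2 hx2
  simp only [s2]
  have s1 : ∀ i : ℕ, ∑ j : Fin (2 ^ ℓ), ((1 - c) * W i j L + c * W i j (L + 1)) * hat ℓ j (x 1) =
      (1 - b) * ((1 - c) * W i J L + c * W i J (L + 1)) +
        b * ((1 - c) * W i (J + 1) L + c * W i (J + 1) (L + 1)) := fun i =>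
    sum_hat (f := fun j => (1 - c) * W i j L + c * W i j (L + 1)) (by simp [hW, extendZero])
      hJ hb.1 hb.2 hx1
  simp only [s1]
  exact sum_hat (f := fun i => (1 - b) * ((1 - c) * W i J L + c * W i J (L + 1)) +
        b * ((1 - c) * W i (J + 1) L + c * W i (J + 1) (L + 1))) (by simp [hW, extendZero])
      hI ha.1 ha.2 hx0

lemma analysis_feFun (ℓ : ℕ) (A : ℕ → ℕ → ℕ → ℝ) :
    analysis ℓ (feFun ℓ A) = fun (i j k : Fin (2 ^ ℓ)) => A i j k := by
  funext i j k
  rw [analysis, feFun_eq_trilin A i.2 j.2 k.2 (a := 0) (b := 0) (c := 0) (by simp) (by simp)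
    (by simp) (by simp [node]; field_simp) (by simp [node]; field_simp)
    (by simp [node]; field_simp)]
  simp [trilin, extendZero]

/-- Gives access to `hasWeakDeriv_of_lipschitz`; the size of the constant plays no role. -/
lemma feFun_lipschitz (ℓ : ℕ) (A : ℕ → ℕ → ℕ → ℝ) : ∃ C, LipschitzWith C (feFun ℓ A) := by
  have hlag : ∀ i j k : ℕ, LipschitzWith (3 * 2 ^ ℓ) (lagrange ℓ i j k) := by
    intro i j k
    refine LipschitzWith.of_dist_le_mul fun x y => ?_
    have hc : ∀ m : Fin 3, |x m - y m| ≤ dist x y := fun m => by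
      rw [dist_eq_norm]
      exact PiLp.norm_apply_le (x - y) m
    have h0 := (hat_lipschitz ℓ i (x 0) (y 0)).trans (mul_le_mul_of_nonneg_left (hc 0) (by positivity))
    have h1 := (hat_lipschitz ℓ j (x 1) (y 1)).trans (mul_le_mul_of_nonneg_left (hc 1) (by positivity))
    have h2 := (hat_lipschitz ℓ k (x 2) (y 2)).trans (mul_le_mul_of_nonneg_left (hc 2) (by positivity))
    have key : ∀ a b c a' b' c' : ℝ, 0 ≤ a → a ≤ 1 → 0 ≤ b → b ≤ 1 → 0 ≤ b' → b' ≤ 1 → 0 ≤ c' →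
        c' ≤ 1 → 0 ≤ a' → a' ≤ 1 → 0 ≤ c → c ≤ 1 →
        |a * b * c - a' * b' * c'| ≤ |a - a'| + |b - b'| + |c - c'| := by
      intro a b c a' b' c' _ _ _ _ _ _ _ _ _ _ _ _
      have : a * b * c - a' * b' * c' = (a - a') * (b * c) + (b - b') * (a' * c)
        + (c - c') * (a' * b') := by ring
      rw [this]
      have hm : ∀ z p q : ℝ, 0 ≤ p → p ≤ 1 → 0 ≤ q → q ≤ 1 → |z * (p * q)| ≤ |z| := by
        intro z p q hp hp1 hq hq1
        rw [abs_mul, abs_of_nonneg (mul_nonneg hp hq)]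
        exact mul_le_of_le_one_right (abs_nonneg _) (mul_le_one₀ hp1 hq hq1)
      refine (abs_add_le _ _).trans (add_le_add ((abs_add_le _ _).trans (add_le_add ?_ ?_)) ?_) <;>
        (apply hm <;> assumption)
    rw [Real.dist_eq, lagrange, lagrange]
    refine (key _ _ _ _ _ _ (hat_nonneg _ _ _) (hat_le_one _ _ _) (hat_nonneg _ _ _)
      (hat_le_one _ _ _) (hat_nonneg _ _ _) (hat_le_one _ _ _) (hat_nonneg _ _ _)
      (hat_le_one _ _ _) (hat_nonneg _ _ _) (hat_le_one _ _ _) (hat_nonneg _ _ _)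
      (hat_le_one _ _ _)).trans ?_
    push_cast
    linarith
  have hsum : ∀ {ι : Type} (s : Finset ι) (f : ι → E3 → ℝ), (∀ i, ∃ C, LipschitzWith C (f i)) →
      ∃ C, LipschitzWith C (fun x => ∑ i ∈ s, f i x) := by
    classical
    intro ι s f hf
    induction s using Finset.induction_on with
    | empty => exact ⟨0, by simp⟩
    | insert a s ha ih =>
      obtain ⟨C, hC⟩ := ih
      obtain ⟨C', hC'⟩ := hf a
      refine ⟨C' + C, ?_⟩
      simp only [Finset.sum_insert ha]
      exact hC'.add hC
  unfold feFun
  refine hsum _ _ fun i => hsum _ _ fun j => hsum _ _ fun k => ⟨‖A i j k‖₊ * (3 * 2 ^ ℓ), ?_⟩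
  exact (lipschitzWith_smul (A i j k)).comp (hlag i j k)

end QTTApprox

namespace QTTApprox

/-! ### Calculus of partial derivatives -/

lemma partialDeriv_comm {f : E3 → ℝ} (hf : ContDiff ℝ ∞ f) (i j : Fin 3) :
    partialDeriv i (partialDeriv j f) = partialDeriv j (partialDeriv i f) := by
  have hd : Differentiable ℝ (fderiv ℝ f) :=
    (hf.fderiv_right (m := ∞) (by simp)).differentiable (by simp)
  have h : ∀ (i j : Fin 3) x, partialDeriv i (partialDeriv j f) x =
      fderiv ℝ (fderiv ℝ f) x (unitVec i) (unitVec j) := by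
    intro i j x
    change fderiv ℝ (fun y => fderiv ℝ f y (unitVec j)) x (unitVec i) = _
    rw [fderiv_clm_apply (hd x) (differentiableAt_const _)]
    simp
  funext x
  rw [h, h]
  have hs : IsSymmSndFDerivAt ℝ f x :=
    (hf.contDiffAt (x := x)).isSymmSndFDerivAt (by simpa using ENat.LEInfty.out)
  exact hs _ _

lemma partialDeriv_iterate_comm {f : E3 → ℝ} (hf : ContDiff ℝ ∞ f) (i j : Fin 3) (n : ℕ) :
    partialDeriv i ((partialDeriv j)^[n] f) = (partialDeriv j)^[n] (partialDeriv i f) := by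
  induction n with
  | zero => rfl
  | succ n ih =>
    rw [Function.iterate_succ_apply', partialDeriv_comm (contDiff_iterate_partialDeriv hf j n),
      ih, Function.iterate_succ_apply']

lemma partialDeriv_multiDeriv {f : E3 → ℝ} (hf : ContDiff ℝ ∞ f) (i : Fin 3) (α : Fin 3 → ℕ) :
    partialDeriv i (multiDeriv α f) = multiDeriv (α + Pi.single i 1) f := by
  have c2 := contDiff_iterate_partialDeriv hf 2 (α 2)
  have c1 := contDiff_iterate_partialDeriv c2 1 (α 1)
  fin_cases i
  · simp [multiDeriv, Function.iterate_succ_apply']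
  · simp only [multiDeriv, Fin.mk_one]
    rw [partialDeriv_iterate_comm c1]
    simp [Function.iterate_succ_apply']
  · simp only [multiDeriv, Fin.reduceFinMk]
    rw [partialDeriv_iterate_comm c1, partialDeriv_iterate_comm c2]
    simp [Function.iterate_succ_apply']

lemma toLp_update (z : Fin 3 → ℝ) (i : Fin 3) (t : ℝ) :
    (WithLp.toLp 2 (Function.update z i t) : E3) = WithLp.toLp 2 z + (t - z i) • unitVec i := by
  ext j
  by_cases h : j = i
  · subst h; simp
  · simp [h]

lemma hasDerivAt_line {f : E3 → ℝ} (hf : ContDiff ℝ ∞ f) (x : E3) (i : Fin 3) (t : ℝ) :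
    HasDerivAt (fun t : ℝ => f (x + t • unitVec i)) (partialDeriv i f (x + t • unitVec i)) t := by
  have h1 : HasDerivAt (fun t : ℝ => x + t • unitVec i) (unitVec i) t := by
    simpa using ((hasDerivAt_id t).smul_const (unitVec i)).const_add x
  exact ((hf.differentiable (by simp)) _).hasFDerivAt.comp_hasDerivAt t h1

lemma hasDerivAt_update_line {f : E3 → ℝ} (hf : ContDiff ℝ ∞ f) (z : Fin 3 → ℝ) (i : Fin 3)
    (t : ℝ) : HasDerivAt (fun t : ℝ => f (WithLp.toLp 2 (Function.update z i t)))
      (partialDeriv i f (WithLp.toLp 2 (Function.update z i t))) t := by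
  have h := (hasDerivAt_line hf (WithLp.toLp 2 z) i (t - z i)).comp t
    ((hasDerivAt_id t).sub_const (z i))
  simp only [mul_one] at h
  rw [← toLp_update] at h
  refine h.congr_of_eventuallyEq (Eventually.of_forall fun t => ?_)
  simp [toLp_update]

/-! ### Pointwise bounds from square integrals of mixed derivatives -/

/-- Cauchy–Schwarz, obtained by expanding the nonnegative integral of `((b - a) * g - m) ^ 2`. -/
lemma sq_integral_le {g : ℝ → ℝ} (hg : Continuous g) {a b : ℝ} (hab : a < b) :
    (∫ t in a..b, g t) ^ 2 ≤ (b - a) * ∫ t in a..b, g t ^ 2 := by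
  set m := ∫ t in a..b, g t
  have h : 0 ≤ ∫ t in a..b, ((b - a) * g t - m) ^ 2 :=
    intervalIntegral.integral_nonneg hab.le fun t _ => sq_nonneg _
  have e : ∫ t in a..b, ((b - a) * g t - m) ^ 2 =
      (b - a) ^ 2 * (∫ t in a..b, g t ^ 2) - (b - a) * m ^ 2 := by
    have : ∀ t, ((b - a) * g t - m) ^ 2 =
      (b - a) ^ 2 * g t ^ 2 - 2 * (b - a) * m * g t + m ^ 2 := fun t => by ring
    simp only [this]
    rw [intervalIntegral.integral_add, intervalIntegral.integral_sub,
      intervalIntegral.integral_const_mul, intervalIntegral.integral_const_mul,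
      intervalIntegral.integral_const]
    · simp only [smul_eq_mul]; ring
    all_goals exact Continuous.intervalIntegrable (by fun_prop) _ _
  rw [e] at h
  have hb : 0 < b - a := sub_pos.2 hab
  have : 0 ≤ (b - a) * ((b - a) * (∫ t in a..b, g t ^ 2) - m ^ 2) := by linarith
  have := nonneg_of_mul_nonneg_right this hb
  linarith

/-- A one-dimensional Sobolev inequality: write `g y` as `g t` plus an integral of `g'`, square, and
average over `t`. -/
lemma sq_le_integral {g g' : ℝ → ℝ} (hg : ∀ t, HasDerivAt g (g' t) t) (hg' : Continuous g')
    {a η y : ℝ} (hη : 0 < η) (hy : y ∈ Set.Icc a (a + η)) :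
    g y ^ 2 ≤ ∫ t in a..(a + η), (2 / η * g t ^ 2 + 2 * η * g' t ^ 2) := by
  have hgc : Continuous g := continuous_iff_continuousAt.2 fun t => (hg t).continuousAt
  have hab : a < a + η := by linarith
  set I := ∫ t in a..(a + η), g' t ^ 2 with hI
  have h1 : ∀ t ∈ Set.Icc a (a + η), g y ^ 2 ≤ 2 * g t ^ 2 + 2 * (η * I) := by
    intro t ht
    have e1 : g y = g t + ∫ u in t..y, g' u := by
      rw [intervalIntegral.integral_eq_sub_of_hasDerivAt (fun u _ => hg u)
        (hg'.intervalIntegrable _ _)]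
      ring
    have e2 : |∫ u in t..y, g' u| ≤ ∫ u in a..(a + η), |g' u| := by
      have h := intervalIntegral.norm_integral_le_abs_integral_norm (f := g') (a := t) (b := y)
        (μ := volume)
      simp only [Real.norm_eq_abs] at h
      refine h.trans ?_
      refine (intervalIntegral.abs_integral_mono_interval (c := a) (d := a + η) ?_ ?_ ?_).trans
        (le_of_eq ?_)
      · rw [Set.uIoc_of_le hab.le]
        intro u hu
        rw [Set.mem_uIoc] at hu
        constructor
        · rcases hu with hu | hu
          · exact ht.1.trans_lt hu.1
          · exact hy.1.trans_lt hu.1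
        · rcases hu with hu | hu
          · exact hu.2.trans hy.2
          · exact hu.2.trans ht.2
      · exact Eventually.of_forall fun u => abs_nonneg _
      · exact hg'.abs.intervalIntegrable _ _
      · exact abs_of_nonneg (intervalIntegral.integral_nonneg hab.le fun _ _ => abs_nonneg _)
    have e3 := sq_integral_le hg'.abs hab
    simp only [sq_abs, add_sub_cancel_left] at e3
    have e4 : (∫ u in t..y, g' u) ^ 2 ≤ η * I := by
      refine le_trans ?_ e3
      rw [← sq_abs]
      exact pow_le_pow_left₀ (abs_nonneg _) e2 2
    rw [e1]
    nlinarith [sq_nonneg (g t - ∫ u in t..y, g' u)]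
  have h2 : ∫ t in a..(a + η), g y ^ 2 ≤ ∫ t in a..(a + η), (2 * g t ^ 2 + 2 * (η * I)) := by
    refine intervalIntegral.integral_mono_on hab.le ?_ ?_ h1
    · exact continuous_const.intervalIntegrable _ _
    · exact Continuous.intervalIntegrable (by fun_prop) _ _
  rw [intervalIntegral.integral_const, intervalIntegral.integral_add,
    intervalIntegral.integral_const_mul, intervalIntegral.integral_const] at h2
  rotate_left
  · exact Continuous.intervalIntegrable (by fun_prop) _ _
  · exact continuous_const.intervalIntegrable _ _
  rw [intervalIntegral.integral_add, intervalIntegral.integral_const_mul,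
    intervalIntegral.integral_const_mul, ← hI]
  rotate_left
  · exact Continuous.intervalIntegrable (by fun_prop) _ _
  · exact Continuous.intervalIntegrable (by fun_prop) _ _
  simp only [add_sub_cancel_left, smul_eq_mul] at h2
  set J := ∫ t in a..(a + η), g t ^ 2
  have : g y ^ 2 ≤ (2 * J + η * (2 * (η * I))) / η := by
    rw [le_div_iff₀ hη]; linarith
  refine this.trans (le_of_eq ?_)
  field_simp

/-- `sq_le_integral` in direction `i` replaces each function by itself and its derivative, marked by
a Boolean. The result is again a weighted sum of squares, so the step can be iterated over the three
directions. -/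
lemma ofReal_sum_sq_le {ι : Type} [Fintype ι] (f : ι → E3 → ℝ) (hf : ∀ k, ContDiff ℝ ∞ (f k))
    (c : ι → ℝ) (hc : ∀ k, 0 ≤ c k) {a η : ℝ} (hη : 0 < η) (i : Fin 3) (z : Fin 3 → ℝ)
    (hz : z i ∈ Set.Icc a (a + η)) :
    ENNReal.ofReal (∑ k, c k * f k (WithLp.toLp 2 z) ^ 2) ≤
      ∫⁻ t in Set.Ioo a (a + η), ENNReal.ofReal (∑ k : ι × Bool,
        (bif k.2 then 2 * η * c k.1 else 2 / η * c k.1) *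
        (bif k.2 then partialDeriv i (f k.1) else f k.1)
          (WithLp.toLp 2 (Function.update z i t)) ^ 2) := by
  have hcont : ∀ g : E3 → ℝ, ContDiff ℝ ∞ g →
      Continuous fun t : ℝ => g (WithLp.toLp 2 (Function.update z i t)) := fun g hg =>
    continuous_iff_continuousAt.2 fun t => (hasDerivAt_update_line hg z i t).continuousAt
  have h1 : ∀ k, f k (WithLp.toLp 2 z) ^ 2 ≤ ∫ t in a..(a + η),
      (2 / η * f k (WithLp.toLp 2 (Function.update z i t)) ^ 2 +
      2 * η * partialDeriv i (f k) (WithLp.toLp 2 (Function.update z i t)) ^ 2) := by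
    intro k
    have := sq_le_integral (fun t => hasDerivAt_update_line (hf k) z i t)
      (hcont _ (contDiff_partialDeriv (hf k) i)) hη hz
    simpa using this
  set G : ℝ → ℝ := fun t => ∑ k : ι × Bool,
        (bif k.2 then 2 * η * c k.1 else 2 / η * c k.1) *
        (bif k.2 then partialDeriv i (f k.1) else f k.1)
          (WithLp.toLp 2 (Function.update z i t)) ^ 2 with hG
  have hGc : Continuous G := by
    refine continuous_finsetSum _ fun k _ => continuous_const.mul (Continuous.pow ?_ 2)
    cases k.2
    · exact hcont _ (hf k.1)
    · exact hcont _ (contDiff_partialDeriv (hf k.1) i)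
  have hG0 : ∀ t, 0 ≤ G t := fun t => Finset.sum_nonneg fun k _ => by
    refine mul_nonneg ?_ (sq_nonneg _)
    cases k.2
    · exact mul_nonneg (by positivity) (hc _)
    · exact mul_nonneg (by positivity) (hc _)
  have h2 : ∑ k, c k * f k (WithLp.toLp 2 z) ^ 2 ≤ ∫ t in a..(a + η), G t := by
    have e : ∀ t, G t = ∑ k, c k * (2 / η * f k (WithLp.toLp 2 (Function.update z i t)) ^ 2 +
      2 * η * partialDeriv i (f k) (WithLp.toLp 2 (Function.update z i t)) ^ 2) := by
      intro t
      simp only [hG, Fintype.sum_prod_type, Fintype.sum_bool, cond_true, cond_false]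
      refine Finset.sum_congr rfl fun k _ => ?_
      ring
    simp only [e]
    rw [intervalIntegral.integral_finsetSum]
    · refine Finset.sum_le_sum fun k _ => ?_
      rw [intervalIntegral.integral_const_mul]
      exact mul_le_mul_of_nonneg_left (h1 k) (hc k)
    · intro k _
      refine Continuous.intervalIntegrable ?_ _ _
      have := hcont _ (hf k)
      have := hcont _ (contDiff_partialDeriv (hf k) i)
      fun_prop
  refine (ENNReal.ofReal_le_ofReal h2).trans ?_
  rw [intervalIntegral.integral_of_le (by linarith), integral_Ioc_eq_integral_Ioo,
    ofReal_integral_eq_lintegral_ofReal]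
  · exact (hGc.integrableOn_Icc (a := a) (b := a + η)).mono_set Set.Ioo_subset_Icc_self
  · exact Eventually.of_forall hG0

/-- The open cube with lower corner `a` and side `η`. -/
def cube (a : Fin 3 → ℝ) (η : ℝ) : Set E3 := {x | ∀ i, x i ∈ Set.Ioo (a i) (a i + η)}

lemma cube_eq_preimage (a : Fin 3 → ℝ) (η : ℝ) :
    cube a η = WithLp.ofLp ⁻¹' (Set.pi Set.univ fun i => Set.Ioo (a i) (a i + η)) := by
  ext x; simp [cube]

lemma measurableSet_cube (a : Fin 3 → ℝ) (η : ℝ) : MeasurableSet (cube a η) := by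
  rw [cube_eq_preimage]
  exact (PiLp.volume_preserving_ofLp (Fin 3)).measurable
    (MeasurableSet.univ_pi fun i => measurableSet_Ioo)

lemma Q_eq_cube : Q = cube 0 1 := by
  ext x; simp [Q, cube]

lemma lintegral_cube (a : Fin 3 → ℝ) (η : ℝ) {G : E3 → ℝ≥0∞} (hG : Measurable G)
    (z : Fin 3 → ℝ) : ∫⁻ x in cube a η, G x =
    ∫⁻ t₀ in Set.Ioo (a 0) (a 0 + η), ∫⁻ t₁ in Set.Ioo (a 1) (a 1 + η),
      ∫⁻ t₂ in Set.Ioo (a 2) (a 2 + η), G (WithLp.toLp 2 (Function.update (Function.update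
        (Function.update z 0 t₀) 1 t₁) 2 t₂)) := by
  have hm := PiLp.volume_preserving_ofLp (Fin 3)
  have hGm : Measurable fun z : Fin 3 → ℝ => G (WithLp.toLp 2 z) :=
    hG.comp (PiLp.volume_preserving_toLp (Fin 3)).measurable
  have e1 : ∫⁻ x in cube a η, G x = ∫⁻ z in Set.pi Set.univ fun i => Set.Ioo (a i) (a i + η),
      G (WithLp.toLp 2 z) := by
    rw [cube_eq_preimage, ← hm.setLIntegral_comp_preimage
      (MeasurableSet.univ_pi fun i => measurableSet_Ioo) hGm]
  rw [e1, volume_pi, Measure.restrict_pi_pi, lintegral_eq_lmarginal_univ z]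
  have hu : (Finset.univ : Finset (Fin 3)) = insert 0 (insert 1 {2}) := by decide
  rw [hu, lmarginal_insert _ hGm (by decide)]
  refine lintegral_congr fun t₀ => ?_
  rw [lmarginal_insert _ hGm (by decide)]
  refine lintegral_congr fun t₁ => ?_
  rw [lmarginal_singleton]

/-- A Sobolev inequality with mixed derivatives on a cube of side `η`. -/
lemma sq_le_of_mixed_integrals {w : E3 → ℝ} (hw : ContDiff ℝ ∞ w) (α : Fin 3 → ℕ)
    {a : Fin 3 → ℝ} {η T : ℝ} (hη : 0 < η) (hT : 0 ≤ T)
    (h : ∀ β : Fin 3 → ℕ, (∀ i, β i ≤ 1) → ∫⁻ x in cube a η,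
      ENNReal.ofReal (η ^ (2 * ∑ i, β i) * multiDeriv (α + β) w x ^ 2) ≤
        ENNReal.ofReal (T * η ^ 3))
    {x : E3} (hx : ∀ i, x i ∈ Set.Icc (a i) (a i + η)) : multiDeriv α w x ^ 2 ≤ 64 * T := by
  set f₀ : Unit → E3 → ℝ := fun _ => multiDeriv α w with hf₀
  set f₁ : Unit × Bool → E3 → ℝ := fun k => bif k.2 then partialDeriv 0 (f₀ k.1) else f₀ k.1
    with hf₁
  set f₂ : (Unit × Bool) × Bool → E3 → ℝ :=
    fun k => bif k.2 then partialDeriv 1 (f₁ k.1) else f₁ k.1 with hf₂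
  set f₃ : ((Unit × Bool) × Bool) × Bool → E3 → ℝ :=
    fun k => bif k.2 then partialDeriv 2 (f₂ k.1) else f₂ k.1 with hf₃
  set c₀ : Unit → ℝ := fun _ => 1
  set c₁ : Unit × Bool → ℝ := fun k => bif k.2 then 2 * η * c₀ k.1 else 2 / η * c₀ k.1 with hc₁
  set c₂ : (Unit × Bool) × Bool → ℝ :=
    fun k => bif k.2 then 2 * η * c₁ k.1 else 2 / η * c₁ k.1 with hc₂
  set c₃ : ((Unit × Bool) × Bool) × Bool → ℝ :=
    fun k => bif k.2 then 2 * η * c₂ k.1 else 2 / η * c₂ k.1 with hc₃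
  have s₀ : ∀ k, ContDiff ℝ ∞ (f₀ k) := fun k => contDiff_multiDeriv hw α
  have s₁ : ∀ k, ContDiff ℝ ∞ (f₁ k) := by
    rintro ⟨k, _ | _⟩
    exacts [s₀ k, contDiff_partialDeriv (s₀ k) 0]
  have s₂ : ∀ k, ContDiff ℝ ∞ (f₂ k) := by
    rintro ⟨k, _ | _⟩
    exacts [s₁ k, contDiff_partialDeriv (s₁ k) 1]
  have s₃ : ∀ k, ContDiff ℝ ∞ (f₃ k) := by
    rintro ⟨k, _ | _⟩
    exacts [s₂ k, contDiff_partialDeriv (s₂ k) 2]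
  have p₁ : ∀ k, 0 ≤ c₁ k := by
    rintro ⟨k, _ | _⟩ <;> simp only [hc₁, cond_true, cond_false] <;> positivity
  have p₂ : ∀ k, 0 ≤ c₂ k := by
    rintro ⟨k, _ | _⟩ <;> simp only [hc₂, cond_true, cond_false] <;> have := p₁ k <;> positivity
  have p₃ : ∀ k, 0 ≤ c₃ k := by
    rintro ⟨k, _ | _⟩ <;> simp only [hc₃, cond_true, cond_false] <;> have := p₂ k <;> positivity
  set z : Fin 3 → ℝ := WithLp.ofLp x with hz
  have key : ENNReal.ofReal (∑ k, c₀ k * f₀ k (WithLp.toLp 2 z) ^ 2) ≤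
      ∫⁻ y in cube a η, ENNReal.ofReal (∑ k, c₃ k * f₃ k y ^ 2) := by
    rw [lintegral_cube a η _ z]
    · refine (ofReal_sum_sq_le f₀ s₀ c₀ (fun _ => zero_le_one) hη 0 z (hx 0)).trans ?_
      refine lintegral_mono fun t₀ => ?_
      refine (ofReal_sum_sq_le f₁ s₁ c₁ p₁ hη 1 _ (by simpa [hz] using hx 1)).trans ?_
      refine lintegral_mono fun t₁ => ?_
      exact ofReal_sum_sq_le f₂ s₂ c₂ p₂ hη 2 _ (by simpa [hz] using hx 2)
    · refine Measurable.ennreal_ofReal (Continuous.measurable ?_)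
      exact continuous_finsetSum _ fun k _ => continuous_const.mul ((s₃ k).continuous.pow 2)
  -- Each direction contributes 2/η or 2η to the coefficient, so the term of `β` carries 8/η³ times
  -- η^(2|β|), the scaling of the hypothesis. Eight terms of size at most 8T give 64T.
  have hterm : ∀ k, ∫⁻ y in cube a η, ENNReal.ofReal (c₃ k * f₃ k y ^ 2) ≤
      ENNReal.ofReal (8 * T) := by
    intro k
    obtain ⟨β, hβ, hfk, hck⟩ : ∃ β : Fin 3 → ℕ, (∀ i, β i ≤ 1) ∧ f₃ k = multiDeriv (α + β) w ∧
        c₃ k = 8 / η ^ 3 * η ^ (2 * ∑ i, β i) := by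
      have e0 : ∀ (b : Bool) (i : Fin 3) (γ : Fin 3 → ℕ),
          (bif b then partialDeriv i (multiDeriv γ w) else multiDeriv γ w) =
          multiDeriv (γ + Pi.single i (bif b then 1 else 0)) w := by
        intro b i γ
        cases b
        · simp
        · simpa using partialDeriv_multiDeriv hw i γ
      obtain ⟨⟨⟨k, b₀⟩, b₁⟩, b₂⟩ := k
      refine ⟨![bif b₀ then 1 else 0, bif b₁ then 1 else 0, bif b₂ then 1 else 0], ?_, ?_, ?_⟩
      · intro i
        fin_cases i
        · cases b₀ <;> simp
        · cases b₁ <;> simp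
        · cases b₂ <;> simp
      · simp only [hf₃, hf₂, hf₁, hf₀, e0]
        congr 1
        funext j
        fin_cases j <;> simp
      · simp only [hc₃, hc₂, hc₁, c₀, Fin.sum_univ_three]
        cases b₀ <;> cases b₁ <;> cases b₂ <;> simp <;> field_simp <;> norm_num
    have e : ∀ y, c₃ k * f₃ k y ^ 2 = 8 / η ^ 3 *
        (η ^ (2 * ∑ i, β i) * multiDeriv (α + β) w y ^ 2) := fun y => by
      rw [hfk, hck]; ring
    simp only [e]
    have h8 : 0 ≤ 8 / η ^ 3 := by positivity
    simp only [ENNReal.ofReal_mul h8]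
    rw [lintegral_const_mul' _ _ ENNReal.ofReal_ne_top]
    refine (mul_le_mul_right (h β hβ) _).trans (le_of_eq ?_)
    rw [← ENNReal.ofReal_mul h8]
    congr 1
    field_simp
  have hfin : ∫⁻ y in cube a η, ENNReal.ofReal (∑ k, c₃ k * f₃ k y ^ 2) ≤
      ENNReal.ofReal (64 * T) := by
    have e : ∀ y, ENNReal.ofReal (∑ k, c₃ k * f₃ k y ^ 2) =
        ∑ k, ENNReal.ofReal (c₃ k * f₃ k y ^ 2) := fun y =>
      ENNReal.ofReal_sum_of_nonneg fun k _ => mul_nonneg (p₃ k) (sq_nonneg _)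
    simp only [e]
    rw [lintegral_finsetSum]
    · refine (Finset.sum_le_card_nsmul _ _ _ fun k _ => hterm k).trans ?_
      simp only [Finset.card_univ, Fintype.card_prod, Fintype.card_unit, Fintype.card_bool]
      rw [nsmul_eq_mul, ← ENNReal.ofReal_natCast, ← ENNReal.ofReal_mul (by positivity)]
      refine ENNReal.ofReal_le_ofReal (le_of_eq ?_)
      push_cast
      ring
    · intro k _
      exact Measurable.ennreal_ofReal
        (continuous_const.mul ((s₃ k).continuous.pow 2)).measurable
  have := key.trans hfin
  rw [ENNReal.ofReal_le_ofReal_iff (by positivity)] at this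
  simpa [c₀, hf₀, hz] using this

end QTTApprox

namespace QTTApprox

/-! ### Pointwise bounds for the derivatives of smooth functions -/

/-- Weighted square integral bounds: `B s` for derivatives of order `s ≥ 2`, `M` for the gradient. -/
structure HasL2Bounds (w : E3 → ℝ) (B : ℕ → ℝ) (M : ℝ) : Prop where
  smooth : ContDiff ℝ ∞ w
  high : ∀ α : Fin 3 → ℕ, 2 ≤ ∑ i, α i → ∫⁻ x in Q,
    ENNReal.ofReal (‖x‖ ^ (2 * (∑ i, α i) - 3) * multiDeriv α w x ^ 2) ≤
      ENNReal.ofReal (B (∑ i, α i) ^ 2)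
  grad : ∀ i, ∫⁻ x in Q, ENNReal.ofReal (partialDeriv i w x ^ 2) ≤ ENNReal.ofReal (M ^ 2)

/-- Pointwise bounds for the derivatives in the closed cube, in terms of the coordinates. -/
structure HasPointwiseBounds (w : E3 → ℝ) (C A 𝔡 : ℝ) : Prop where
  smooth : ContDiff ℝ ∞ w
  high : ∀ α : Fin 3 → ℕ, 2 ≤ ∑ i, α i → ∀ x : E3, (∀ j, x j ∈ Set.Icc (0 : ℝ) 1) →
    ∀ i, 0 < x i → |multiDeriv α w x| ≤
      C * A ^ (∑ i, α i) * ((∑ i, α i).factorial : ℝ) ^ 𝔡 / x i ^ (∑ i, α i)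
  hess : ∀ m j, ∀ x : E3, (∀ j, x j ∈ Set.Icc (0 : ℝ) 1) → ∀ i, 0 < x i →
    |partialDeriv m (partialDeriv j w) x| ≤ C / x i ^ 2
  grad : ∀ j, ∀ x : E3, (∀ j, x j ∈ Set.Icc (0 : ℝ) 1) → ∀ i, 0 < x i →
    |partialDeriv j w x| ≤ C / x i

/-- The corner `x - η` is clamped at 0 in every coordinate, and η ≤ 1/2 keeps the cube inside `Q`.
In direction `i` the cube starts no lower than x_i - η ≥ η, which bounds the distance from the
origin. -/
lemma exists_cube_mem {x : E3} (hx : ∀ j, x j ∈ Set.Icc (0 : ℝ) 1) {i : Fin 3} {η : ℝ}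
    (hη : 0 < η) (hi : 2 * η ≤ x i) : ∃ a : Fin 3 → ℝ, (∀ j, x j ∈ Set.Icc (a j) (a j + η)) ∧
      cube a η ⊆ Q ∧ ∀ y ∈ cube a η, η ≤ ‖y‖ := by
  have hη1 : 2 * η ≤ 1 := hi.trans (hx i).2
  refine ⟨fun j => max 0 (x j - η), fun j => ⟨max_le (hx j).1 (by linarith), ?_⟩,
    fun y hy j => ?_, fun y hy => ?_⟩
  · have := le_max_right 0 (x j - η)
    linarith
  · have h := hy j
    refine ⟨(le_max_left _ _).trans_lt h.1, h.2.trans_le ?_⟩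
    change max 0 (x j - η) + η ≤ 1
    rcases le_total 0 (x j - η) with h' | h'
    · rw [max_eq_right h']; linarith [(hx j).2]
    · rw [max_eq_left h']; linarith
  · have h := (hy i).1
    have h1 := le_max_right 0 (x i - η)
    have h2 : y i ≤ ‖y‖ := (le_abs_self _).trans (PiLp.norm_apply_le y i)
    have h3 : max 0 (x i - η) < y i := h
    linarith

lemma HasL2Bounds.lintegral_cube_le {w : E3 → ℝ} {B : ℕ → ℝ} {M : ℝ} (h : HasL2Bounds w B M)
    {γ : Fin 3 → ℕ} (hγ : 2 ≤ ∑ i, γ i) {a : Fin 3 → ℝ} {η : ℝ} (hη : 0 < η)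
    (hQ : cube a η ⊆ Q) (ha : ∀ y ∈ cube a η, η ≤ ‖y‖) :
    ∫⁻ x in cube a η, ENNReal.ofReal (η ^ (2 * (∑ i, γ i) - 3) * multiDeriv γ w x ^ 2) ≤
      ENNReal.ofReal (B (∑ i, γ i) ^ 2) := by
  refine le_trans ?_ ((lintegral_mono_set hQ).trans (h.high γ hγ))
  refine setLIntegral_mono' (measurableSet_cube _ _) fun x hx => ?_
  refine ENNReal.ofReal_le_ofReal ?_
  gcongr
  exact ha x hx

/-- On a cube of side η = x_i/2 the weight is at least a power of η, and all powers of η combine to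
η^-s. The mixed Sobolev inequality uses up to three additional derivatives, whence `Bm`. -/
lemma HasL2Bounds.high_pointwise {w : E3 → ℝ} {B : ℕ → ℝ} {M : ℝ} (h : HasL2Bounds w B M)
    {α : Fin 3 → ℕ} (hα : 2 ≤ ∑ i, α i) {Bm : ℝ} (hBm : 0 ≤ Bm)
    (hB : ∀ b ≤ 3, |B (∑ i, α i + b)| ≤ Bm) {x : E3} (hx : ∀ j, x j ∈ Set.Icc (0 : ℝ) 1)
    {i : Fin 3} (hi : 0 < x i) :
    |multiDeriv α w x| ≤ 8 * Bm * 2 ^ (∑ i, α i) / x i ^ (∑ i, α i) := by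
  set s := ∑ i, α i with hs
  set η := x i / 2 with hη
  have hη0 : 0 < η := by positivity
  obtain ⟨a, hxa, hQ, ha⟩ := exists_cube_mem hx (i := i) hη0 (by rw [hη]; linarith)
  have key := sq_le_of_mixed_integrals h.smooth α (a := a) (η := η) (T := Bm ^ 2 / η ^ (2 * s))
    hη0 (by positivity) (fun β hβ => ?_) hxa
  · have e : 64 * (Bm ^ 2 / η ^ (2 * s)) = (8 * Bm * 2 ^ s / x i ^ s) ^ 2 := by
      rw [hη, div_pow, div_pow, mul_pow, mul_pow, ← pow_mul, ← pow_mul, mul_comm s 2]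
      field_simp
      ring
    rw [e] at key
    exact abs_le_of_sq_le_sq key (by positivity)
  · set b := ∑ i, β i with hb
    have hb3 : b ≤ 3 := by
      rw [hb, Fin.sum_univ_three]
      have := hβ 0; have := hβ 1; have := hβ 2
      omega
    have hsum : ∑ i, (α + β) i = s + b := by simp [Finset.sum_add_distrib, hs, hb]
    have h1 := h.lintegral_cube_le (γ := α + β) (by rw [hsum]; omega) hη0 hQ ha
    rw [hsum] at h1
    -- The exponents balance, 2b + 2s = 3 + (2(s + b) - 3), and the truncated subtraction is exact
    -- because s ≥ 2.
    have e : ∀ y, η ^ (2 * b) * multiDeriv (α + β) w y ^ 2 = η ^ 3 / η ^ (2 * s) *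
        (η ^ (2 * (s + b) - 3) * multiDeriv (α + β) w y ^ 2) := by
      intro y
      have : η ^ (2 * b) * η ^ (2 * s) = η ^ 3 * η ^ (2 * (s + b) - 3) := by
        rw [← pow_add, ← pow_add]
        congr 1
        omega
      field_simp
      linear_combination (multiDeriv (α + β) w y ^ 2) * this
    simp only [e]
    have h8 : 0 ≤ η ^ 3 / η ^ (2 * s) := by positivity
    simp only [ENNReal.ofReal_mul h8]
    rw [lintegral_const_mul' _ _ ENNReal.ofReal_ne_top]
    refine (mul_le_mul_right h1 _).trans ?_
    rw [← ENNReal.ofReal_mul h8]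
    refine ENNReal.ofReal_le_ofReal ?_
    have : B (s + b) ^ 2 ≤ Bm ^ 2 := by
      rw [← sq_abs]
      exact pow_le_pow_left₀ (abs_nonneg _) (hB b hb3) 2
    calc η ^ 3 / η ^ (2 * s) * B (s + b) ^ 2 ≤ η ^ 3 / η ^ (2 * s) * Bm ^ 2 := by gcongr
      _ = _ := by ring

/-- The same argument with η = 1/4, but the term without additional derivatives has order one, where
only the unweighted bound `M` is available. The 64 in `T` is η^-3. -/
lemma HasL2Bounds.grad_outer {w : E3 → ℝ} {B : ℕ → ℝ} {M : ℝ} (h : HasL2Bounds w B M)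
    {Bm : ℝ} (hM : 0 ≤ M) (hBm : 0 ≤ Bm) (hB : ∀ b, 1 ≤ b → b ≤ 3 → |B (1 + b)| ≤ Bm) (j : Fin 3)
    {x : E3} (hx : ∀ j, x j ∈ Set.Icc (0 : ℝ) 1) {i : Fin 3} (hi : 1 / 2 ≤ x i) :
    |partialDeriv j w x| ≤ 64 * (M + Bm) := by
  obtain ⟨a, hxa, hQ, ha⟩ := exists_cube_mem hx (i := i) (η := 1 / 4) (by norm_num) (by linarith)
  have hsj : ∑ i, (Pi.single j 1 : Fin 3 → ℕ) i = 1 := by simp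
  have key := sq_le_of_mixed_integrals h.smooth (Pi.single j 1) (a := a) (η := 1 / 4)
    (T := 64 * (M ^ 2 + Bm ^ 2)) (by norm_num) (by positivity) (fun β hβ => ?_) hxa
  · rw [multiDeriv_single] at key
    refine abs_le_of_sq_le_sq (key.trans ?_) (by positivity)
    nlinarith
  · set b := ∑ i, β i with hb
    have hb3 : b ≤ 3 := by
      rw [hb, Fin.sum_univ_three]
      have := hβ 0; have := hβ 1; have := hβ 2
      omega
    have hsum : ∑ i, ((Pi.single j 1 : Fin 3 → ℕ) + β) i = 1 + b := by
      simp [Finset.sum_add_distrib, hb]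
    rcases Nat.eq_zero_or_pos b with h0 | h0
    · have hβ0 : β = 0 := by
        funext i
        have := (Finset.sum_eq_zero_iff.1 h0) i (Finset.mem_univ i)
        simpa using this
      rw [h0, hβ0, add_zero, multiDeriv_single]
      simp only [mul_zero, pow_zero, one_mul]
      refine (lintegral_mono_set hQ).trans ((h.grad j).trans (ENNReal.ofReal_le_ofReal ?_))
      nlinarith
    · have h1 := h.lintegral_cube_le (γ := Pi.single j 1 + β) (by rw [hsum]; omega)
        (by norm_num) hQ ha
      rw [hsum] at h1
      have e : ∀ y, (1 / 4 : ℝ) ^ (2 * b) * multiDeriv (Pi.single j 1 + β) w y ^ 2 = 1 / 4 *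
          ((1 / 4) ^ (2 * (1 + b) - 3) * multiDeriv (Pi.single j 1 + β) w y ^ 2) := by
        intro y
        rw [← mul_assoc, ← pow_succ']
        congr 2
        omega
      simp only [e]
      have h8 : (0 : ℝ) ≤ 1 / 4 := by positivity
      simp only [ENNReal.ofReal_mul h8]
      rw [lintegral_const_mul' _ _ ENNReal.ofReal_ne_top]
      refine (mul_le_mul_right h1 _).trans ?_
      rw [← ENNReal.ofReal_mul h8]
      refine ENNReal.ofReal_le_ofReal ?_
      have : B (1 + b) ^ 2 ≤ Bm ^ 2 := by
        rw [← sq_abs]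
        exact pow_le_pow_left₀ (abs_nonneg _) (hB b h0 hb3) 2
      nlinarith

lemma abs_sub_le_of_partialDeriv {f : E3 → ℝ} (hf : ContDiff ℝ ∞ f) (x : E3) (i : Fin 3)
    {τ C : ℝ} (hτ : 0 ≤ τ)
    (h : ∀ t ∈ Set.Icc (0 : ℝ) τ, |partialDeriv i f (x + t • unitVec i)| ≤ C) :
    |f (x + τ • unitVec i) - f x| ≤ C * τ := by
  have := Convex.norm_image_sub_le_of_norm_hasDerivWithin_le (s := Set.Icc (0 : ℝ) τ)
    (f := fun t : ℝ => f (x + t • unitVec i))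
    (fun t _ => (hasDerivAt_line hf x i t).hasDerivWithinAt) h (convex_Icc 0 τ)
    (Set.left_mem_Icc.2 hτ) (Set.right_mem_Icc.2 hτ)
  simpa [abs_of_nonneg hτ] using this

lemma add_smul_unitVec_apply_self (x : E3) (i : Fin 3) (t : ℝ) :
    (x + t • unitVec i) i = x i + t := by
  simp

lemma add_smul_unitVec_apply_of_ne (x : E3) {i j : Fin 3} (h : j ≠ i) (t : ℝ) :
    (x + t • unitVec i) j = x j := by
  simp [h]

lemma add_smul_unitVec_mem {x : E3} (hx : ∀ j, x j ∈ Set.Icc (0 : ℝ) 1) {i : Fin 3} {t : ℝ}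
    (h0 : 0 ≤ x i + t) (h1 : x i + t ≤ 1) (j : Fin 3) :
    (x + t • unitVec i) j ∈ Set.Icc (0 : ℝ) 1 := by
  by_cases h : j = i
  · subst h
    rw [add_smul_unitVec_apply_self]
    exact ⟨h0, h1⟩
  · rw [add_smul_unitVec_apply_of_ne x h]
    exact hx j

/-- The gradient bound is carried inwards from the region x_i ≥ 1/2 by doubling x_i: integrating the
Hessian bound from x_i to 2 x_i costs C₂/x_i, while the bound at the doubled point is half the
target. The constant C₀ + 2 C₂ is reproduced by this step. -/
lemma grad_of_hess {w : E3 → ℝ} (hw : ContDiff ℝ ∞ w) {C₂ C₀ : ℝ} (hC₂ : 0 ≤ C₂) (hC₀ : 0 ≤ C₀)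
    (j : Fin 3)
    (hess : ∀ m, ∀ x : E3, (∀ j, x j ∈ Set.Icc (0 : ℝ) 1) → ∀ i, 0 < x i →
      |partialDeriv m (partialDeriv j w) x| ≤ C₂ / x i ^ 2)
    (outer : ∀ x : E3, (∀ j, x j ∈ Set.Icc (0 : ℝ) 1) → ∀ i, 1 / 2 ≤ x i →
      |partialDeriv j w x| ≤ C₀) (i : Fin 3) (x : E3) (hx : ∀ j, x j ∈ Set.Icc (0 : ℝ) 1)
    (hi : 0 < x i) : |partialDeriv j w x| ≤ (C₀ + 2 * C₂) / x i := by
  have key : ∀ n : ℕ, ∀ x : E3, (∀ j, x j ∈ Set.Icc (0 : ℝ) 1) → (1 / 2) ^ (n + 1) ≤ x i →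
      |partialDeriv j w x| ≤ (C₀ + 2 * C₂) / x i := by
    intro n
    induction n with
    | zero =>
      intro x hx hi
      refine (outer x hx i (by simpa using hi)).trans ?_
      have h0 : 0 < x i := lt_of_lt_of_le (by norm_num) hi
      rw [le_div_iff₀ h0]
      nlinarith [(hx i).2]
    | succ n ih =>
      intro x hx hi
      have h0 : 0 < x i := lt_of_lt_of_le (by positivity) hi
      rcases le_or_gt (1 / 2) (x i) with h | h
      · refine (outer x hx i h).trans ?_
        rw [le_div_iff₀ h0]
        nlinarith [(hx i).2]
      have hy := ih (x + x i • unitVec i) (add_smul_unitVec_mem hx (by linarith) (by linarith))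
        (by
          rw [add_smul_unitVec_apply_self]
          rw [pow_succ] at hi
          linarith)
      rw [add_smul_unitVec_apply_self] at hy
      have hd := abs_sub_le_of_partialDeriv (contDiff_partialDeriv hw j) x i (τ := x i)
        (C := C₂ / x i ^ 2) h0.le (fun t ht => by
          refine (hess i _ (add_smul_unitVec_mem hx (by linarith [ht.1])
            (by linarith [ht.2])) i (by rw [add_smul_unitVec_apply_self]; linarith [ht.1])).trans ?_
          rw [add_smul_unitVec_apply_self]
          gcongr
          linarith [ht.1])
      have e1 : C₂ / x i ^ 2 * x i = C₂ / x i := by field_simp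
      have e2 : (C₀ + 2 * C₂) / (x i + x i) = (C₀ / x i) / 2 + C₂ / x i := by field_simp; ring
      have e3 : (C₀ + 2 * C₂) / x i = C₀ / x i + 2 * (C₂ / x i) := by field_simp
      have e4 : 0 ≤ C₀ / x i := by positivity
      rw [e1] at hd
      rw [e2] at hy
      rw [e3]
      have := abs_sub_abs_le_abs_sub (partialDeriv j w x) (partialDeriv j w (x + x i • unitVec i))
      rw [abs_sub_comm] at this
      linarith
  obtain ⟨n, hn⟩ := exists_pow_lt_of_lt_one hi (show (1 / 2 : ℝ) < 1 by norm_num)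
  refine key n x hx (le_trans ?_ hn.le)
  exact pow_le_pow_of_le_one (by norm_num) (by norm_num) (Nat.le_succ n)

/-- The three derivatives lost in the Sobolev inequality cost only a geometric factor, which is
absorbed into the constants C and A of the Gevrey bound. -/
lemma factorial_add_three_le (s : ℕ) : ((s + 3).factorial : ℝ) ≤ 64 * 8 ^ s * s.factorial := by
  have h1 : s + 3 ≤ 4 * 2 ^ s := by
    induction s with
    | zero => simp
    | succ n ih =>
      rw [pow_succ]
      have : 0 < 2 ^ n := by positivity
      omega
  have h2 : ((s : ℝ) + 3) ≤ 4 * 2 ^ s := by exact_mod_cast h1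
  have h3 : ((s + 3).factorial : ℝ) = (s + 3) * (s + 2) * (s + 1) * s.factorial := by
    simp only [Nat.factorial_succ]
    push_cast
    ring
  have h4 : (8 : ℝ) ^ s = 2 ^ s * 2 ^ s * 2 ^ s := by rw [← mul_pow, ← mul_pow]; norm_num
  rw [h3, h4]
  have h5 : (0 : ℝ) ≤ s := by positivity
  calc ((s : ℝ) + 3) * (s + 2) * (s + 1) * s.factorial
      ≤ (4 * 2 ^ s) * (4 * 2 ^ s) * (4 * 2 ^ s) * s.factorial := by
        gcongr <;> linarith
    _ = _ := by ring

/-- Weighted square integral bounds of Gevrey type imply pointwise bounds of Gevrey type. -/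
theorem exists_pointwiseBounds {C A 𝔡 M : ℝ} (hC : 0 < C) (hA : 1 ≤ A) (h𝔡 : 1 ≤ 𝔡)
    (hM : 0 ≤ M) : ∃ C₁ A₁ : ℝ, 0 < C₁ ∧ 1 ≤ A₁ ∧ ∀ w : E3 → ℝ,
      HasL2Bounds w (fun s => C * A ^ s * (s.factorial : ℝ) ^ 𝔡) M →
      HasPointwiseBounds w C₁ A₁ 𝔡 := by
  set B : ℕ → ℝ := fun s => C * A ^ s * (s.factorial : ℝ) ^ 𝔡 with hB
  have hA0 : 0 < A := by linarith
  have hBpos : ∀ s, 0 ≤ B s := fun s => by positivity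
  have hBmono : ∀ s b, b ≤ 3 → |B (s + b)| ≤ B (s + 3) := by
    intro s b hb
    rw [abs_of_nonneg (hBpos _)]
    simp only [hB]
    gcongr
  -- The 2 comes from the cubes of side x_i/2 and 8^𝔡 from the three lost derivatives.
  set A₁ := 2 * A * (8 : ℝ) ^ 𝔡 with hA₁
  have h8 : (1 : ℝ) ≤ 8 ^ 𝔡 := Real.one_le_rpow (by norm_num) (by linarith)
  have hA₁1 : 1 ≤ A₁ := by rw [hA₁]; nlinarith
  set Ch := 8 * C * A ^ 3 * (64 : ℝ) ^ 𝔡 with hCh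
  have hCh0 : 0 < Ch := by positivity
  have hB3 : ∀ s, 8 * B (s + 3) * 2 ^ s ≤ Ch * A₁ ^ s * (s.factorial : ℝ) ^ 𝔡 := by
    intro s
    have h1 : ((s + 3).factorial : ℝ) ^ 𝔡 ≤ 64 ^ 𝔡 * (8 ^ 𝔡) ^ s * (s.factorial : ℝ) ^ 𝔡 := by
      refine (Real.rpow_le_rpow (by positivity) (factorial_add_three_le s) (by linarith)).trans ?_
      rw [Real.mul_rpow (by positivity) (by positivity), Real.mul_rpow (by positivity)
        (by positivity), Real.rpow_pow_comm (by norm_num)]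
    calc 8 * B (s + 3) * 2 ^ s = 8 * C * A ^ 3 * (A ^ s * 2 ^ s) * ((s + 3).factorial : ℝ) ^ 𝔡 := by
          simp only [hB]; ring
      _ ≤ 8 * C * A ^ 3 * (A ^ s * 2 ^ s) * (64 ^ 𝔡 * (8 ^ 𝔡) ^ s * (s.factorial : ℝ) ^ 𝔡) := by
          gcongr
      _ = _ := by simp only [hCh, hA₁, mul_pow]; ring
  set C₂ := Ch * A₁ ^ 2 * ((2 : ℕ).factorial : ℝ) ^ 𝔡 with hC₂
  set C₀ := 64 * (M + B 4) with hC₀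
  have hC₂0 : 0 ≤ C₂ := by positivity
  have hC₀0 : 0 ≤ C₀ := by have := hBpos 4; positivity
  refine ⟨Ch + C₂ + (C₀ + 2 * C₂), A₁, by positivity, hA₁1, fun w hw => ?_⟩
  have high : ∀ α : Fin 3 → ℕ, 2 ≤ ∑ i, α i → ∀ x : E3, (∀ j, x j ∈ Set.Icc (0 : ℝ) 1) →
      ∀ i, 0 < x i → |multiDeriv α w x| ≤
      Ch * A₁ ^ (∑ i, α i) * ((∑ i, α i).factorial : ℝ) ^ 𝔡 / x i ^ (∑ i, α i) := by
    intro α hα x hx i hi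
    refine (hw.high_pointwise hα (hBpos _) (hBmono _) hx hi).trans ?_
    exact div_le_div_of_nonneg_right (hB3 _) (pow_pos hi _).le
  have hess : ∀ m j, ∀ x : E3, (∀ j, x j ∈ Set.Icc (0 : ℝ) 1) → ∀ i, 0 < x i →
      |partialDeriv m (partialDeriv j w) x| ≤ C₂ / x i ^ 2 := by
    intro m j x hx i hi
    have hs : ∑ i, ((Pi.single j 1 : Fin 3 → ℕ) + (Pi.single m 1 : Fin 3 → ℕ)) i = 2 := by
      simp [Finset.sum_add_distrib]
    have := high (Pi.single j 1 + Pi.single m 1) hs.ge x hx i hi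
    rwa [hs, ← partialDeriv_multiDeriv hw.smooth, multiDeriv_single] at this
  refine ⟨hw.smooth, fun α hα x hx i hi => ?_, fun m j x hx i hi => ?_, fun j x hx i hi => ?_⟩
  · refine (high α hα x hx i hi).trans ?_
    gcongr
    linarith
  · refine (hess m j x hx i hi).trans ?_
    gcongr
    linarith
  · refine (grad_of_hess hw.smooth hC₂0 hC₀0 j (fun m => hess m j) (fun x hx i hi => ?_)
      i x hx hi).trans ?_
    · exact hw.grad_outer hM (hBpos 4) (fun b _ hb => hBmono 1 b hb) j hx hi
    · refine div_le_div_of_nonneg_right ?_ hi.le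
      linarith

end QTTApprox

namespace QTTApprox

/-! ### Taylor polynomials -/

/-- The directional derivative `v · ∇`. -/
noncomputable def dirDeriv (v : Fin 3 → ℝ) (f : E3 → ℝ) : E3 → ℝ :=
  fun x => ∑ i, v i * partialDeriv i f x

lemma contDiff_dirDeriv {f : E3 → ℝ} (hf : ContDiff ℝ ∞ f) (v : Fin 3 → ℝ) :
    ContDiff ℝ ∞ (dirDeriv v f) :=
  ContDiff.sum fun i _ => contDiff_const.mul (contDiff_partialDeriv hf i)

lemma contDiff_iterate_dirDeriv {f : E3 → ℝ} (hf : ContDiff ℝ ∞ f) (v : Fin 3 → ℝ) (n : ℕ) :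
    ContDiff ℝ ∞ ((dirDeriv v)^[n] f) := by
  induction n with
  | zero => simpa
  | succ n ih =>
    rw [Function.iterate_succ_apply']
    exact contDiff_dirDeriv ih v

lemma hasDerivAt_dirDeriv {f : E3 → ℝ} (hf : ContDiff ℝ ∞ f) (x : E3) (v : Fin 3 → ℝ) (t : ℝ) :
    HasDerivAt (fun t : ℝ => f (x + t • WithLp.toLp 2 v))
      (dirDeriv v f (x + t • WithLp.toLp 2 v)) t := by
  have h1 : HasDerivAt (fun t : ℝ => x + t • (WithLp.toLp 2 v : E3)) (WithLp.toLp 2 v) t := by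
    simpa using ((hasDerivAt_id t).smul_const (WithLp.toLp 2 v : E3)).const_add x
  have h2 := ((hf.differentiable (by simp)) (x + t • WithLp.toLp 2 v)).hasFDerivAt.comp_hasDerivAt
    t h1
  refine h2.congr_deriv ?_
  have : (WithLp.toLp 2 v : E3) = ∑ i, v i • unitVec i := by
    ext j
    fin_cases j <;> simp [Fin.sum_univ_three]
  have e : ∀ L : E3 →L[ℝ] ℝ, L (WithLp.toLp 2 v) = ∑ i, v i * L (unitVec i) := fun L => by
    rw [this, map_sum]
    simp
  exact e _

/-- Multinomial expansion of iterated directional derivatives. -/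
lemma exists_dirDeriv_expansion {w : E3 → ℝ} (hw : ContDiff ℝ ∞ w) (n : ℕ) :
    ∃ (ι : Type) (_ : Fintype ι) (a : ι → Fin 3 → ℕ), Fintype.card ι = 3 ^ n ∧
      (∀ k, ∑ i, a k i = n) ∧ ∀ v x, (dirDeriv v)^[n] w x =
        ∑ k, (∏ i, v i ^ a k i) * multiDeriv (a k) w x := by
  induction n with
  | zero =>
    refine ⟨Unit, inferInstance, fun _ => 0, by simp, by simp, fun v x => ?_⟩
    simp [multiDeriv_zero]
  | succ n ih =>
    obtain ⟨ι, _, a, hcard, hsum, h⟩ := ih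
    -- Terms are indexed by words in the three directions, so repetitions take the place of
    -- multinomial coefficients and the number of terms is 3^n.
    refine ⟨ι × Fin 3, inferInstance, fun k => a k.1 + Pi.single k.2 1, ?_, ?_, fun v x => ?_⟩
    · simp [hcard, pow_succ]
    · intro k
      simp [Finset.sum_add_distrib, hsum]
    · rw [Function.iterate_succ_apply']
      have hfun : (dirDeriv v)^[n] w = fun x => ∑ k, (∏ i, v i ^ a k i) * multiDeriv (a k) w x :=
        funext fun x => h v x
      rw [hfun, dirDeriv]
      have hp : ∀ i, partialDeriv i (fun x => ∑ k, (∏ i, v i ^ a k i) * multiDeriv (a k) w x) x =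
          ∑ k, (∏ i, v i ^ a k i) * multiDeriv (a k + Pi.single i 1) w x := by
        intro i
        have hd : ∀ k, DifferentiableAt ℝ (multiDeriv (a k) w) x := fun k =>
          (contDiff_multiDeriv hw (a k)).differentiable (by simp) x
        unfold partialDeriv
        rw [fderiv_fun_sum (fun k _ => (hd k).const_mul _)]
        simp only [sum_apply]
        refine Finset.sum_congr rfl fun k _ => ?_
        rw [fderiv_const_mul (hd k), ← partialDeriv_multiDeriv hw]
        simp [partialDeriv]
      simp only [hp, Finset.mul_sum]
      rw [Fintype.sum_prod_type, Finset.sum_comm]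
      refine Finset.sum_congr rfl fun k _ => Finset.sum_congr rfl fun i _ => ?_
      rw [← mul_assoc]
      congr 1
      have : ∀ j, v j ^ ((a k + Pi.single i 1 : Fin 3 → ℕ) j) =
          v j ^ a k j * (if j = i then v j else 1) := by
        intro j
        by_cases hj : j = i
        · subst hj; simp [pow_succ]
        · simp [hj]
      simp only [this, Finset.prod_mul_distrib, Finset.prod_ite_eq', Finset.mem_univ, if_true]
      ring

/-- The Taylor polynomial of degree less than `s` at `x`. -/
noncomputable def taylorPoly (w : E3 → ℝ) (s : ℕ) (x : E3) (v : Fin 3 → ℝ) : ℝ :=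
  ∑ n ∈ Finset.range s, ((n.factorial : ℝ)⁻¹) * (dirDeriv v)^[n] w x

lemma taylorPoly_zero_vec (w : E3 → ℝ) {s : ℕ} (hs : 0 < s) (x : E3) :
    taylorPoly w s x 0 = w x := by
  unfold taylorPoly
  rw [Finset.sum_eq_single_of_mem 0 (Finset.mem_range.2 hs)]
  · simp
  · intro n _ hn
    obtain ⟨m, rfl⟩ := Nat.exists_eq_succ_of_ne_zero hn
    rw [Nat.succ_eq_add_one, Function.iterate_succ_apply']
    simp [dirDeriv]

/-- Total degree below `s` keeps every single exponent below `s`. The scaling by `h` turns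
coordinates into integer node offsets, as `IsBlockPoly` requires. -/
lemma exists_taylorPoly_coeff {w : E3 → ℝ} (hw : ContDiff ℝ ∞ w) (s : ℕ) (x : E3) (h : ℝ) :
    ∃ c : Fin s → Fin s → Fin s → ℝ, ∀ m₁ m₂ m₃ : ℝ,
      taylorPoly w s x ![h * m₁, h * m₂, h * m₃] =
        ∑ a, ∑ b, ∑ e, c a b e * (m₁ ^ (a : ℕ) * m₂ ^ (b : ℕ) * m₃ ^ (e : ℕ)) := by
  set mono : Fin s × Fin s × Fin s → (ℝ × ℝ × ℝ → ℝ) := fun p m =>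
    m.1 ^ (p.1 : ℕ) * m.2.1 ^ (p.2.1 : ℕ) * m.2.2 ^ (p.2.2 : ℕ) with hmono
  have hmem : (fun m : ℝ × ℝ × ℝ => taylorPoly w s x ![h * m.1, h * m.2.1, h * m.2.2]) ∈
      Submodule.span ℝ (Set.range mono) := by
    have e : (fun m : ℝ × ℝ × ℝ => taylorPoly w s x ![h * m.1, h * m.2.1, h * m.2.2]) =
        ∑ n ∈ Finset.range s, ((n.factorial : ℝ)⁻¹) • fun m : ℝ × ℝ × ℝ =>
          (dirDeriv ![h * m.1, h * m.2.1, h * m.2.2])^[n] w x := by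
      funext m
      simp [taylorPoly]
    rw [e]
    refine Submodule.sum_mem _ fun n hn => Submodule.smul_mem _ _ ?_
    rw [Finset.mem_range] at hn
    obtain ⟨ι, _, a, -, hsum, hexp⟩ := exists_dirDeriv_expansion hw n
    have e2 : (fun m : ℝ × ℝ × ℝ => (dirDeriv ![h * m.1, h * m.2.1, h * m.2.2])^[n] w x) =
        ∑ k, (h ^ n * multiDeriv (a k) w x) • fun m : ℝ × ℝ × ℝ =>
          m.1 ^ a k 0 * m.2.1 ^ a k 1 * m.2.2 ^ a k 2 := by
      funext m
      simp only [hexp, Finset.sum_apply, Pi.smul_apply, smul_eq_mul, Fin.prod_univ_three]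
      refine Finset.sum_congr rfl fun k _ => ?_
      have := hsum k
      rw [Fin.sum_univ_three] at this
      rw [← this]
      simp only [Matrix.cons_val_zero, Matrix.cons_val_one, Matrix.cons_val]
      ring
    rw [e2]
    refine Submodule.sum_mem _ fun k _ => Submodule.smul_mem _ _ (Submodule.subset_span ?_)
    have := hsum k
    rw [Fin.sum_univ_three] at this
    exact ⟨(⟨a k 0, by omega⟩, ⟨a k 1, by omega⟩, ⟨a k 2, by omega⟩), rfl⟩
  obtain ⟨c, hc⟩ := (Submodule.mem_span_range_iff_exists_fun ℝ).1 hmem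
  refine ⟨fun a b e => c (a, b, e), fun m₁ m₂ m₃ => ?_⟩
  have := congrFun hc (m₁, m₂, m₃)
  simp only [Finset.sum_apply, Pi.smul_apply, smul_eq_mul, hmono, Fintype.sum_prod_type] at this
  exact this.symm

/-- Lagrange's remainder on the segment, with the `s`-th directional derivative expanded into 3^s
terms. The condition `0 ≤ v i` keeps the `i`-th coordinate above `ρ` along the segment. -/
lemma taylorPoly_error {w : E3 → ℝ} {C A 𝔡 : ℝ} (hw : HasPointwiseBounds w C A 𝔡)
    (hC : 0 ≤ C) (hA : 0 ≤ A) {s : ℕ} (hs : 2 ≤ s) {x : E3} {v : Fin 3 → ℝ} {V ρ : ℝ} {i : Fin 3}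
    (hx : ∀ t ∈ Set.Icc (0 : ℝ) 1, ∀ j, x j + t * v j ∈ Set.Icc (0 : ℝ) 1)
    (hρ : 0 < ρ) (hi : ρ ≤ x i) (hvi : 0 ≤ v i) (hV : ∀ j, |v j| ≤ V) :
    |w (x + WithLp.toLp 2 v) - taylorPoly w s x v| ≤
      (3 * V) ^ s / s.factorial * (C * A ^ s * (s.factorial : ℝ) ^ 𝔡 / ρ ^ s) := by
  have hV0 : 0 ≤ V := (abs_nonneg _).trans (hV 0)
  set g : ℝ → ℝ := fun t => w (x + t • WithLp.toLp 2 v) with hg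
  have hgs : ContDiff ℝ ∞ g := by
    have : ContDiff ℝ ∞ fun t : ℝ => x + t • (WithLp.toLp 2 v : E3) := by fun_prop
    exact hw.smooth.comp this
  have hiter : ∀ n t, iteratedDeriv n g t = (dirDeriv v)^[n] w (x + t • WithLp.toLp 2 v) := by
    intro n
    induction n with
    | zero => intro t; simp [hg]
    | succ n ih =>
      intro t
      rw [iteratedDeriv_succ, Function.iterate_succ_apply', funext ih]
      exact (hasDerivAt_dirDeriv (contDiff_iterate_dirDeriv hw.smooth v n) x v t).deriv
  have hwithin : ∀ n, ∀ t ∈ Set.Icc (0 : ℝ) 1, iteratedDerivWithin n g (Set.Icc 0 1) t =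
      (dirDeriv v)^[n] w (x + t • WithLp.toLp 2 v) := by
    intro n t ht
    rw [iteratedDerivWithin_eq_iteratedDeriv (uniqueDiffOn_Icc zero_lt_one)
      ((hgs.of_le (by exact_mod_cast le_top)).contDiffAt) ht, hiter]
  have hbound : ∀ t ∈ Set.Icc (0 : ℝ) 1, |(dirDeriv v)^[s] w (x + t • WithLp.toLp 2 v)| ≤
      (3 * V) ^ s * (C * A ^ s * (s.factorial : ℝ) ^ 𝔡 / ρ ^ s) := by
    intro t ht
    obtain ⟨ι, _, a, hcard, hsum, hexp⟩ := exists_dirDeriv_expansion hw.smooth s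
    rw [hexp]
    refine (Finset.abs_sum_le_sum_abs _ _).trans ?_
    have hterm : ∀ k ∈ (Finset.univ : Finset ι),
        |(∏ i, v i ^ a k i) * multiDeriv (a k) w (x + t • WithLp.toLp 2 v)| ≤
        V ^ s * (C * A ^ s * (s.factorial : ℝ) ^ 𝔡 / ρ ^ s) := by
      intro k _
      rw [abs_mul]
      refine mul_le_mul ?_ ?_ (abs_nonneg _) (by positivity)
      · rw [Finset.abs_prod, ← hsum k, ← Finset.prod_pow_eq_pow_sum]
        refine Finset.prod_le_prod (fun _ _ => abs_nonneg _) fun j _ => ?_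
        rw [abs_pow]
        exact pow_le_pow_left₀ (abs_nonneg _) (hV j) _
      · have hcoord : ∀ j, (x + t • WithLp.toLp 2 v : E3) j = x j + t * v j := fun j => by simp
        have hxi : ρ ≤ (x + t • WithLp.toLp 2 v : E3) i := by
          rw [hcoord]
          nlinarith [mul_nonneg ht.1 hvi]
        have := hw.high (a k) (by rw [hsum k]; exact hs) (x + t • WithLp.toLp 2 v)
          (fun j => by rw [hcoord]; exact hx t ht j) i (hρ.trans_le hxi)
        rw [hsum k] at this
        refine this.trans ?_
        gcongr
    refine (Finset.sum_le_card_nsmul _ _ _ hterm).trans (le_of_eq ?_)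
    rw [Finset.card_univ, hcard, nsmul_eq_mul]
    push_cast
    ring
  obtain ⟨n, rfl⟩ : ∃ n, s = n + 1 := ⟨s - 1, by omega⟩
  have hu : Set.uIcc (0 : ℝ) 1 = Set.Icc 0 1 := Set.uIcc_of_le zero_le_one
  have hu' : Set.uIoo (0 : ℝ) 1 = Set.Ioo 0 1 := Set.uIoo_of_le zero_le_one
  obtain ⟨ξ, hξ, hξe⟩ := taylor_mean_remainder_lagrange (f := g) (x := 1) (x₀ := 0) (n := n)
    zero_ne_one ((hgs.of_le (by exact_mod_cast le_top)).contDiffOn) (by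
      rw [hu, hu']
      have h1 : ContDiffOn ℝ ((n + 1 : ℕ) : WithTop ℕ∞) g (Set.Icc 0 1) :=
        (hgs.of_le (by exact_mod_cast le_top)).contDiffOn
      exact (h1.differentiableOn_iteratedDerivWithin (by exact_mod_cast n.lt_succ_self)
        (uniqueDiffOn_Icc zero_lt_one)).mono Set.Ioo_subset_Icc_self)
  rw [hu] at hξe
  rw [hu'] at hξ
  have hT : taylorWithinEval g n (Set.Icc 0 1) 0 1 = taylorPoly w (n + 1) x v := by
    rw [taylor_within_apply, taylorPoly]
    refine Finset.sum_congr rfl fun k _ => ?_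
    rw [hwithin k 0 (by simp)]
    simp
  rw [hT, hwithin _ _ (Set.Ioo_subset_Icc_self hξ)] at hξe
  have hg1 : g 1 = w (x + WithLp.toLp 2 v) := by simp [hg]
  rw [hg1] at hξe
  rw [hξe]
  simp only [sub_zero, one_pow, mul_one]
  rw [abs_div, abs_of_pos (show (0 : ℝ) < ((n + 1).factorial : ℝ) by positivity)]
  rw [div_mul_eq_mul_div]
  gcongr
  exact hbound ξ (Set.Ioo_subset_Icc_self hξ)

end QTTApprox

namespace QTTApprox

/-! ### The array of blockwise Taylor polynomials -/

lemma node_apply (ℓ i j k : ℕ) (m : Fin 3) :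
    node ℓ i j k m = ((![i, j, k] m : ℕ) : ℝ) / 2 ^ ℓ := by
  fin_cases m <;> simp [node]

/-- On each block, the values at the nodes of the Taylor polynomial of `w` at the lower corner of
the block; the origin, where `w` may be singular, gets the value of a neighbouring node. -/
noncomputable def blockTaylor (w : E3 → ℝ) (ℓ K s i j k : ℕ) : ℝ :=
  if max i (max j k) = 0 then w (node ℓ 1 0 0) else
    taylorPoly w s (node ℓ (2 ^ (level i j k - K) * (i / 2 ^ (level i j k - K)))
      (2 ^ (level i j k - K) * (j / 2 ^ (level i j k - K)))
      (2 ^ (level i j k - K) * (k / 2 ^ (level i j k - K))))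
      ![(2 ^ ℓ)⁻¹ * (i % 2 ^ (level i j k - K) : ℕ), (2 ^ ℓ)⁻¹ * (j % 2 ^ (level i j k - K) : ℕ),
        (2 ^ ℓ)⁻¹ * (k % 2 ^ (level i j k - K) : ℕ)]

lemma exists_two_pow_level_le {i j k : ℕ} (h : max i (max j k) ≠ 0) :
    ∃ m : Fin 3, 2 ^ level i j k ≤ ![i, j, k] m := by
  have h1 : 2 ^ level i j k ≤ max i (max j k) := Nat.pow_log_le_self 2 h
  rcases le_max_iff.1 h1 with h | h
  · exact ⟨0, h⟩
  rcases le_max_iff.1 h with h | h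
  · exact ⟨1, h⟩
  · exact ⟨2, h⟩

lemma isBlockPoly_blockTaylor {w : E3 → ℝ} (hw : ContDiff ℝ ∞ w) (ℓ K : ℕ) {s : ℕ}
    (hs : 0 < s) : IsBlockPoly K s (blockTaylor w ℓ K s) := by
  choose cf hcf using exists_taylorPoly_coeff hw s
  -- Only the origin lies in a block numbered (0,0,0): any other triple has an index of at least
  -- 2^M, no less than the block length. Its polynomial is constant, realised as a Taylor polynomial
  -- with step 0.
  refine ⟨fun M a b e => if a = 0 ∧ b = 0 ∧ e = 0 then cf (node ℓ 1 0 0) 0 else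
    cf (node ℓ (2 ^ (M - K) * a) (2 ^ (M - K) * b) (2 ^ (M - K) * e)) (2 ^ ℓ)⁻¹, ?_⟩
  rintro i j k M W rfl rfl
  by_cases h0 : max i (max j k) = 0
  · obtain ⟨rfl, rfl, rfl⟩ : i = 0 ∧ j = 0 ∧ k = 0 := by simpa [Nat.max_eq_zero_iff] using h0
    have := hcf (node ℓ 1 0 0) 0 0 0 0
    have hv : (![0 * 0, 0 * 0, 0 * 0] : Fin 3 → ℝ) = 0 := by
      funext m; fin_cases m <;> simp
    rw [hv, taylorPoly_zero_vec w hs] at this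
    simp only [blockTaylor, max_self, if_true, Nat.zero_div, and_self, Nat.zero_mod,
      Nat.cast_zero]
    exact this
  · have hne : ¬ (i / 2 ^ (level i j k - K) = 0 ∧ j / 2 ^ (level i j k - K) = 0 ∧
        k / 2 ^ (level i j k - K) = 0) := by
      rintro ⟨h1, h2, h3⟩
      obtain ⟨m, hm⟩ := exists_two_pow_level_le h0
      have hpow : 2 ^ (level i j k - K) ≤ 2 ^ level i j k :=
        Nat.pow_le_pow_right two_pos (Nat.sub_le _ _)
      have hpos : 0 < 2 ^ (level i j k - K) := by positivity
      rw [Nat.div_eq_zero_iff_lt hpos] at h1 h2 h3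
      fin_cases m
      · exact absurd hm (by simp only [Fin.zero_eta, Matrix.cons_val_zero]; omega)
      · exact absurd hm (by simp only [Fin.mk_one, Matrix.cons_val_one, Matrix.cons_val_zero]; omega)
      · exact absurd hm (by simp only [Fin.reduceFinMk, Matrix.cons_val]; omega)
    simp only [blockTaylor, h0, if_false, hne]
    exact hcf _ _ _ _ _

/-- The ratio of the block side to the lower bound 2^M/2^ℓ for a coordinate of the corner is 2^-K,
and the bounds for the derivatives are scale invariant. Below level `K` a block is a single node and
the error vanishes. -/
lemma blockTaylor_error {w : E3 → ℝ} {C A 𝔡 : ℝ} (hw : HasPointwiseBounds w C A 𝔡)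
    (hC : 0 ≤ C) (hA : 0 ≤ A) {ℓ K s : ℕ} (hs : 2 ≤ s) {i j k : ℕ} (hi : i < 2 ^ ℓ)
    (hj : j < 2 ^ ℓ) (hk : k < 2 ^ ℓ) (h0 : max i (max j k) ≠ 0) :
    |blockTaylor w ℓ K s i j k - w (node ℓ i j k)| ≤
      C * (3 * A / 2 ^ K) ^ s * ((s.factorial : ℝ) ^ 𝔡 / s.factorial) := by
  set M := level i j k with hM
  set W := 2 ^ (M - K) with hW
  have hWpos : 0 < W := by positivity
  set n : Fin 3 → ℕ := ![i, j, k] with hn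
  have hnl : ∀ m, n m < 2 ^ ℓ := by
    intro m; fin_cases m
    exacts [hi, hj, hk]
  have hp : (0 : ℝ) < 2 ^ ℓ := by positivity
  set x := node ℓ (W * (i / W)) (W * (j / W)) (W * (k / W)) with hx
  set v : Fin 3 → ℝ := ![(2 ^ ℓ)⁻¹ * (i % W : ℕ), (2 ^ ℓ)⁻¹ * (j % W : ℕ),
        (2 ^ ℓ)⁻¹ * (k % W : ℕ)] with hv
  have hxm : ∀ m, x m = ((W * (n m / W) : ℕ) : ℝ) / 2 ^ ℓ := by
    intro m
    rw [hx, node_apply]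
    fin_cases m <;> rfl
  have hvm : ∀ m, v m = ((n m % W : ℕ) : ℝ) / 2 ^ ℓ := by
    intro m
    rw [div_eq_inv_mul]
    fin_cases m <;> rfl
  have hxv : ∀ m, x m + v m = (n m : ℝ) / 2 ^ ℓ := by
    intro m
    rw [hxm, hvm, ← add_div, ← Nat.cast_add, Nat.div_add_mod]
  have hnode : x + WithLp.toLp 2 v = node ℓ i j k := by
    ext m
    rw [node_apply]
    simpa using hxv m
  have hbt : blockTaylor w ℓ K s i j k = taylorPoly w s x v := by
    simp only [blockTaylor, h0, if_false]
    rfl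
  rw [hbt, ← hnode, abs_sub_comm]
  rcases lt_or_ge M K with hMK | hMK
  · have hW1 : W = 1 := by rw [hW, Nat.sub_eq_zero_of_le hMK.le, pow_zero]
    have hv0 : v = 0 := by
      funext m
      rw [hvm, hW1]
      simp [Nat.mod_one]
    rw [hv0, taylorPoly_zero_vec w (by omega)]
    simp only [WithLp.toLp_zero, add_zero, sub_self, abs_zero]
    positivity
  · obtain ⟨m, hm⟩ := exists_two_pow_level_le h0
    have hWM : W * 2 ^ K = 2 ^ M := by rw [hW, ← pow_add]; congr 1; omega
    -- 2^M is a multiple of the block length, so rounding an index of at least 2^M down to the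
    -- corner does not bring it below 2^M.
    have hdiv : 2 ^ M ≤ W * (n m / W) := by
      rw [← hWM]
      refine Nat.mul_le_mul_left _ ?_
      rw [Nat.le_div_iff_mul_le hWpos, mul_comm, hWM]
      exact hm
    have hv0 : ∀ m, 0 ≤ v m := fun m => by rw [hvm]; positivity
    have hx0 : ∀ m, 0 ≤ x m := fun m => by rw [hxm]; positivity
    have hρ : (0 : ℝ) < 2 ^ M / 2 ^ ℓ := by positivity
    refine (taylorPoly_error hw hC hA hs (V := W / 2 ^ ℓ) (ρ := 2 ^ M / 2 ^ ℓ) (i := m)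
      (fun t ht q => ⟨add_nonneg (hx0 q) (mul_nonneg ht.1 (hv0 q)), ?_⟩) hρ ?_ (hv0 m)
      (fun q => ?_)).trans (le_of_eq ?_)
    · have h1 : x q + t * v q ≤ x q + v q := by nlinarith [hv0 q, ht.2]
      refine h1.trans ?_
      rw [hxv, div_le_one hp]
      exact_mod_cast (hnl q).le
    · rw [hxm]
      gcongr
      exact_mod_cast hdiv
    · rw [abs_of_nonneg (hv0 q), hvm]
      gcongr
      exact (Nat.mod_lt _ hWpos).le
    · have hWr : (W : ℝ) * 2 ^ K = 2 ^ M := by exact_mod_cast hWM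
      rw [← hWr]
      have hWr0 : (0 : ℝ) < W := by exact_mod_cast hWpos
      simp only [mul_pow, div_pow]
      field_simp

end QTTApprox

namespace QTTApprox

/-! ### Interpolation on a mesh cell -/

lemma abs_convexComb_sub_le {a p q D E : ℝ} (ha : a ∈ Set.Icc (0 : ℝ) 1) (hp : |p - D| ≤ E)
    (hq : |q - D| ≤ E) : |(1 - a) * p + a * q - D| ≤ E := by
  have h1 : (1 - a) * p + a * q - D = (1 - a) * (p - D) + a * (q - D) := by ring
  have h2 : 0 ≤ 1 - a := by linarith [ha.2]
  rw [h1]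
  calc _ ≤ (1 - a) * |p - D| + a * |q - D| := by
        refine (abs_add_le _ _).trans (le_of_eq ?_)
        rw [abs_mul, abs_mul, abs_of_nonneg h2, abs_of_nonneg ha.1]
    _ ≤ (1 - a) * E + a * E := by gcongr; exact ha.1
    _ = E := by ring

/-- The trilinear interpolant on the cell with lower vertex `n`, at local coordinates `θ`. -/
noncomputable def cellInterp (V : (Fin 3 → ℕ) → ℝ) (n : Fin 3 → ℕ) (θ : Fin 3 → ℝ) : ℝ :=
  trilin (fun i j k => V ![i, j, k]) (n 0) (n 1) (n 2) (θ 0) (θ 1) (θ 2)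

/-- `p` is a vertex of the cell with lower vertex `n`. -/
def IsVertex (n p : Fin 3 → ℕ) : Prop := ∀ j, p j = n j ∨ p j = n j + 1

/-- The trilinear interpolant is an iterated convex combination of the vertex values. -/
lemma abs_cellInterp_sub_le {V : (Fin 3 → ℕ) → ℝ} {n : Fin 3 → ℕ} {θ : Fin 3 → ℝ}
    (hθ : ∀ j, θ j ∈ Set.Icc (0 : ℝ) 1) {D E : ℝ} (h : ∀ p, IsVertex n p → |V p - D| ≤ E) :
    |cellInterp V n θ - D| ≤ E := by
  unfold cellInterp trilin
  refine abs_convexComb_sub_le (hθ 0)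
    (abs_convexComb_sub_le (hθ 1)
      (abs_convexComb_sub_le (hθ 2) (h _ ?_) (h _ ?_))
      (abs_convexComb_sub_le (hθ 2) (h _ ?_) (h _ ?_)))
    (abs_convexComb_sub_le (hθ 1)
      (abs_convexComb_sub_le (hθ 2) (h _ ?_) (h _ ?_))
      (abs_convexComb_sub_le (hθ 2) (h _ ?_) (h _ ?_))) <;>
  · intro j
    fin_cases j <;> simp

lemma cellInterp_eq_affine (V : (Fin 3 → ℕ) → ℝ) (n : Fin 3 → ℕ) (θ : Fin 3 → ℝ) (i : Fin 3)
    (t : ℝ) : cellInterp V n (Function.update θ i t) = cellInterp V n (Function.update θ i 0) +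
      t * (cellInterp V n (Function.update θ i 1) - cellInterp V n (Function.update θ i 0)) := by
  unfold cellInterp trilin
  fin_cases i <;> simp <;> ring

/-- The slope in direction `i` is a convex combination of the differences along the four edges
parallel to `i`. -/
lemma abs_cellInterp_diff_le {V : (Fin 3 → ℕ) → ℝ} {n : Fin 3 → ℕ} {θ : Fin 3 → ℝ}
    (hθ : ∀ j, θ j ∈ Set.Icc (0 : ℝ) 1) (i : Fin 3) {H D E : ℝ}
    (h : ∀ p, IsVertex n p → p i = n i → |H * (V (p + Pi.single i 1) - V p) - D| ≤ E) :
    |H * (cellInterp V n (Function.update θ i 1) - cellInterp V n (Function.update θ i 0)) - D|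
      ≤ E := by
  have conv : ∀ {b c p₁ p₂ p₃ p₄ : ℝ}, b ∈ Set.Icc (0 : ℝ) 1 → c ∈ Set.Icc (0 : ℝ) 1 →
      |p₁ - D| ≤ E → |p₂ - D| ≤ E → |p₃ - D| ≤ E → |p₄ - D| ≤ E →
      |(1 - b) * ((1 - c) * p₁ + c * p₂) + b * ((1 - c) * p₃ + c * p₄) - D| ≤ E :=
    fun hb hc h1 h2 h3 h4 => abs_convexComb_sub_le hb (abs_convexComb_sub_le hc h1 h2)
      (abs_convexComb_sub_le hc h3 h4)
  have e0 : ∀ a b c : ℕ, ![a, b, c] + Pi.single 0 1 = ![a + 1, b, c] := by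
    intro a b c; funext j; fin_cases j <;> simp
  have e1 : ∀ a b c : ℕ, ![a, b, c] + Pi.single 1 1 = ![a, b + 1, c] := by
    intro a b c; funext j; fin_cases j <;> simp
  have e2 : ∀ a b c : ℕ, ![a, b, c] + Pi.single 2 1 = ![a, b, c + 1] := by
    intro a b c; funext j; fin_cases j <;> simp
  have hver : ∀ a b c : ℕ, a ≤ 1 → b ≤ 1 → c ≤ 1 → IsVertex n ![n 0 + a, n 1 + b, n 2 + c] := by
    intro a b c ha hb hc j
    fin_cases j <;> simp <;> omega
  fin_cases i
  · have k1 := h _ (hver 0 0 0 (by simp) (by simp) (by simp)) (by simp)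
    have k2 := h _ (hver 0 0 1 (by simp) (by simp) (by simp)) (by simp)
    have k3 := h _ (hver 0 1 0 (by simp) (by simp) (by simp)) (by simp)
    have k4 := h _ (hver 0 1 1 (by simp) (by simp) (by simp)) (by simp)
    have := conv (hθ 1) (hθ 2) k1 k2 k3 k4
    refine le_of_eq_of_le ?_ this
    congr 2
    simp only [cellInterp, trilin, Fin.zero_eta, e0, add_zero]
    simp
    ring
  · have k1 := h _ (hver 0 0 0 (by simp) (by simp) (by simp)) (by simp)
    have k2 := h _ (hver 0 0 1 (by simp) (by simp) (by simp)) (by simp)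
    have k3 := h _ (hver 1 0 0 (by simp) (by simp) (by simp)) (by simp)
    have k4 := h _ (hver 1 0 1 (by simp) (by simp) (by simp)) (by simp)
    have := conv (hθ 0) (hθ 2) k1 k2 k3 k4
    refine le_of_eq_of_le ?_ this
    congr 2
    simp only [cellInterp, trilin, Fin.mk_one, e1, add_zero]
    simp
    ring
  · have k1 := h _ (hver 0 0 0 (by simp) (by simp) (by simp)) (by simp)
    have k2 := h _ (hver 0 1 0 (by simp) (by simp) (by simp)) (by simp)
    have k3 := h _ (hver 1 0 0 (by simp) (by simp) (by simp)) (by simp)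
    have k4 := h _ (hver 1 1 0 (by simp) (by simp) (by simp)) (by simp)
    have := conv (hθ 0) (hθ 1) k1 k2 k3 k4
    refine le_of_eq_of_le ?_ this
    congr 2
    simp only [cellInterp, trilin, Fin.reduceFinMk, e2, add_zero]
    simp
    ring

/-- The coefficients of `feFun ℓ A` as a function of the multi-index of the node. -/
noncomputable def nodeVal (ℓ : ℕ) (A : ℕ → ℕ → ℕ → ℝ) (p : Fin 3 → ℕ) : ℝ :=
  extendZero ℓ A (p 0) (p 1) (p 2)

lemma feFun_eq_cellInterp {ℓ : ℕ} (A : ℕ → ℕ → ℕ → ℝ) {n : Fin 3 → ℕ} (hn : ∀ j, n j < 2 ^ ℓ)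
    {x : E3} {θ : Fin 3 → ℝ} (hθ : ∀ j, θ j ∈ Set.Icc (0 : ℝ) 1)
    (hx : ∀ j, 2 ^ ℓ * x j = n j + θ j) : feFun ℓ A x = cellInterp (nodeVal ℓ A) n θ := by
  rw [feFun_eq_trilin A (hn 0) (hn 1) (hn 2) (hθ 0) (hθ 1) (hθ 2) (hx 0) (hx 1) (hx 2)]
  rfl

lemma lineDeriv_feFun {ℓ : ℕ} (A : ℕ → ℕ → ℕ → ℝ) {n : Fin 3 → ℕ} (hn : ∀ j, n j < 2 ^ ℓ)
    {x : E3} {θ : Fin 3 → ℝ} (hθ : ∀ j, θ j ∈ Set.Ioo (0 : ℝ) 1)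
    (hx : ∀ j, 2 ^ ℓ * x j = n j + θ j) (i : Fin 3) : lineDeriv ℝ (feFun ℓ A) x (unitVec i) =
      2 ^ ℓ * (cellInterp (nodeVal ℓ A) n (Function.update θ i 1) -
        cellInterp (nodeVal ℓ A) n (Function.update θ i 0)) := by
  set V := nodeVal ℓ A
  set T0 := cellInterp V n (Function.update θ i 0)
  set T1 := cellInterp V n (Function.update θ i 1)
  have hd : HasDerivAt (fun t : ℝ => T0 + (θ i + 2 ^ ℓ * t) * (T1 - T0))
      (2 ^ ℓ * (T1 - T0)) 0 := by
    have := ((((hasDerivAt_id (0 : ℝ)).const_mul ((2 : ℝ) ^ ℓ)).const_add (θ i)).mul_const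
      (T1 - T0)).const_add T0
    simpa using this
  have hev : (fun t : ℝ => feFun ℓ A (x + t • unitVec i)) =ᶠ[𝓝 0]
      fun t : ℝ => T0 + (θ i + 2 ^ ℓ * t) * (T1 - T0) := by
    have hc : ContinuousAt (fun t : ℝ => θ i + 2 ^ ℓ * t) 0 := by fun_prop
    have hm : ∀ᶠ t in 𝓝 (0 : ℝ), θ i + 2 ^ ℓ * t ∈ Set.Ioo (0 : ℝ) 1 :=
      hc.eventually_mem (isOpen_Ioo.mem_nhds (by simpa using hθ i))
    filter_upwards [hm] with t ht
    rw [← cellInterp_eq_affine, feFun_eq_cellInterp A hn (θ := Function.update θ i _)]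
    · intro j
      by_cases h : j = i
      · subst h
        simpa using Set.Ioo_subset_Icc_self ht
      · simpa [h] using Set.Ioo_subset_Icc_self (hθ j)
    · intro j
      by_cases h : j = i
      · subst h
        rw [add_smul_unitVec_apply_self, Function.update_self, mul_add, hx]
        ring
      · rw [add_smul_unitVec_apply_of_ne x h, Function.update_of_ne h, hx]
  exact (hd.congr_of_eventuallyEq hev).deriv

/-! ### Differences of a function with bounded derivatives -/

lemma abs_sub_le_of_segment {f : E3 → ℝ} (hf : ContDiff ℝ ∞ f) {y z : E3} {B τ : ℝ}
    (hyz : ∀ j, |y j - z j| ≤ τ)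
    (h : ∀ j, ∀ t ∈ Set.Icc (0 : ℝ) 1, |partialDeriv j f (z + t • (y - z))| ≤ B) :
    |f y - f z| ≤ 3 * B * τ := by
  have hv : (WithLp.toLp 2 (fun j => y j - z j) : E3) = y - z := by
    ext j; simp
  have := Convex.norm_image_sub_le_of_norm_hasDerivWithin_le (s := Set.Icc (0 : ℝ) 1)
    (f := fun t : ℝ => f (z + t • (y - z))) (C := 3 * B * τ)
    (f' := fun t => dirDeriv (fun j => y j - z j) f (z + t • (y - z)))
    (fun t _ => by
      have := hasDerivAt_dirDeriv hf z (fun j => y j - z j) t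
      rw [hv] at this
      exact this.hasDerivWithinAt) (fun t ht => ?_) (convex_Icc 0 1)
    (Set.left_mem_Icc.2 zero_le_one) (Set.right_mem_Icc.2 zero_le_one)
  · simpa using this
  · rw [dirDeriv, Real.norm_eq_abs]
    refine (Finset.abs_sum_le_sum_abs _ _).trans ?_
    have hle : ∀ j, |(y j - z j) * partialDeriv j f (z + t • (y - z))| ≤ τ * B := fun j => by
      rw [abs_mul]
      exact mul_le_mul (hyz j) (h j t ht) (abs_nonneg _) ((abs_nonneg _).trans (hyz j))
    refine (Finset.sum_le_sum fun j _ => hle j).trans (le_of_eq ?_)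
    simp
    ring

lemma segment_coord {y z : E3} (t : ℝ) (j : Fin 3) :
    (z + t • (y - z)) j = (1 - t) * z j + t * y j := by
  simp
  ring

lemma segment_mem_Icc {y z : E3} {a b : ℝ} {t : ℝ} (ht : t ∈ Set.Icc (0 : ℝ) 1) {j : Fin 3}
    (hy : y j ∈ Set.Icc a b) (hz : z j ∈ Set.Icc a b) : (z + t • (y - z)) j ∈ Set.Icc a b := by
  rw [segment_coord]
  have h1 : 0 ≤ 1 - t := by linarith [ht.2]
  constructor
  · nlinarith [mul_nonneg h1 (sub_nonneg.2 hz.1), mul_nonneg ht.1 (sub_nonneg.2 hy.1)]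
  · nlinarith [mul_nonneg h1 (sub_nonneg.2 hz.2), mul_nonneg ht.1 (sub_nonneg.2 hy.2)]

/-- The mean value inequality for the function itself. -/
lemma HasPointwiseBounds.abs_sub_le {w : E3 → ℝ} {C A 𝔡 : ℝ} (hw : HasPointwiseBounds w C A 𝔡)
    (hC : 0 ≤ C) {y z : E3} (hy : ∀ j, y j ∈ Set.Icc (0 : ℝ) 1) (hz : ∀ j, z j ∈ Set.Icc (0 : ℝ) 1)
    {i : Fin 3} {ρ τ : ℝ} (hρ : 0 < ρ) (hyi : ρ ≤ y i) (hzi : ρ ≤ z i)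
    (hyz : ∀ j, |y j - z j| ≤ τ) : |w y - w z| ≤ 3 * (C / ρ) * τ := by
  refine abs_sub_le_of_segment hw.smooth hyz fun j t ht => ?_
  have h1 := segment_mem_Icc ht (j := i) (a := ρ) (b := 1) ⟨hyi, (hy i).2⟩ ⟨hzi, (hz i).2⟩
  refine (hw.grad j _ (fun j => segment_mem_Icc ht (hy j) (hz j)) i (hρ.trans_le h1.1)).trans ?_
  exact div_le_div_of_nonneg_left hC hρ h1.1

/-- The mean value inequality for the gradient. -/
lemma HasPointwiseBounds.abs_partialDeriv_sub_le {w : E3 → ℝ} {C A 𝔡 : ℝ}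
    (hw : HasPointwiseBounds w C A 𝔡)
    (hC : 0 ≤ C) {y z : E3} (hy : ∀ j, y j ∈ Set.Icc (0 : ℝ) 1) (hz : ∀ j, z j ∈ Set.Icc (0 : ℝ) 1)
    {i : Fin 3} {ρ τ : ℝ} (hρ : 0 < ρ) (hyi : ρ ≤ y i) (hzi : ρ ≤ z i)
    (hyz : ∀ j, |y j - z j| ≤ τ) (k : Fin 3) :
    |partialDeriv k w y - partialDeriv k w z| ≤ 3 * (C / ρ ^ 2) * τ := by
  refine abs_sub_le_of_segment (contDiff_partialDeriv hw.smooth k) hyz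
    fun j t ht => ?_
  have h1 := segment_mem_Icc ht (j := i) (a := ρ) (b := 1) ⟨hyi, (hy i).2⟩ ⟨hzi, (hz i).2⟩
  refine (hw.hess j k _ (fun j => segment_mem_Icc ht (hy j) (hz j)) i (hρ.trans_le h1.1)).trans ?_
  exact div_le_div_of_nonneg_left hC (by positivity) (by have := h1.1; gcongr)

/-- The mean value inequality for `f` minus a linear function of slope `D`. -/
lemma abs_diffQuot_sub_le {f : E3 → ℝ} (hf : ContDiff ℝ ∞ f) (y : E3) (i : Fin 3) {D B H : ℝ}
    (hH : 0 < H) (h : ∀ t ∈ Set.Icc (0 : ℝ) H⁻¹, |partialDeriv i f (y + t • unitVec i) - D| ≤ B) :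
    |H * (f (y + H⁻¹ • unitVec i) - f y) - D| ≤ B := by
  have := Convex.norm_image_sub_le_of_norm_hasDerivWithin_le (s := Set.Icc (0 : ℝ) H⁻¹)
    (f := fun t : ℝ => f (y + t • unitVec i) - t * D)
    (f' := fun t => partialDeriv i f (y + t • unitVec i) - D)
    (fun t _ => by
      have := (hasDerivAt_line hf y i t).sub (hasDerivAt_mul_const (x := t) D)
      exact this.hasDerivWithinAt) (fun t ht => h t ht) (convex_Icc 0 H⁻¹)
    (Set.left_mem_Icc.2 (by positivity)) (Set.right_mem_Icc.2 (by positivity))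
  have hi : (0 : ℝ) < H⁻¹ := by positivity
  simp only [zero_smul, add_zero, zero_mul, sub_zero, Real.norm_eq_abs, abs_of_pos hi] at this
  have e : H * (f (y + H⁻¹ • unitVec i) - f y) - D =
      H * (f (y + H⁻¹ • unitVec i) - H⁻¹ * D - f y) := by
    linear_combination D * (mul_inv_cancel₀ hH.ne')
  rw [e, abs_mul, abs_of_pos hH]
  calc _ ≤ H * (B * H⁻¹) := by gcongr
    _ = B := by field_simp

/-! ### The interpolation error away from the faces of the cells -/

/-- The node with multi-index `p`. -/
noncomputable def pt (ℓ : ℕ) (p : Fin 3 → ℕ) : E3 := node ℓ (p 0) (p 1) (p 2)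

lemma pt_apply (ℓ : ℕ) (p : Fin 3 → ℕ) (j : Fin 3) : pt ℓ p j = (p j : ℝ) / 2 ^ ℓ := by
  rw [pt, node_apply]
  fin_cases j <;> rfl

lemma pt_add_single (ℓ : ℕ) (p : Fin 3 → ℕ) (i : Fin 3) :
    pt ℓ (p + Pi.single i 1) = pt ℓ p + ((2 : ℝ) ^ ℓ)⁻¹ • unitVec i := by
  ext j
  by_cases h : j = i
  · subst h
    rw [add_smul_unitVec_apply_self, pt_apply, pt_apply]
    simp
    ring
  · rw [add_smul_unitVec_apply_of_ne _ h, pt_apply, pt_apply]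
    simp [h]

/-- The values `A` are within `δ` of those of `w` at all nodes of the closed cube but the origin,
where the value of `w` at a neighbouring node is taken. -/
structure IsNodalApprox (w : E3 → ℝ) (ℓ : ℕ) (A : ℕ → ℕ → ℕ → ℝ) (δ : ℝ) : Prop where
  zero : nodeVal ℓ A 0 = w (pt ℓ (Pi.single 0 1))
  approx : ∀ p : Fin 3 → ℕ, p ≠ 0 → (∀ j, p j ≤ 2 ^ ℓ) → |nodeVal ℓ A p - w (pt ℓ p)| ≤ δ

section Cell

variable {w : E3 → ℝ} {C A 𝔡 : ℝ} {ℓ : ℕ} {V : ℕ → ℕ → ℕ → ℝ} {δ : ℝ} {n : Fin 3 → ℕ} {x : E3}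
  {θ : Fin 3 → ℝ}

lemma IsVertex.pt_mem {p : Fin 3 → ℕ} (hn : ∀ j, n j < 2 ^ ℓ) (hp : IsVertex n p) (j : Fin 3) :
    pt ℓ p j ∈ Set.Icc ((n j : ℝ) / 2 ^ ℓ) ((n j + 1) / 2 ^ ℓ) ∧
      pt ℓ p j ∈ Set.Icc (0 : ℝ) 1 ∧ p j ≤ 2 ^ ℓ := by
  have h1 : n j ≤ p j ∧ p j ≤ n j + 1 := by rcases hp j with h | h <;> omega
  have h2 : p j ≤ 2 ^ ℓ := by have := hn j; omega
  have a1 : (n j : ℝ) ≤ p j := by exact_mod_cast h1.1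
  have a2 : (p j : ℝ) ≤ n j + 1 := by exact_mod_cast h1.2
  have a3 : (p j : ℝ) ≤ 2 ^ ℓ := by exact_mod_cast h2
  rw [pt_apply]
  refine ⟨⟨by gcongr, by gcongr⟩, ⟨by positivity, ?_⟩, h2⟩
  rw [div_le_one (by positivity)]
  exact a3

lemma cell_mem (hn : ∀ j, n j < 2 ^ ℓ) (hθ : ∀ j, θ j ∈ Set.Ioo (0 : ℝ) 1)
    (hx : ∀ j, 2 ^ ℓ * x j = n j + θ j) (j : Fin 3) :
    x j ∈ Set.Icc ((n j : ℝ) / 2 ^ ℓ) ((n j + 1) / 2 ^ ℓ) ∧ x j ∈ Set.Ioo (0 : ℝ) 1 := by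
  have hp : (0 : ℝ) < 2 ^ ℓ := by positivity
  have h1 : x j = (n j + θ j) / 2 ^ ℓ := by rw [← hx j]; field_simp
  have h2 : ((n j + 1 : ℕ) : ℝ) ≤ 2 ^ ℓ := by exact_mod_cast hn j
  push_cast at h2
  have := hθ j
  rw [h1]
  refine ⟨⟨by gcongr; linarith [this.1], by gcongr; exact this.2.le⟩, ?_, ?_⟩
  · have := this.1
    positivity
  · rw [div_lt_one hp]
    linarith [this.2]

lemma abs_sub_le_of_mem_Icc_cell {a b q H : ℝ} (ha : a ∈ Set.Icc (q / H) ((q + 1) / H))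
    (hb : b ∈ Set.Icc (q / H) ((q + 1) / H)) : |a - b| ≤ H⁻¹ := by
  have : (q + 1) / H = q / H + H⁻¹ := by ring
  rw [this] at ha hb
  rw [abs_le]
  constructor <;> linarith [ha.1, ha.2, hb.1, hb.2]

/-- The error on a cell that does not touch the origin. -/
lemma IsNodalApprox.outer (hw : HasPointwiseBounds w C A 𝔡) (hC : 0 ≤ C)
    (hV : IsNodalApprox w ℓ V δ) (hn : ∀ j, n j < 2 ^ ℓ) (hθ : ∀ j, θ j ∈ Set.Ioo (0 : ℝ) 1)
    (hx : ∀ j, 2 ^ ℓ * x j = n j + θ j) {m : Fin 3} (hm : 1 ≤ n m) :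
    |feFun ℓ V x - w x| ≤ 6 * C * (2 ^ ℓ)⁻¹ / x m + δ ∧
    ∀ i, |lineDeriv ℝ (feFun ℓ V) x (unitVec i) - partialDeriv i w x| ≤
      12 * C * (2 ^ ℓ)⁻¹ / x m ^ 2 + 2 * 2 ^ ℓ * δ := by
  have hp : (0 : ℝ) < 2 ^ ℓ := by positivity
  have hθ' : ∀ j, θ j ∈ Set.Icc (0 : ℝ) 1 := fun j => Set.Ioo_subset_Icc_self (hθ j)
  have hxc := cell_mem hn hθ hx
  have hx01 : ∀ j, x j ∈ Set.Icc (0 : ℝ) 1 := fun j => Set.Ioo_subset_Icc_self (hxc j).2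
  have hm1 : (1 : ℝ) ≤ n m := by exact_mod_cast hm
  -- Because `n m ≥ 1`, the whole cell has `m`-th coordinate comparable to that of `x`: ρ ≤ x m ≤
  -- 2ρ.
  set ρ : ℝ := n m / 2 ^ ℓ with hρ
  have hρ0 : 0 < ρ := by positivity
  have hρx : x m ≤ 2 * ρ := by
    refine (hxc m).1.2.trans ?_
    rw [hρ, ← mul_div_assoc]
    gcongr
    linarith
  have hxm : 0 < x m := (hxc m).2.1
  have hρi : ρ⁻¹ ≤ 2 / x m := by
    rw [inv_le_iff_one_le_mul₀ hρ0]
    rw [div_mul_eq_mul_div, le_div_iff₀ hxm]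
    linarith
  have hne : ∀ p, IsVertex n p → p ≠ 0 := by
    intro p hp h
    have := hp m
    rw [h] at this
    simp only [Pi.zero_apply] at this
    omega
  constructor
  · rw [feFun_eq_cellInterp V hn hθ' hx]
    refine abs_cellInterp_sub_le hθ' fun p hpv => ?_
    have h1 := hV.approx p (hne p hpv) fun j => (hpv.pt_mem hn j).2.2
    have h2 := hw.abs_sub_le hC (fun j => (hpv.pt_mem hn j).2.1) hx01 hρ0
      (hpv.pt_mem hn m).1.1 (hxc m).1.1
      (fun j => abs_sub_le_of_mem_Icc_cell (hpv.pt_mem hn j).1 (hxc j).1)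
    have h3 : 3 * (C / ρ) * ((2 : ℝ) ^ ℓ)⁻¹ ≤ 6 * C * (2 ^ ℓ)⁻¹ / x m := by
      calc 3 * (C / ρ) * ((2 : ℝ) ^ ℓ)⁻¹ = 3 * C * (2 ^ ℓ)⁻¹ * ρ⁻¹ := by ring
        _ ≤ 3 * C * (2 ^ ℓ)⁻¹ * (2 / x m) := by gcongr
        _ = _ := by ring
    have := abs_sub_le (nodeVal ℓ V p) (w (pt ℓ p)) (w x)
    linarith
  · intro i
    rw [lineDeriv_feFun V hn hθ hx i]
    refine abs_cellInterp_diff_le hθ' i fun p hpv hpi => ?_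
    have hpv' : IsVertex n (p + Pi.single i 1) := by
      intro j
      by_cases h : j = i
      · subst h; right; simp [hpi]
      · simpa [h] using hpv j
    have h1 := hV.approx p (hne p hpv) fun j => (hpv.pt_mem hn j).2.2
    have h2 := hV.approx _ (hne _ hpv') fun j => (hpv'.pt_mem hn j).2.2
    have h3 : |2 ^ ℓ * (w (pt ℓ (p + Pi.single i 1)) - w (pt ℓ p)) - partialDeriv i w x| ≤
        12 * C * (2 ^ ℓ)⁻¹ / x m ^ 2 := by
      rw [pt_add_single]
      refine abs_diffQuot_sub_le hw.smooth _ i hp fun t ht => ?_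
      have hy : ∀ j, (pt ℓ p + t • unitVec i) j ∈
          Set.Icc ((n j : ℝ) / 2 ^ ℓ) ((n j + 1) / 2 ^ ℓ) := by
        intro j
        by_cases h : j = i
        · subst h
          rw [add_smul_unitVec_apply_self, pt_apply, hpi]
          refine ⟨by linarith [ht.1], ?_⟩
          rw [add_div, one_div]
          linarith [ht.2]
        · rw [add_smul_unitVec_apply_of_ne _ h]
          exact (hpv.pt_mem hn j).1
      have hy1 : ∀ j, (pt ℓ p + t • unitVec i) j ∈ Set.Icc (0 : ℝ) 1 := fun j => by
        refine ⟨le_trans (by positivity) (hy j).1, (hy j).2.trans ?_⟩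
        rw [div_le_one hp]
        exact_mod_cast hn j
      refine (hw.abs_partialDeriv_sub_le hC hy1 hx01 hρ0 (hy m).1 (hxc m).1.1
        (fun j => abs_sub_le_of_mem_Icc_cell (hy j) (hxc j).1) i).trans ?_
      calc 3 * (C / ρ ^ 2) * ((2 : ℝ) ^ ℓ)⁻¹ = 3 * C * (2 ^ ℓ)⁻¹ * ρ⁻¹ ^ 2 := by ring
        _ ≤ 3 * C * (2 ^ ℓ)⁻¹ * (2 / x m) ^ 2 := by gcongr
        _ = _ := by ring
    -- The error splits into the consistency error of the exact difference quotient and the nodal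
    -- errors, which are magnified by 2^ℓ.
    have e : 2 ^ ℓ * (nodeVal ℓ V (p + Pi.single i 1) - nodeVal ℓ V p) - partialDeriv i w x =
        (2 ^ ℓ * (w (pt ℓ (p + Pi.single i 1)) - w (pt ℓ p)) - partialDeriv i w x) +
        2 ^ ℓ * ((nodeVal ℓ V (p + Pi.single i 1) - w (pt ℓ (p + Pi.single i 1))) -
          (nodeVal ℓ V p - w (pt ℓ p))) := by ring
    rw [e]
    refine (abs_add_le _ _).trans (add_le_add h3 ?_)
    rw [abs_mul, abs_of_pos hp]
    calc _ ≤ (2 : ℝ) ^ ℓ * (δ + δ) := by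
          gcongr
          exact (abs_sub _ _).trans (add_le_add h2 h1)
      _ = _ := by ring

/-- The error on the cell at the origin. -/
lemma IsNodalApprox.inner (hw : HasPointwiseBounds w C A 𝔡) (hC : 0 ≤ C) (hδ : 0 ≤ δ)
    (hV : IsNodalApprox w ℓ V δ) (hn : ∀ j, n j = 0) (hθ : ∀ j, θ j ∈ Set.Ioo (0 : ℝ) 1)
    (hx : ∀ j, 2 ^ ℓ * x j = n j + θ j) (m : Fin 3) :
    |feFun ℓ V x - w x| ≤ 6 * C * (2 ^ ℓ)⁻¹ / x m + δ ∧
    ∀ i, |lineDeriv ℝ (feFun ℓ V) x (unitVec i) - partialDeriv i w x| ≤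
      7 * C / x m + 2 * 2 ^ ℓ * δ := by
  have hp : (0 : ℝ) < 2 ^ ℓ := by positivity
  have hn' : ∀ j, n j < 2 ^ ℓ := fun j => by rw [hn j]; positivity
  have hθ' : ∀ j, θ j ∈ Set.Icc (0 : ℝ) 1 := fun j => Set.Ioo_subset_Icc_self (hθ j)
  have hxc := cell_mem hn' hθ hx
  have hx01 : ∀ j, x j ∈ Set.Icc (0 : ℝ) 1 := fun j => Set.Ioo_subset_Icc_self (hxc j).2
  have hxm : 0 < x m := (hxc m).2.1
  have hxh : x m ≤ (2 ^ ℓ)⁻¹ := by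
    have := (hxc m).1.2
    rw [hn m] at this
    simpa using this
  have hv1 : IsVertex n (fun _ => 1) := fun j => by rw [hn j]; simp
  -- Every vertex other than the origin shares a coordinate of value h with the vertex (1,1,1). On
  -- the segment between them that coordinate stays h, the gradient is at most C/h, and the values
  -- differ by at most 3C.
  set c := w (pt ℓ fun _ => 1) with hc
  have hp1 : ∀ j, pt ℓ (fun _ => 1) j = (2 ^ ℓ)⁻¹ := fun j => by rw [pt_apply]; simp
  have hnz : ∀ p, IsVertex n p → p ≠ 0 → |w (pt ℓ p) - c| ≤ 3 * C := by
    intro p hpv hp0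
    obtain ⟨j, hj⟩ := Function.ne_iff.1 hp0
    have hj1 : p j = 1 := by
      have := hpv j
      rw [hn j] at this
      simp only [Pi.zero_apply] at hj
      omega
    refine (hw.abs_sub_le hC (fun j => (hpv.pt_mem hn' j).2.1) (fun j => (hv1.pt_mem hn' j).2.1)
      (i := j) (ρ := (2 ^ ℓ)⁻¹) (by positivity) (by rw [pt_apply, hj1]; simp) (by rw [hp1])
      (fun j => abs_sub_le_of_mem_Icc_cell (hpv.pt_mem hn' j).1 (hv1.pt_mem hn' j).1)).trans ?_
    apply le_of_eq
    field_simp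
  have hall : ∀ p, IsVertex n p → |nodeVal ℓ V p - c| ≤ 3 * C + δ := by
    intro p hpv
    by_cases hp0 : p = 0
    · rw [hp0, hV.zero]
      refine (hnz _ ?_ ?_).trans (by linarith)
      · intro j
        rw [hn j]
        by_cases h : j = 0 <;> simp [h]
      · simp
    · have h1 := hV.approx p hp0 fun j => (hpv.pt_mem hn' j).2.2
      have h2 := hnz p hpv hp0
      have := abs_sub_le (nodeVal ℓ V p) (w (pt ℓ p)) c
      linarith
  have hxc' : |c - w x| ≤ 3 * (C / x m) * (2 ^ ℓ)⁻¹ :=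
    hw.abs_sub_le hC (fun j => (hv1.pt_mem hn' j).2.1) hx01 hxm (by rw [hp1]; exact hxh) le_rfl
      (fun j => abs_sub_le_of_mem_Icc_cell (hv1.pt_mem hn' j).1 (hxc j).1)
  have hone : 1 ≤ (2 ^ ℓ)⁻¹ / x m := by rwa [one_le_div hxm]
  have hinv : 2 ^ ℓ ≤ (x m)⁻¹ := by
    rw [le_inv_comm₀ hp hxm]
    exact hxh
  constructor
  · rw [feFun_eq_cellInterp V hn' hθ' hx]
    refine abs_cellInterp_sub_le hθ' fun p hpv => ?_
    have h1 := hall p hpv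
    have h2 := abs_sub_le (nodeVal ℓ V p) c (w x)
    have h3 : 3 * C ≤ 3 * C * ((2 ^ ℓ)⁻¹ / x m) := le_mul_of_one_le_right (by positivity) hone
    calc _ ≤ 3 * C + δ + 3 * (C / x m) * (2 ^ ℓ)⁻¹ := by linarith
      _ ≤ 3 * C * ((2 ^ ℓ)⁻¹ / x m) + δ + 3 * (C / x m) * (2 ^ ℓ)⁻¹ := by linarith
      _ = _ := by ring
  · intro i
    rw [lineDeriv_feFun V hn' hθ hx i]
    refine abs_cellInterp_diff_le hθ' i fun p hpv hpi => ?_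
    have hpv' : IsVertex n (p + Pi.single i 1) := by
      intro j
      by_cases h : j = i
      · subst h; right; simp [hpi]
      · simpa [h] using hpv j
    have h1 := hall p hpv
    have h2 := hall _ hpv'
    have h3 := hw.grad i x hx01 m hxm
    -- The difference quotient is not claimed to be accurate here, only to be of size C/x m plus
    -- nodal error; the smallness comes later from the size of the cell.
    have h4 : |nodeVal ℓ V (p + Pi.single i 1) - nodeVal ℓ V p| ≤ 2 * (3 * C + δ) := by
      have := abs_sub_le (nodeVal ℓ V (p + Pi.single i 1)) c (nodeVal ℓ V p)
      rw [abs_sub_comm c] at this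
      linarith
    calc _ ≤ 2 ^ ℓ * |nodeVal ℓ V (p + Pi.single i 1) - nodeVal ℓ V p| + |partialDeriv i w x| := by
          refine (abs_sub _ _).trans ?_
          rw [abs_mul, abs_of_pos hp]
      _ ≤ 2 ^ ℓ * (2 * (3 * C + δ)) + C / x m := by gcongr
      _ = 6 * C * 2 ^ ℓ + C / x m + 2 * 2 ^ ℓ * δ := by ring
      _ ≤ 6 * C * (x m)⁻¹ + C / x m + 2 * 2 ^ ℓ * δ := by gcongr
      _ = _ := by ring

end Cell

end QTTApprox

namespace QTTApprox

/-! ### The interpolation error in `H¹(Q)` -/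

lemma norm_le_two_mul {x : E3} {m : Fin 3} (hx : ∀ j, |x j| ≤ x m) : ‖x‖ ≤ 2 * x m := by
  have h0 : 0 ≤ x m := (abs_nonneg _).trans (hx m)
  refine abs_le_of_sq_le_sq' ?_ (by positivity) |>.2
  rw [EuclideanSpace.real_norm_sq_eq, Fin.sum_univ_three]
  have h : ∀ j, x j ^ 2 ≤ x m ^ 2 := fun j => sq_le_sq.2 ((hx j).trans (le_abs_self _))
  nlinarith [h 0, h 1, h 2, sq_nonneg (x m)]

lemma Q_norm {x : E3} (hx : x ∈ Q) : 0 < ‖x‖ ∧ ‖x‖ < 2 := by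
  refine ⟨norm_pos_iff.2 fun h => ?_, ?_⟩
  · have := (hx 0).1
    simp [h] at this
  · refine lt_of_pow_lt_pow_left₀ 2 (by norm_num) ?_
    rw [EuclideanSpace.real_norm_sq_eq, Fin.sum_univ_three]
    have h : ∀ j, x j ^ 2 < 1 := fun j => by nlinarith [(hx j).1, (hx j).2]
    linarith [h 0, h 1, h 2]

/-- In polar coordinates the exponent becomes 2 - 5/2 = -1/2, which is integrable at zero. -/
lemma integrableOn_norm_rpow : IntegrableOn (fun x : E3 => ‖x‖ ^ (-5 / 2 : ℝ)) Q := by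
  set f : ℝ → ℝ := (Set.Ioo 0 2).indicator fun r => r ^ (-5 / 2 : ℝ) with hf
  have h1 : Integrable (fun x : E3 => f ‖x‖) := by
    rw [integrable_fun_norm_addHaar volume]
    have h2 : IntegrableOn (fun r : ℝ => r ^ (-1 / 2 : ℝ)) (Set.Ioo 0 2) :=
      (intervalIntegral.integrableOn_Ioo_rpow_iff (by norm_num)).2 (by norm_num)
    have h3 : Integrable ((Set.Ioo (0 : ℝ) 2).indicator fun r => r ^ (-1 / 2 : ℝ)) :=
      (integrable_indicator_iff measurableSet_Ioo).2 h2
    refine h3.integrableOn.congr_fun (fun r hr => ?_) measurableSet_Ioi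
    have hr0 : (0 : ℝ) < r := hr
    by_cases h : r ∈ Set.Ioo (0 : ℝ) 2
    · simp only [hf, Set.indicator_of_mem h, finrank_euclideanSpace, Fintype.card_fin, smul_eq_mul]
      rw [← Real.rpow_natCast, ← Real.rpow_add hr0]
      norm_num
    · simp [hf, Set.indicator_of_notMem h]
  refine h1.integrableOn.congr_fun (fun x hx => ?_) measurableSet_Q
  simp only [hf]
  rw [Set.indicator_of_mem (Set.mem_Ioo.2 (Q_norm hx))]

lemma aestronglyMeasurable_norm_rpow (b : ℝ) :
    AEStronglyMeasurable (fun x : E3 => ‖x‖ ^ b) (volume.restrict Q) :=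
  (measurable_norm.pow_const b).aestronglyMeasurable

lemma volume_Q : volume Q = 1 := by
  have h := lintegral_cube 0 1 (G := 1) measurable_one 0
  rw [← Q_eq_cube] at h
  simpa using h

lemma memLp_norm_rpow :
    MemLp (fun x : E3 => ‖x‖ ^ (-5 / 4 : ℝ)) 2 (volume.restrict Q) := by
  rw [memLp_two_iff_integrable_sq (aestronglyMeasurable_norm_rpow _)]
  refine integrableOn_norm_rpow.congr_fun (fun x hx => ?_) measurableSet_Q
  simp only
  rw [← Real.rpow_natCast, ← Real.rpow_mul (norm_nonneg x)]
  norm_num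

/-- Almost every point of the cube lies in the interior of a mesh cell. -/
lemma ae_mem_cell (ℓ : ℕ) : ∀ᵐ x : E3 ∂(volume.restrict Q), x ∈ Q ∧ ∃ (n : Fin 3 → ℕ)
    (θ : Fin 3 → ℝ), (∀ j, n j < 2 ^ ℓ) ∧ (∀ j, θ j ∈ Set.Ioo (0 : ℝ) 1) ∧
      ∀ j, 2 ^ ℓ * x j = n j + θ j := by
  have hq : ∀ j, ∀ᵐ x : E3, x j ∉ Set.range fun k : ℕ => (k : ℝ) / 2 ^ ℓ := by
    intro j
    have h1 : ∀ᵐ t : ℝ, t ∉ Set.range fun k : ℕ => (k : ℝ) / 2 ^ ℓ :=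
      (Set.countable_range _).ae_notMem volume
    have h2 : Measure.QuasiMeasurePreserving (fun x : E3 => x j) volume volume := by
      have a := Measure.quasiMeasurePreserving_eval (fun _ : Fin 3 => (volume : Measure ℝ)) j
      have b := (EuclideanSpace.volume_preserving_symm_measurableEquiv_toLp
        (Fin 3)).quasiMeasurePreserving
      exact a.comp b
    exact h2.ae h1
  have hp : (0 : ℝ) < 2 ^ ℓ := by positivity
  filter_upwards [ae_restrict_mem measurableSet_Q, ae_restrict_of_ae (ae_all_iff.2 hq)]
    with x hx hx'
  have h0 : ∀ j, 0 ≤ 2 ^ ℓ * x j := fun j => mul_nonneg hp.le (hx j).1.le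
  refine ⟨hx, fun j => ⌊2 ^ ℓ * x j⌋₊, fun j => 2 ^ ℓ * x j - ⌊2 ^ ℓ * x j⌋₊, fun j => ?_,
    fun j => ⟨?_, ?_⟩, fun j => by ring⟩
  · rw [Nat.floor_lt (h0 j)]
    push_cast
    nlinarith [(hx j).2]
  · refine sub_pos.2 (lt_of_le_of_ne (Nat.floor_le (h0 j)) fun h => hx' j ⟨⌊2 ^ ℓ * x j⌋₊, ?_⟩)
    simp only
    rw [h]
    field_simp
  · have := Nat.lt_floor_add_one (2 ^ ℓ * x j)
    linarith

/-- The three error profiles, for the values, for the gradient away from the origin and for the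
gradient in the cell at the origin, are dominated by one profile that is square integrable and keeps
a positive power of `h`. -/
lemma rpow_interp_le {h μ : ℝ} (hh : 0 < h) (hμ : 0 < μ) (hμ1 : μ ≤ 1) (hh1 : h ≤ 1) :
    h / μ ≤ h ^ (1 / 4 : ℝ) * μ ^ (-5 / 4 : ℝ) ∧
    (h ≤ μ → h / μ ^ 2 ≤ h ^ (1 / 4 : ℝ) * μ ^ (-5 / 4 : ℝ)) ∧
    (μ ≤ h → 1 / μ ≤ h ^ (1 / 4 : ℝ) * μ ^ (-5 / 4 : ℝ)) := by
  have eh : h = h ^ (1 / 4 : ℝ) * h ^ (3 / 4 : ℝ) := by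
    rw [← Real.rpow_add hh]; norm_num
  have e1 : μ⁻¹ = μ ^ (-5 / 4 : ℝ) * μ ^ (1 / 4 : ℝ) := by
    rw [← Real.rpow_add hμ, ← Real.rpow_neg_one]; norm_num
  have e2 : (μ ^ 2)⁻¹ = μ ^ (-5 / 4 : ℝ) * μ ^ (-3 / 4 : ℝ) := by
    rw [← Real.rpow_add hμ, ← Real.rpow_natCast, ← Real.rpow_neg hμ.le]; norm_num
  refine ⟨?_, fun hle => ?_, fun hle => ?_⟩
  · rw [div_eq_mul_inv, e1]
    nth_rw 1 [eh]
    have a1 : h ^ (3 / 4 : ℝ) ≤ 1 := Real.rpow_le_one hh.le hh1 (by norm_num)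
    have a2 : μ ^ (1 / 4 : ℝ) ≤ 1 := Real.rpow_le_one hμ.le hμ1 (by norm_num)
    calc _ = h ^ (1 / 4 : ℝ) * μ ^ (-5 / 4 : ℝ) * (h ^ (3 / 4 : ℝ) * μ ^ (1 / 4 : ℝ)) := by ring
      _ ≤ h ^ (1 / 4 : ℝ) * μ ^ (-5 / 4 : ℝ) * 1 := by
          gcongr
          exact mul_le_one₀ a1 (by positivity) a2
      _ = _ := by ring
  · rw [div_eq_mul_inv, e2]
    nth_rw 1 [eh]
    have a1 : h ^ (3 / 4 : ℝ) ≤ μ ^ (3 / 4 : ℝ) := Real.rpow_le_rpow hh.le hle (by norm_num)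
    have a2 : μ ^ (3 / 4 : ℝ) * μ ^ (-3 / 4 : ℝ) = 1 := by
      rw [← Real.rpow_add hμ]; norm_num
    calc _ = h ^ (1 / 4 : ℝ) * μ ^ (-5 / 4 : ℝ) * (h ^ (3 / 4 : ℝ) * μ ^ (-3 / 4 : ℝ)) := by ring
      _ ≤ h ^ (1 / 4 : ℝ) * μ ^ (-5 / 4 : ℝ) * (μ ^ (3 / 4 : ℝ) * μ ^ (-3 / 4 : ℝ)) := by gcongr
      _ = _ := by rw [a2, mul_one]
  · rw [one_div, e1]
    have a1 : μ ^ (1 / 4 : ℝ) ≤ h ^ (1 / 4 : ℝ) := Real.rpow_le_rpow hμ.le hle (by norm_num)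
    calc _ ≤ μ ^ (-5 / 4 : ℝ) * h ^ (1 / 4 : ℝ) := by gcongr
      _ = _ := by ring

/-- With `m` the largest coordinate, ‖x‖ ≤ 2 x m, and `n m = 0` means that the cell touches the
origin. The constant 48 is 12 · 4, where 4 bounds 2^(5/4). -/
lemma IsNodalApprox.ae_le {w : E3 → ℝ} {C A 𝔡 : ℝ} {ℓ : ℕ} {V : ℕ → ℕ → ℕ → ℝ} {δ : ℝ}
    (hw : HasPointwiseBounds w C A 𝔡) (hC : 0 ≤ C) (hδ : 0 ≤ δ) (hV : IsNodalApprox w ℓ V δ) :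
    ∀ᵐ x ∂(volume.restrict Q), |feFun ℓ V x - w x| ≤
        48 * C * ((2 ^ ℓ)⁻¹ : ℝ) ^ (1 / 4 : ℝ) * ‖x‖ ^ (-5 / 4 : ℝ) + 2 * 2 ^ ℓ * δ ∧
      ∀ i, |lineDeriv ℝ (feFun ℓ V) x (unitVec i) - partialDeriv i w x| ≤
        48 * C * ((2 ^ ℓ)⁻¹ : ℝ) ^ (1 / 4 : ℝ) * ‖x‖ ^ (-5 / 4 : ℝ) + 2 * 2 ^ ℓ * δ := by
  filter_upwards [ae_mem_cell ℓ] with x hx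
  obtain ⟨hxQ, n, θ, hn, hθ, hxn⟩ := hx
  obtain ⟨m, -, hm⟩ := Finset.exists_max_image Finset.univ (fun j => x j) ⟨0, Finset.mem_univ _⟩
  have hp : (0 : ℝ) < 2 ^ ℓ := by positivity
  have h1ℓ : (1 : ℝ) ≤ 2 ^ ℓ := one_le_pow₀ (by norm_num)
  have hxm := hxQ m
  have hh0 : (0 : ℝ) < (2 ^ ℓ)⁻¹ := by positivity
  have hh1 : ((2 : ℝ) ^ ℓ)⁻¹ ≤ 1 := inv_le_one_of_one_le₀ h1ℓ
  obtain ⟨r1, r2, r3⟩ := rpow_interp_le hh0 hxm.1 hxm.2.le hh1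
  have hnorm : ‖x‖ ≤ 2 * x m := norm_le_two_mul fun j => by
    rw [abs_of_pos (hxQ j).1]; exact hm j (Finset.mem_univ _)
  have hnp := (Q_norm hxQ).1
  have hμ : x m ^ (-5 / 4 : ℝ) ≤ 4 * ‖x‖ ^ (-5 / 4 : ℝ) := by
    calc x m ^ (-5 / 4 : ℝ) ≤ (‖x‖ / 2) ^ (-5 / 4 : ℝ) :=
          Real.rpow_le_rpow_of_nonpos (by positivity) (by linarith) (by norm_num)
      _ = 2 ^ (5 / 4 : ℝ) * ‖x‖ ^ (-5 / 4 : ℝ) := by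
          rw [Real.div_rpow hnp.le (by norm_num), show (-5 / 4 : ℝ) = -(5 / 4) by norm_num,
            Real.rpow_neg (by norm_num : (0 : ℝ) ≤ 2), div_inv_eq_mul, mul_comm]
      _ ≤ 2 ^ (2 : ℝ) * ‖x‖ ^ (-5 / 4 : ℝ) := by gcongr <;> norm_num
      _ = _ := by norm_num
  set W := 48 * C * ((2 ^ ℓ)⁻¹ : ℝ) ^ (1 / 4 : ℝ) * ‖x‖ ^ (-5 / 4 : ℝ) with hW
  have hbd : ∀ {q : ℝ}, q ≤ ((2 ^ ℓ)⁻¹ : ℝ) ^ (1 / 4 : ℝ) * x m ^ (-5 / 4 : ℝ) →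
      12 * C * q ≤ W := by
    intro q hq
    calc 12 * C * q ≤ 12 * C * (((2 ^ ℓ)⁻¹ : ℝ) ^ (1 / 4 : ℝ) * (4 * ‖x‖ ^ (-5 / 4 : ℝ))) := by
          gcongr
          exact hq.trans (by gcongr)
      _ = W := by rw [hW]; ring
  have hb1 := hbd r1
  have hδ' : δ ≤ 2 * 2 ^ ℓ * δ := le_mul_of_one_le_left hδ (by linarith)
  have hfun : 6 * C * (2 ^ ℓ)⁻¹ / x m ≤ W := by
    refine le_trans ?_ hb1
    rw [mul_div_assoc]
    have : 0 ≤ ((2 : ℝ) ^ ℓ)⁻¹ / x m := div_nonneg hh0.le hxm.1.le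
    gcongr
    norm_num
  by_cases h : n m = 0
  · have hn0 : ∀ j, n j = 0 := by
      intro j
      have a1 : (n j : ℝ) < 1 := by
        have b1 := hxn j
        have b2 := hxn m
        rw [h] at b2
        have b3 : 2 ^ ℓ * x j ≤ 2 ^ ℓ * x m := by
          have := hm j (Finset.mem_univ _)
          gcongr
        have := (hθ j).1
        have := (hθ m).2
        push_cast at b2
        linarith
      have a2 : n j < 1 := by exact_mod_cast a1
      omega
    obtain ⟨h1, h2⟩ := hV.inner hw hC hδ hn0 hθ hxn m
    refine ⟨h1.trans (by linarith), fun i => (h2 i).trans ?_⟩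
    have hμh : x m ≤ (2 ^ ℓ)⁻¹ := by
      have := (cell_mem hn hθ hxn m).1.2
      rw [h] at this
      simpa using this
    have hb := hbd (r3 hμh)
    have : 7 * C / x m ≤ 12 * C * (1 / x m) := by
      rw [mul_one_div]
      have := hxm.1
      gcongr
      norm_num
    linarith
  · obtain ⟨h1, h2⟩ := hV.outer hw hC hn hθ hxn (m := m) (by omega)
    refine ⟨h1.trans (by linarith), fun i => (h2 i).trans ?_⟩
    have hμh : (2 ^ ℓ)⁻¹ ≤ x m := by
      refine le_trans ?_ (cell_mem hn hθ hxn m).1.1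
      rw [inv_eq_one_div]
      exact div_le_div_of_nonneg_right (Nat.one_le_cast.2 (Nat.one_le_iff_ne_zero.2 h)) hp.le
    have hb := hbd (r2 hμh)
    rw [mul_div_assoc]
    linarith

/-- The error of the nodal interpolation in the `L²(Q)` norm, for the function and its gradient. -/
theorem exists_interpolation_bound : ∃ K : ℝ, 0 < K ∧ ∀ {w : E3 → ℝ} {C A 𝔡 : ℝ} {ℓ : ℕ}
    {V : ℕ → ℕ → ℕ → ℝ} {δ : ℝ}, HasPointwiseBounds w C A 𝔡 → 0 ≤ C → 0 ≤ δ →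
    IsNodalApprox w ℓ V δ →
    eLpNorm (fun x => feFun ℓ V x - w x) 2 (volume.restrict Q) ≤
        ENNReal.ofReal (K * C * ((2 ^ ℓ)⁻¹ : ℝ) ^ (1 / 4 : ℝ) + 2 * 2 ^ ℓ * δ) ∧
      ∀ i, eLpNorm (fun x => lineDeriv ℝ (feFun ℓ V) x (unitVec i) - partialDeriv i w x) 2
        (volume.restrict Q) ≤
          ENNReal.ofReal (K * C * ((2 ^ ℓ)⁻¹ : ℝ) ^ (1 / 4 : ℝ) + 2 * 2 ^ ℓ * δ) := by
  set L := eLpNorm (fun x : E3 => ‖x‖ ^ (-5 / 4 : ℝ)) 2 (volume.restrict Q) with hL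
  have hLt : L ≠ ⊤ := memLp_norm_rpow.eLpNorm_ne_top
  refine ⟨48 * L.toReal + 1, by positivity, ?_⟩
  intro w C A 𝔡 ℓ V δ hw hC hδ hV
  have hae := hV.ae_le hw hC hδ
  have key : ∀ f : E3 → ℝ, (∀ᵐ x ∂(volume.restrict Q), |f x| ≤
      48 * C * ((2 ^ ℓ)⁻¹ : ℝ) ^ (1 / 4 : ℝ) * ‖x‖ ^ (-5 / 4 : ℝ) + 2 * 2 ^ ℓ * δ) →
      eLpNorm f 2 (volume.restrict Q) ≤ ENNReal.ofReal ((48 * L.toReal + 1) * C *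
        ((2 ^ ℓ)⁻¹ : ℝ) ^ (1 / 4 : ℝ) + 2 * 2 ^ ℓ * δ) := by
    intro f hf
    set c := 48 * C * ((2 ^ ℓ)⁻¹ : ℝ) ^ (1 / 4 : ℝ) with hc
    have hc0 : 0 ≤ c := by positivity
    set d := 2 * 2 ^ ℓ * δ with hd
    have hd0 : 0 ≤ d := by positivity
    set g : E3 → ℝ := fun x => ‖x‖ ^ (-5 / 4 : ℝ) with hg
    have h1 : eLpNorm f 2 (volume.restrict Q) ≤
        eLpNorm (c • g + fun _ => d) 2 (volume.restrict Q) := by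
      refine eLpNorm_mono_ae_real ?_
      filter_upwards [hf] with x hx
      simpa [hg] using hx
    have h2 : eLpNorm (c • g + fun _ => d) 2 (volume.restrict Q) ≤
        eLpNorm (c • g) 2 (volume.restrict Q) + eLpNorm (fun _ : E3 => d) 2 (volume.restrict Q) :=
      eLpNorm_add_le ((aestronglyMeasurable_norm_rpow _).const_smul _)
        aestronglyMeasurable_const (by norm_num)
    have h3 : eLpNorm (c • g) 2 (volume.restrict Q) = ENNReal.ofReal (c * L.toReal) := by
      rw [eLpNorm_const_smul, ENNReal.ofReal_mul hc0, ENNReal.ofReal_toReal hLt,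
        Real.enorm_eq_ofReal_abs, abs_of_nonneg hc0]
    have h4 : eLpNorm (fun _ : E3 => d) 2 (volume.restrict Q) = ENNReal.ofReal d := by
      rw [eLpNorm_const' _ (by norm_num) (by norm_num), Measure.restrict_apply_univ, volume_Q,
        ENNReal.one_rpow, mul_one, Real.enorm_eq_ofReal_abs, abs_of_nonneg hd0]
    refine h1.trans (h2.trans ?_)
    rw [h3, h4, ← ENNReal.ofReal_add (by positivity) hd0]
    refine ENNReal.ofReal_le_ofReal (add_le_add ?_ le_rfl)
    have : 0 ≤ C * ((2 ^ ℓ)⁻¹ : ℝ) ^ (1 / 4 : ℝ) := by positivity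
    rw [hc]
    nlinarith
  exact ⟨key _ (hae.mono fun x hx => hx.1), fun i => key _ (hae.mono fun x hx => hx.2 i)⟩

end QTTApprox

namespace QTTApprox

/-! ### Mollification after shrinking the cube -/

/-- The convolution of `f`, restricted to `Q`, with the kernel `k`. -/
noncomputable def convQ (f k : E3 → ℝ) (z : E3) : ℝ := ∫ y in Q, f y * k (z - y)

lemma convQ_eq_convolution (f k : E3 → ℝ) :
    convQ f k = convolution (Q.indicator f) k (ContinuousLinearMap.mul ℝ ℝ) volume := by
  funext z
  rw [convQ, convolution, ← integral_indicator measurableSet_Q]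
  congr 1
  funext y
  by_cases h : y ∈ Q <;> simp [h]

lemma locallyIntegrable_indicator_Q {f : E3 → ℝ} (hf : IntegrableOn f Q) :
    LocallyIntegrable (Q.indicator f) :=
  ((integrable_indicator_iff measurableSet_Q).2 hf).locallyIntegrable

lemma contDiff_convQ {f k : E3 → ℝ} (hf : IntegrableOn f Q) (hk : ContDiff ℝ ∞ k)
    (hc : HasCompactSupport k) : ContDiff ℝ ∞ (convQ f k) := by
  rw [convQ_eq_convolution]
  exact hc.contDiff_convolution_right _ (locallyIntegrable_indicator_Q hf) hk

lemma partialDeriv_convQ {f k : E3 → ℝ} (hf : IntegrableOn f Q) (hk : ContDiff ℝ ∞ k)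
    (hc : HasCompactSupport k) (i : Fin 3) :
    partialDeriv i (convQ f k) = convQ f (partialDeriv i k) := by
  have hk1 : ContDiff ℝ 1 k := hk.of_le (by simp)
  funext z
  rw [convQ_eq_convolution, partialDeriv,
    (hc.hasFDerivAt_convolution_right _ (locallyIntegrable_indicator_Q hf) hk1 z).fderiv,
    convolution_precompR_apply _ (locallyIntegrable_indicator_Q hf) (hc.fderiv ℝ)
      (hk1.continuous_fderiv one_ne_zero), convQ_eq_convolution]
  rfl

/-- The affine map that shrinks the unit cube towards its centre. -/
noncomputable def shrink (η : ℝ) (x : E3) : E3 := (1 - 2 * η) • x + WithLp.toLp 2 fun _ => η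

lemma shrink_apply (η : ℝ) (x : E3) (j : Fin 3) : shrink η x j = (1 - 2 * η) * x j + η := by
  simp [shrink]

lemma contDiff_shrink (η : ℝ) : ContDiff ℝ ∞ (shrink η) := by
  unfold shrink
  fun_prop

lemma partialDeriv_comp_affine {f : E3 → ℝ} (hf : ContDiff ℝ ∞ f) (c a : ℝ) (b : E3) (i : Fin 3) :
    partialDeriv i (fun x => c * f (a • x + b)) = fun x => c * a * partialDeriv i f (a • x + b) := by
  funext x
  have h1 : HasFDerivAt (fun x : E3 => a • x + b) (a • ContinuousLinearMap.id ℝ E3) x :=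
    ((hasFDerivAt_id x).const_smul a).add_const b
  have h2 := (((hf.differentiable (by simp)) (a • x + b)).hasFDerivAt.comp x h1).const_mul c
  unfold partialDeriv
  have h3 : fderiv ℝ (fun x => c * f (a • x + b)) x =
    c • (fderiv ℝ f (a • x + b)).comp (a • ContinuousLinearMap.id ℝ E3) := h2.fderiv
  rw [h3]
  simp
  ring

/-- An operator that intertwines partial derivatives up to powers of a factor intertwines all
derivatives. -/
lemma multiDeriv_intertwine {P : (E3 → ℝ) → Prop} (hP : ∀ f i, P f → P (partialDeriv i f))
    {Φ : ℕ → (E3 → ℝ) → E3 → ℝ}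
    (hΦ : ∀ n f i, P f → partialDeriv i (Φ n f) = Φ (n + 1) (partialDeriv i f)) (α : Fin 3 → ℕ)
    {f : E3 → ℝ} (hf : P f) : multiDeriv α (Φ 0 f) = Φ (∑ i, α i) (multiDeriv α f) := by
  have hit : ∀ i k n f, P f → P ((partialDeriv i)^[k] f) ∧
      (partialDeriv i)^[k] (Φ n f) = Φ (n + k) ((partialDeriv i)^[k] f) := by
    intro i k
    induction k with
    | zero => intro n f hf; simp [hf]
    | succ k ih =>
      intro n f hf
      obtain ⟨h1, h2⟩ := ih n f hf
      rw [Function.iterate_succ_apply', Function.iterate_succ_apply', h2]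
      exact ⟨hP _ _ h1, hΦ _ _ _ h1⟩
  unfold multiDeriv
  obtain ⟨p2, e2⟩ := hit 2 (α 2) 0 f hf
  rw [e2]
  obtain ⟨p1, e1⟩ := hit 1 (α 1) (0 + α 2) _ p2
  rw [e1]
  obtain ⟨p0, e0⟩ := hit 0 (α 0) (0 + α 2 + α 1) _ p1
  rw [e0, Fin.sum_univ_three]
  congr 1
  omega

lemma hasCompactSupport_partialDeriv {f : E3 → ℝ} (hf : HasCompactSupport f) (i : Fin 3) :
    HasCompactSupport (partialDeriv i f) :=
  hf.of_isClosed_subset (isClosed_tsupport _) (tsupport_partialDeriv _ _)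

lemma multiDeriv_convQ_shrink {f k : E3 → ℝ} (hf : IntegrableOn f Q) (hk : ContDiff ℝ ∞ k)
    (hc : HasCompactSupport k) (η : ℝ) (α : Fin 3 → ℕ) :
    multiDeriv α (fun x => convQ f k (shrink η x)) =
      fun x => (1 - 2 * η) ^ (∑ i, α i) * convQ f (multiDeriv α k) (shrink η x) := by
  have := multiDeriv_intertwine (P := fun k => ContDiff ℝ ∞ k ∧ HasCompactSupport k)
    (Φ := fun n k x => (1 - 2 * η) ^ n * convQ f k (shrink η x))
    (fun k i hk => ⟨contDiff_partialDeriv hk.1 i, hasCompactSupport_partialDeriv hk.2 i⟩)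
    (fun n k i hk => by
      have := partialDeriv_comp_affine (contDiff_convQ hf hk.1 hk.2) ((1 - 2 * η) ^ n) (1 - 2 * η)
        (WithLp.toLp 2 fun _ => η) i
      rw [partialDeriv_convQ hf hk.1 hk.2] at this
      rw [pow_succ]
      exact this) α ⟨hk, hc⟩
  simpa using this

lemma multiDeriv_reflect {k : E3 → ℝ} (hk : ContDiff ℝ ∞ k) (z : E3) (α : Fin 3 → ℕ) :
    multiDeriv α (fun y => k (z - y)) = fun y => (-1) ^ (∑ i, α i) * multiDeriv α k (z - y) := by
  have := multiDeriv_intertwine (P := fun k => ContDiff ℝ ∞ k)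
    (Φ := fun n k y => (-1) ^ n * k (z - y)) (fun k i hk => contDiff_partialDeriv hk i)
    (fun n k i hk => by
      have := partialDeriv_comp_affine hk ((-1) ^ n) (-1) z i
      have e : ∀ y : E3, (-1 : ℝ) • y + z = z - y := fun y => by
        rw [neg_one_smul]; abel
      simp only [e] at this
      rw [pow_succ]
      exact this) α hk
  simpa using this

/-- Convolution with the derivative of the kernel is convolution of the weak derivative. -/
lemma HasWeakDeriv.convQ_multiDeriv {α : Fin 3 → ℕ} {u g : E3 → ℝ} (h : HasWeakDeriv α u g)
    {k : E3 → ℝ} (hk : ContDiff ℝ ∞ k) {r : ℝ} (hkr : tsupport k ⊆ Metric.closedBall 0 r)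
    {z : E3} (hz : Metric.closedBall z r ⊆ Q) : convQ u (multiDeriv α k) z = convQ g k z := by
  have hts : tsupport (fun y => k (z - y)) ⊆ Metric.closedBall z r := by
    refine closure_minimal (fun y hy => ?_) Metric.isClosed_closedBall
    have := hkr (subset_tsupport k hy)
    rw [mem_closedBall_zero_iff] at this
    rwa [Metric.mem_closedBall, dist_comm, dist_eq_norm]
  have hcs : HasCompactSupport (fun y => k (z - y)) :=
    (isCompact_closedBall z r).of_isClosed_subset (isClosed_tsupport _) hts
  -- The test function is the reflected kernel, and the sign from its reflection cancels the sign in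
  -- the definition of weak derivative.
  have key := h.integral_eq (fun y => k (z - y)) (hk.comp (contDiff_const.sub contDiff_id)) hcs
    (hts.trans hz)
  rw [multiDeriv_reflect hk] at key
  have e : ∀ y, u y * ((-1) ^ (∑ i, α i) * multiDeriv α k (z - y)) =
      (-1) ^ (∑ i, α i) * (u y * multiDeriv α k (z - y)) := fun y => by ring
  simp only [e, integral_const_mul] at key
  exact mul_left_cancel₀ (pow_ne_zero _ (by norm_num)) key

/-- A mollifier of radius `r`. -/
structure IsMollifier (k : E3 → ℝ) (r : ℝ) : Prop where
  smooth : ContDiff ℝ ∞ k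
  nonneg : ∀ x, 0 ≤ k x
  tsupport_subset : tsupport k ⊆ Metric.closedBall 0 r
  integrable : Integrable k
  integral_eq : ∫ x, k x = 1

lemma exists_isMollifier {r : ℝ} (hr : 0 < r) : ∃ k, IsMollifier k r := by
  let b : ContDiffBump (0 : E3) := ⟨r / 2, r, by positivity, by linarith⟩
  exact ⟨b.normed volume, b.contDiff_normed, b.nonneg_normed, b.tsupport_normed_eq.subset,
    b.integrable_normed, b.integral_normed⟩

lemma IsMollifier.hasCompactSupport {k : E3 → ℝ} {r : ℝ} (hk : IsMollifier k r) :
    HasCompactSupport k :=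
  (isCompact_closedBall 0 r).of_isClosed_subset (isClosed_tsupport _) hk.tsupport_subset

lemma IsMollifier.eq_zero {k : E3 → ℝ} {r : ℝ} (hk : IsMollifier k r) {z : E3} (hz : r < ‖z‖) :
    k z = 0 :=
  image_eq_zero_of_notMem_tsupport fun h => by
    have := hk.tsupport_subset h
    rw [mem_closedBall_zero_iff] at this
    linarith

lemma abs_coord_sub_le {x y : E3} (j : Fin 3) : |x j - y j| ≤ ‖x - y‖ :=
  PiLp.norm_apply_le (x - y) j

/-- The shrunken cube has distance η from the boundary of `Q` and the averages reach only η/2. Hence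
they use values of the function in `Q` alone, and no extension is needed. -/
lemma closedBall_shrink_subset {η : ℝ} (hη : 0 < η) (hη1 : η ≤ 1 / 4) {x : E3}
    (hx : ∀ j, x j ∈ Set.Icc (0 : ℝ) 1) : Metric.closedBall (shrink η x) (η / 2) ⊆ Q := by
  intro y hy j
  rw [mem_closedBall_iff_norm] at hy
  have h1 := abs_le.1 ((abs_coord_sub_le (x := y) (y := shrink η x) j).trans hy)
  rw [shrink_apply] at h1
  have h2 := hx j
  constructor
  · nlinarith [h1.1, h2.1, h2.2]
  · nlinarith [h1.2, h2.1, h2.2]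

/-- The mollified function: its derivatives are averages of the weak derivatives. -/
lemma multiDeriv_mollified {α : Fin 3 → ℕ} {u g : E3 → ℝ} (hu : IntegrableOn u Q)
    (h : HasWeakDeriv α u g) {η : ℝ} (hη : 0 < η) (hη1 : η ≤ 1 / 4) {k : E3 → ℝ}
    (hk : IsMollifier k (η / 2)) {x : E3} (hx : ∀ j, x j ∈ Set.Icc (0 : ℝ) 1) :
    multiDeriv α (fun x => convQ u k (shrink η x)) x =
      (1 - 2 * η) ^ (∑ i, α i) * convQ g k (shrink η x) := by
  rw [multiDeriv_convQ_shrink hu hk.smooth hk.hasCompactSupport]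
  simp only
  rw [h.convQ_multiDeriv hk.smooth hk.tsupport_subset (closedBall_shrink_subset hη hη1 hx)]

end QTTApprox

/-! ### Weighted L² bounds and L² convergence of the mollified functions. -/

namespace QTTApprox

lemma eLpNorm_two_sq {X : Type*} [MeasurableSpace X] (μ : Measure X) (f : X → ℝ) :
    eLpNorm f 2 μ ^ 2 = ∫⁻ x, ENNReal.ofReal (f x ^ 2) ∂μ := by
  have := eLpNorm_nnreal_pow_eq_lintegral (f := f) (μ := μ) (p := 2) (by norm_num)
  have e : ∀ x, ‖f x‖ₑ ^ (2 : ℝ) = ENNReal.ofReal (f x ^ 2) := fun x => by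
    rw [Real.enorm_eq_ofReal_abs, ENNReal.ofReal_rpow_of_nonneg (abs_nonneg _) (by norm_num)]
    simp
  simpa [e] using this

lemma eLpNorm_two_le_iff {X : Type*} [MeasurableSpace X] {μ : Measure X} {f : X → ℝ} {c : ℝ≥0∞} :
    eLpNorm f 2 μ ≤ c ↔ ∫⁻ x, ENNReal.ofReal (f x ^ 2) ∂μ ≤ c ^ 2 := by
  rw [← eLpNorm_two_sq, ENNReal.pow_le_pow_left_iff two_ne_zero]

section

variable {k : E3 → ℝ} {η : ℝ}

lemma IsMollifier.lintegral_eq {r : ℝ} (hk : IsMollifier k r) :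
    ∫⁻ x, ENNReal.ofReal (k x) = 1 := by
  rw [← ofReal_integral_eq_lintegral_ofReal hk.integrable (Eventually.of_forall hk.nonneg),
    hk.integral_eq, ENNReal.ofReal_one]

/-- Jensen's inequality, as Cauchy–Schwarz with the kernel split into two square roots; its mass on
`Q` is at most 1. -/
lemma IsMollifier.sq_convQ_le {r : ℝ} (hk : IsMollifier k r) {g : E3 → ℝ}
    (hg : AEStronglyMeasurable g (volume.restrict Q)) (z : E3) :
    ENNReal.ofReal (convQ g k z ^ 2) ≤
      ∫⁻ y in Q, ENNReal.ofReal (g y ^ 2) * ENNReal.ofReal (k (z - y)) := by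
  have hkm : Measurable fun y => ENNReal.ofReal (k (z - y)) :=
    ENNReal.measurable_ofReal.comp
      (hk.smooth.continuous.comp (continuous_const.sub continuous_id)).measurable
  have e0 : ENNReal.ofReal (convQ g k z ^ 2) = ‖convQ g k z‖ₑ ^ 2 := by
    rw [Real.enorm_eq_ofReal_abs, ← ENNReal.ofReal_pow (abs_nonneg _), sq_abs]
  have e1 : ‖convQ g k z‖ₑ ≤ ∫⁻ y in Q, (‖g y‖ₑ * ENNReal.ofReal (k (z - y)) ^ (1 / 2 : ℝ)) *
      ENNReal.ofReal (k (z - y)) ^ (1 / 2 : ℝ) := by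
    refine (enorm_integral_le_lintegral_enorm _).trans (le_of_eq ?_)
    congr 1
    funext y
    rw [mul_assoc, ← ENNReal.rpow_add_of_nonneg _ _ (by norm_num) (by norm_num), enorm_mul,
      Real.enorm_eq_ofReal (hk.nonneg _)]
    norm_num
  have e2 := ENNReal.lintegral_mul_le_Lp_mul_Lq (volume.restrict Q) Real.HolderConjugate.two_two
    (f := fun y => ‖g y‖ₑ * ENNReal.ofReal (k (z - y)) ^ (1 / 2 : ℝ))
    (g := fun y => ENNReal.ofReal (k (z - y)) ^ (1 / 2 : ℝ))
    (hg.enorm.mul (hkm.pow_const _).aemeasurable) (hkm.pow_const _).aemeasurable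
  have e3 : ∫⁻ y in Q, (ENNReal.ofReal (k (z - y)) ^ (1 / 2 : ℝ)) ^ (2 : ℝ) ≤ 1 := by
    refine (setLIntegral_le_lintegral _ _).trans (le_of_eq ?_)
    simp only [← ENNReal.rpow_mul]
    norm_num
    rw [lintegral_sub_left_eq_self (fun y => ENNReal.ofReal (k y)) z, hk.lintegral_eq]
  have e4 : ∀ y, (‖g y‖ₑ * ENNReal.ofReal (k (z - y)) ^ (1 / 2 : ℝ)) ^ (2 : ℝ) =
      ENNReal.ofReal (g y ^ 2) * ENNReal.ofReal (k (z - y)) := by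
    intro y
    rw [ENNReal.mul_rpow_of_nonneg _ _ (by norm_num), ← ENNReal.rpow_mul,
      Real.enorm_eq_ofReal_abs, ENNReal.ofReal_rpow_of_nonneg (abs_nonneg _) (by norm_num)]
    norm_num
  simp only [e4] at e2
  rw [e0]
  calc ‖convQ g k z‖ₑ ^ 2 ≤ ((∫⁻ y in Q, ENNReal.ofReal (g y ^ 2) * ENNReal.ofReal (k (z - y))) ^
        (1 / 2 : ℝ) * 1) ^ 2 := by
        gcongr
        refine e1.trans (e2.trans ?_)
        gcongr
        calc _ ≤ (1 : ℝ≥0∞) ^ (1 / 2 : ℝ) := by gcongr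
          _ = 1 := ENNReal.one_rpow _
    _ = _ := by
        rw [mul_one, ← ENNReal.rpow_natCast, ← ENNReal.rpow_mul]
        norm_num

/-- The change of variables costs (1 - 2η)^-3, and 1 - 2η ≥ 1/2. -/
lemma IsMollifier.lintegral_shrink_le {r : ℝ} (hk : IsMollifier k r) (hη1 : η ≤ 1 / 4) (y : E3) :
    ∫⁻ x in Q, ENNReal.ofReal (k (shrink η x - y)) ≤ 8 := by
  refine (setLIntegral_le_lintegral _ _).trans ?_
  set c : E3 := (WithLp.toLp 2 fun _ => η) - y with hc
  have hlam : 1 / 2 ≤ 1 - 2 * η := by linarith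
  have e : ∀ x, shrink η x - y = (1 - 2 * η) • x + c := fun x => by
    rw [shrink, hc]; abel
  simp only [e]
  have hi : Integrable fun x : E3 => k ((1 - 2 * η) • x + c) :=
    (hk.integrable.comp_add_right c).comp_smul (by linarith)
  rw [← ofReal_integral_eq_lintegral_ofReal hi (Eventually.of_forall fun x => hk.nonneg _),
    Measure.integral_comp_smul volume (fun x => k (x + c)), integral_add_right_eq_self,
    hk.integral_eq]
  rw [show (8 : ℝ≥0∞) = ENNReal.ofReal 8 by norm_num]
  refine ENNReal.ofReal_le_ofReal ?_
  have h3 : (1 / 2 : ℝ) ^ 3 ≤ (1 - 2 * η) ^ 3 := by gcongr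
  simp only [finrank_euclideanSpace, Fintype.card_fin, smul_eq_mul, mul_one]
  rw [abs_of_nonneg (inv_nonneg.2 (by positivity : (0 : ℝ) ≤ (1 - 2 * η) ^ 3))]
  rw [inv_le_comm₀ (by linarith) (by norm_num)]
  linarith

/-- The shift by η exceeds the radius η/2 of the average, so each coordinate of `y` is at least (1 -
2η) times that of `x`. Averaging thus moves no closer to the singular corner, up to this factor. -/
lemma shrink_norm_le (hη : 0 < η) (hη1 : η ≤ 1 / 4) {x y : E3} (hx : x ∈ Q)
    (hxy : ‖shrink η x - y‖ ≤ η / 2) : (1 - 2 * η) * ‖x‖ ≤ ‖y‖ := by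
  have hlam : 0 ≤ 1 - 2 * η := by linarith
  refine abs_le_of_sq_le_sq' ?_ (norm_nonneg _) |>.2
  rw [mul_pow, EuclideanSpace.real_norm_sq_eq, EuclideanSpace.real_norm_sq_eq, Finset.mul_sum]
  refine Finset.sum_le_sum fun j _ => ?_
  rw [← mul_pow]
  have h1 := (abs_le.1 ((abs_coord_sub_le (x := shrink η x) (y := y) j).trans hxy)).2
  rw [shrink_apply] at h1
  have h2 := mul_nonneg hlam (hx j).1.le
  gcongr
  linarith

/-- Weighted `L²` bounds for averages over the shrunken cube. -/
lemma IsMollifier.lintegral_weighted_le (hη : 0 < η) (hη1 : η ≤ 1 / 4)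
    (hk : IsMollifier k (η / 2)) {g : E3 → ℝ} (hg : AEStronglyMeasurable g (volume.restrict Q))
    {e s : ℕ} (hes : e ≤ 2 * s) :
    ∫⁻ x in Q, ENNReal.ofReal (‖x‖ ^ e * ((1 - 2 * η) ^ s * convQ g k (shrink η x)) ^ 2) ≤
      8 * ∫⁻ y in Q, ENNReal.ofReal (‖y‖ ^ e * g y ^ 2) := by
  have hlam : 0 ≤ 1 - 2 * η := by linarith
  have hlam1 : 1 - 2 * η ≤ 1 := by linarith
  have hgm : AEMeasurable (fun y => ENNReal.ofReal (‖y‖ ^ e * g y ^ 2)) (volume.restrict Q) :=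
    ENNReal.measurable_ofReal.comp_aemeasurable
      ((measurable_norm.pow_const e).aemeasurable.mul (hg.aemeasurable.pow_const 2))
  have hkm : Measurable fun p : E3 × E3 => ENNReal.ofReal (k (shrink η p.1 - p.2)) := by
    refine ENNReal.measurable_ofReal.comp (hk.smooth.continuous.comp ?_).measurable
    exact ((contDiff_shrink η).continuous.comp continuous_fst).sub continuous_snd
  have h1 : ∀ x ∈ Q, ENNReal.ofReal (‖x‖ ^ e * ((1 - 2 * η) ^ s * convQ g k (shrink η x)) ^ 2) ≤
      ∫⁻ y in Q, ENNReal.ofReal (‖y‖ ^ e * g y ^ 2) * ENNReal.ofReal (k (shrink η x - y)) := by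
    intro x hx
    have hw : ‖x‖ ^ e * ((1 - 2 * η) ^ s * convQ g k (shrink η x)) ^ 2 =
        (‖x‖ ^ e * (1 - 2 * η) ^ (2 * s)) * convQ g k (shrink η x) ^ 2 := by
      rw [mul_pow, ← pow_mul, mul_comm s 2]; ring
    rw [hw, ENNReal.ofReal_mul (by positivity)]
    refine (mul_le_mul_right (hk.sq_convQ_le hg _) _).trans ?_
    rw [← lintegral_const_mul' _ _ ENNReal.ofReal_ne_top]
    refine lintegral_mono fun y => ?_
    rcases lt_or_ge (η / 2) ‖shrink η x - y‖ with hy | hy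
    · simp [hk.eq_zero hy]
    · rw [← mul_assoc]
      refine mul_le_mul_left ?_ _
      rw [← ENNReal.ofReal_mul (by positivity)]
      refine ENNReal.ofReal_le_ofReal (mul_le_mul_of_nonneg_right ?_ (sq_nonneg _))
      -- The factors 1 - 2η produced by differentiation pay for the change of weight; this is where
      -- `e ≤ 2 * s` is needed.
      calc ‖x‖ ^ e * (1 - 2 * η) ^ (2 * s) ≤ ‖x‖ ^ e * (1 - 2 * η) ^ e :=
            mul_le_mul_of_nonneg_left (pow_le_pow_of_le_one hlam hlam1 hes) (by positivity)
        _ = ((1 - 2 * η) * ‖x‖) ^ e := by rw [mul_pow, mul_comm]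
        _ ≤ ‖y‖ ^ e := pow_le_pow_left₀ (by positivity) (shrink_norm_le hη hη1 hx hy) e
  calc _ ≤ ∫⁻ x in Q, ∫⁻ y in Q, ENNReal.ofReal (‖y‖ ^ e * g y ^ 2) *
        ENNReal.ofReal (k (shrink η x - y)) := setLIntegral_mono' measurableSet_Q h1
    _ = ∫⁻ y in Q, ∫⁻ x in Q, ENNReal.ofReal (‖y‖ ^ e * g y ^ 2) *
        ENNReal.ofReal (k (shrink η x - y)) := by
        refine lintegral_lintegral_swap ?_
        exact hgm.comp_snd.mul hkm.aemeasurable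
    _ ≤ ∫⁻ y in Q, ENNReal.ofReal (‖y‖ ^ e * g y ^ 2) * 8 := by
        refine lintegral_mono fun y => ?_
        rw [lintegral_const_mul' _ _ ENNReal.ofReal_ne_top]
        gcongr
        exact hk.lintegral_shrink_le hη1 y
    _ = _ := by
        rw [lintegral_mul_const'' _ hgm, mul_comm]

lemma IsMollifier.eLpNorm_convQ_le (hη : 0 < η) (hη1 : η ≤ 1 / 4)
    (hk : IsMollifier k (η / 2)) {g : E3 → ℝ} (hg : AEStronglyMeasurable g (volume.restrict Q)) :
    eLpNorm (fun x => convQ g k (shrink η x)) 2 (volume.restrict Q) ≤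
      3 * eLpNorm g 2 (volume.restrict Q) := by
  rw [eLpNorm_two_le_iff, mul_pow, eLpNorm_two_sq]
  have := hk.lintegral_weighted_le hη hη1 hg (e := 0) (s := 0) le_rfl
  simp only [pow_zero, one_mul] at this
  refine this.trans ?_
  gcongr
  norm_num

lemma convQ_sub {f g : E3 → ℝ} (hf : IntegrableOn f Q) (hg : IntegrableOn g Q) {r : ℝ}
    (hk : IsMollifier k r) (z : E3) : convQ (f - g) k z = convQ f k z - convQ g k z := by
  have hi : ∀ {f : E3 → ℝ}, IntegrableOn f Q → IntegrableOn (fun y => f y * k (z - y)) Q := by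
    intro f hf
    obtain ⟨B, hB⟩ := hk.hasCompactSupport.exists_bound_of_continuous hk.smooth.continuous
    exact hf.mul_bdd (c := B) (hk.smooth.continuous.comp
      (continuous_const.sub continuous_id)).aestronglyMeasurable
      (Eventually.of_forall fun y => hB _)
  unfold convQ
  rw [← integral_sub (hi hf) (hi hg)]
  congr 1
  funext y
  simp [sub_mul]

lemma norm_shrink_sub_le (hη : 0 < η) {x : E3} (hx : x ∈ Q) : ‖shrink η x - x‖ ≤ 2 * η := by
  refine abs_le_of_sq_le_sq' ?_ (by positivity) |>.2
  rw [EuclideanSpace.real_norm_sq_eq, Fin.sum_univ_three]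
  have h : ∀ j, (shrink η x - x) j ^ 2 ≤ η ^ 2 := fun j => by
    have e : (shrink η x - x) j = η * (1 - 2 * x j) := by
      rw [PiLp.sub_apply, shrink_apply]; ring
    rw [e, mul_pow]
    have : (1 - 2 * x j) ^ 2 ≤ 1 := by nlinarith [(hx j).1, (hx j).2]
    exact mul_le_of_le_one_right (sq_nonneg _) this
  nlinarith [h 0, h 1, h 2, sq_nonneg η]

/-- The averages of a uniformly continuous function are uniformly close to it. -/
lemma IsMollifier.abs_convQ_sub_le (hη : 0 < η) (hη1 : η ≤ 1 / 4) (hk : IsMollifier k (η / 2))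
    {ψ : E3 → ℝ} (hψ : Continuous ψ) {τ : ℝ}
    (hτ : ∀ x y, ‖x - y‖ ≤ 3 * η → |ψ x - ψ y| ≤ τ) {x : E3} (hx : x ∈ Q) :
    |convQ ψ k (shrink η x) - ψ x| ≤ τ := by
  have hsub : Metric.closedBall (shrink η x) (η / 2) ⊆ Q :=
    closedBall_shrink_subset hη hη1 fun j => Set.Ioo_subset_Icc_self (hx j)
  have hkz : ∀ y, y ∉ Metric.closedBall (shrink η x) (η / 2) → k (shrink η x - y) = 0 := by
    intro y hy
    refine hk.eq_zero ?_
    rwa [Metric.mem_closedBall, dist_comm, dist_eq_norm, not_le] at hy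
  have hki : Integrable fun y => k (shrink η x - y) := hk.integrable.comp_sub_left _
  have hk1 : ∫ y, k (shrink η x - y) = 1 := by
    rw [integral_sub_left_eq_self (fun y => k y), hk.integral_eq]
  have e1 : convQ ψ k (shrink η x) = ∫ y, ψ y * k (shrink η x - y) := by
    rw [convQ]
    refine setIntegral_eq_integral_of_forall_compl_eq_zero fun y hy => ?_
    rw [hkz y fun h => hy (hsub h), mul_zero]
  have hle : ∀ y, ‖(ψ y - ψ x) * k (shrink η x - y)‖ ≤ τ * k (shrink η x - y) := by
    intro y
    by_cases hy : y ∈ Metric.closedBall (shrink η x) (η / 2)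
    · rw [norm_mul, Real.norm_eq_abs, Real.norm_eq_abs, abs_of_nonneg (hk.nonneg _)]
      refine mul_le_mul_of_nonneg_right (hτ _ _ ?_) (hk.nonneg _)
      rw [mem_closedBall_iff_norm] at hy
      have := norm_shrink_sub_le hη hx
      have h3 := norm_sub_le_norm_sub_add_norm_sub y (shrink η x) x
      linarith
    · rw [hkz y hy]; simp
  have hint : Integrable fun y => (ψ y - ψ x) * k (shrink η x - y) :=
    (hki.const_mul τ).mono' ((hψ.sub continuous_const).mul (hk.smooth.continuous.comp
      (continuous_const.sub continuous_id))).aestronglyMeasurable (Eventually.of_forall hle)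
  have e2 : convQ ψ k (shrink η x) - ψ x = ∫ y, (ψ y - ψ x) * k (shrink η x - y) := by
    have : ∀ y, ψ y * k (shrink η x - y) =
      (ψ y - ψ x) * k (shrink η x - y) + ψ x * k (shrink η x - y) := fun y => by ring
    rw [e1]
    simp only [this]
    rw [integral_add hint (hki.const_mul _), integral_const_mul, hk1]
    ring
  rw [e2, ← Real.norm_eq_abs]
  refine (norm_integral_le_of_norm_le (hki.const_mul τ) (Eventually.of_forall hle)).trans ?_
  rw [integral_const_mul, hk1, mul_one]

end

instance : IsFiniteMeasure (volume.restrict Q : Measure E3) :=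
  ⟨by rw [Measure.restrict_apply_univ, volume_Q]; exact ENNReal.one_lt_top⟩

/-- Averages over the shrunken cube converge in `L²(Q)`. -/
lemma exists_mollifier_close {f : E3 → ℝ} (hf : MemLp f 2 (volume.restrict Q)) {ε : ℝ}
    (hε : 0 < ε) : ∃ η₀ > 0, ∀ η, 0 < η → η ≤ η₀ → η ≤ 1 / 4 → ∀ k, IsMollifier k (η / 2) →
      eLpNorm (fun x => convQ f k (shrink η x) - f x) 2 (volume.restrict Q) ≤
        ENNReal.ofReal ε := by
  -- Approximation by a compactly supported continuous ψ: the average of f - ψ costs three parts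
  -- (since 8 ≤ 3²), ψ against its average one, and f - ψ itself one, hence ε/5.
  obtain ⟨ψ, hψc, hψf, hψ, hψL⟩ := hf.exists_hasCompactSupport_eLpNorm_sub_le (by norm_num)
    (ε := ENNReal.ofReal (ε / 5)) (by simpa using hε)
  have huc := hψc.uniformContinuous_of_continuous hψ
  obtain ⟨d, hd, hdψ⟩ := Metric.uniformContinuous_iff.1 huc (ε / 5) (by positivity)
  refine ⟨d / 4, by positivity, fun η hη hηd hη1 k hk => ?_⟩
  have hτ : ∀ x y, ‖x - y‖ ≤ 3 * η → |ψ x - ψ y| ≤ ε / 5 := fun x y h => by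
    have := hdψ (a := x) (b := y) (by rw [dist_eq_norm]; linarith)
    rw [Real.dist_eq] at this
    exact this.le
  have hfψ : MemLp (f - ψ) 2 (volume.restrict Q) := hf.sub hψL
  have a1 := hk.eLpNorm_convQ_le hη hη1 hfψ.1
  have a2 : eLpNorm (fun x => convQ ψ k (shrink η x) - ψ x) 2 (volume.restrict Q) ≤
      ENNReal.ofReal (ε / 5) := by
    have := eLpNorm_le_of_ae_bound (p := 2) (μ := volume.restrict Q) (C := ε / 5)
      (f := fun x => convQ ψ k (shrink η x) - ψ x) (by
        filter_upwards [ae_restrict_mem measurableSet_Q] with x hx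
        exact hk.abs_convQ_sub_le hη hη1 hψ hτ hx)
    simpa [volume_Q] using this
  have hcont : ∀ {f : E3 → ℝ}, MemLp f 2 (volume.restrict Q) → AEStronglyMeasurable
      (fun x => convQ f k (shrink η x)) (volume.restrict Q) := fun hf =>
    ((contDiff_convQ (hf.integrable (by norm_num)) hk.smooth hk.hasCompactSupport).continuous.comp
      (contDiff_shrink η).continuous).aestronglyMeasurable
  have e : (fun x => convQ f k (shrink η x) - f x) =
      ((fun x => convQ (f - ψ) k (shrink η x)) + (fun x => convQ ψ k (shrink η x) - ψ x)) -
        (f - ψ) := by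
    funext x
    simp only [Pi.add_apply, Pi.sub_apply]
    rw [convQ_sub (hf.integrable (by norm_num)) (hψL.integrable (by norm_num)) hk]
    ring
  rw [e]
  have b2 : AEStronglyMeasurable (fun x => convQ ψ k (shrink η x) - ψ x) (volume.restrict Q) :=
    (hcont hψL).sub hψL.1
  refine (eLpNorm_sub_le ((hcont hfψ).add b2) hfψ.1 (by norm_num)).trans ?_
  refine (add_le_add (eLpNorm_add_le (hcont hfψ) b2 (by norm_num)) le_rfl).trans ?_
  calc _ ≤ 3 * ENNReal.ofReal (ε / 5) + ENNReal.ofReal (ε / 5) + ENNReal.ofReal (ε / 5) := by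
        gcongr
        exact a1.trans (by gcongr)
    _ = ENNReal.ofReal ε := by
        rw [show (3 : ℝ≥0∞) = ENNReal.ofReal 3 by norm_num, ← ENNReal.ofReal_mul (by norm_num),
          ← ENNReal.ofReal_add (by positivity) (by positivity),
          ← ENNReal.ofReal_add (by positivity) (by positivity)]
        congr 1
        ring

/-- Smooth approximation in `H¹(Q)` with control of all weighted norms of derivatives. -/
theorem exists_smooth_approx {u : E3 → ℝ} {g : Fin 3 → E3 → ℝ}
    (hu : MemLp u 2 (volume.restrict Q)) (hg : ∀ i, HasWeakDeriv (Pi.single i 1) u (g i))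
    (hgL : ∀ i, MemLp (g i) 2 (volume.restrict Q)) {ε : ℝ} (hε : 0 < ε) :
    ∃ w : E3 → ℝ, ContDiff ℝ ∞ w ∧
      eLpNorm (fun x => w x - u x) 2 (volume.restrict Q) ≤ ENNReal.ofReal ε ∧
      (∀ i, eLpNorm (fun x => partialDeriv i w x - g i x) 2 (volume.restrict Q) ≤
        ENNReal.ofReal ε) ∧
      ∀ (α : Fin 3 → ℕ) (h : E3 → ℝ) (e : ℕ), HasWeakDeriv α u h → e ≤ 2 * ∑ i, α i →
        ∫⁻ x in Q, ENNReal.ofReal (‖x‖ ^ e * multiDeriv α w x ^ 2) ≤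
          8 * ∫⁻ x in Q, ENNReal.ofReal (‖x‖ ^ e * h x ^ 2) := by
  obtain ⟨η₁, hη₁, H₁⟩ := exists_mollifier_close hu hε
  choose η₂ hη₂ H₂ using fun i => exists_mollifier_close (hgL i) (half_pos hε)
  set M := ∑ i, (eLpNorm (g i) 2 (volume.restrict Q)).toReal with hM
  have hMi : ∀ i, (eLpNorm (g i) 2 (volume.restrict Q)).toReal ≤ M := fun i =>
    Finset.single_le_sum (f := fun i => (eLpNorm (g i) 2 (volume.restrict Q)).toReal)
      (fun _ _ => ENNReal.toReal_nonneg) (Finset.mem_univ i)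
  have hM0 : 0 ≤ M := ENNReal.toReal_nonneg.trans (hMi 0)
  -- The last condition compensates for the factor 1 - 2η that shrinking puts in front of the
  -- averaged gradient.
  obtain ⟨η, hη, hη1, hηu, hηg, hηM⟩ : ∃ η : ℝ, 0 < η ∧ η ≤ 1 / 4 ∧ η ≤ η₁ ∧ (∀ i, η ≤ η₂ i) ∧
      2 * η * M ≤ ε / 2 := by
    have h1 : ∀ᶠ η : ℝ in 𝓝[>] 0, η ≤ 1 / 4 ∧ η ≤ η₁ ∧ (∀ i, η ≤ η₂ i) ∧ 2 * η * M ≤ ε / 2 := by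
      have hle : ∀ c : ℝ, 0 < c → ∀ᶠ η : ℝ in 𝓝[>] 0, η ≤ c := fun c hc =>
        eventually_nhdsWithin_of_eventually_nhds (eventually_le_nhds hc)
      refine (hle _ (by norm_num)).and ((hle _ hη₁).and ((eventually_all.2 fun i =>
        hle _ (hη₂ i)).and ?_))
      have hc : ContinuousAt (fun η : ℝ => 2 * η * M) 0 := by fun_prop
      refine eventually_nhdsWithin_of_eventually_nhds (hc.eventually (eventually_le_nhds ?_))
      simpa using half_pos hε
    obtain ⟨η, h, hη⟩ := (h1.and self_mem_nhdsWithin).exists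
    exact ⟨η, hη, h.1, h.2.1, h.2.2.1, h.2.2.2⟩
  obtain ⟨k, hk⟩ := exists_isMollifier (half_pos hη)
  have hui : IntegrableOn u Q := hu.integrable (by norm_num)
  refine ⟨fun x => convQ u k (shrink η x), (contDiff_convQ hui hk.smooth
    hk.hasCompactSupport).comp (contDiff_shrink η), H₁ η hη hηu hη1 k hk, fun i => ?_,
    fun α h e hα he => ?_⟩
  · have e1 : (fun x => partialDeriv i (fun x => convQ u k (shrink η x)) x - g i x)
        =ᵐ[volume.restrict Q]
        ((1 - 2 * η) • fun x => convQ (g i) k (shrink η x) - g i x) - (2 * η) • g i := by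
      filter_upwards [ae_restrict_mem measurableSet_Q] with x hx
      have := multiDeriv_mollified hui (hg i) hη hη1 hk (x := x)
        fun j => Set.Ioo_subset_Icc_self (hx j)
      rw [multiDeriv_single] at this
      rw [this]
      simp
      ring
    rw [eLpNorm_congr_ae e1]
    have hm : AEStronglyMeasurable (fun x => convQ (g i) k (shrink η x) - g i x)
        (volume.restrict Q) :=
      ((contDiff_convQ ((hgL i).integrable (by norm_num)) hk.smooth
        hk.hasCompactSupport).continuous.comp
        (contDiff_shrink η).continuous).aestronglyMeasurable.sub (hgL i).1
    refine (eLpNorm_sub_le (hm.const_smul _) ((hgL i).1.const_smul _) (by norm_num)).trans ?_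
    rw [eLpNorm_const_smul, eLpNorm_const_smul, Real.enorm_eq_ofReal (by linarith),
      Real.enorm_eq_ofReal (by linarith)]
    have t1 : ENNReal.ofReal (1 - 2 * η) *
        eLpNorm (fun x => convQ (g i) k (shrink η x) - g i x) 2 (volume.restrict Q) ≤
          ENNReal.ofReal (ε / 2) := by
      calc _ ≤ 1 * ENNReal.ofReal (ε / 2) := by
            gcongr
            · exact ENNReal.ofReal_le_one.2 (by linarith)
            · exact H₂ i η hη (hηg i) hη1 k hk
        _ = _ := one_mul _
    have t2 : ENNReal.ofReal (2 * η) * eLpNorm (g i) 2 (volume.restrict Q) ≤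
        ENNReal.ofReal (ε / 2) := by
      rw [← ENNReal.ofReal_toReal (hgL i).eLpNorm_ne_top, ← ENNReal.ofReal_mul (by positivity)]
      refine ENNReal.ofReal_le_ofReal (le_trans ?_ hηM)
      have := hMi i
      gcongr
    calc _ ≤ ENNReal.ofReal (ε / 2) + ENNReal.ofReal (ε / 2) := add_le_add t1 t2
      _ = _ := by rw [← ENNReal.ofReal_add (by positivity) (by positivity), add_halves]
  · rw [setLIntegral_congr_fun measurableSet_Q (g := fun x => ENNReal.ofReal (‖x‖ ^ e *
      ((1 - 2 * η) ^ (∑ i, α i) * convQ h k (shrink η x)) ^ 2)) fun x hx => by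
        simp only
        rw [multiDeriv_mollified hui hα hη hη1 hk fun j => Set.Ioo_subset_Icc_self (hx j)]]
    exact hk.lintegral_weighted_le hη hη1 hα.locInt_deriv.aestronglyMeasurable he

end QTTApprox

namespace QTTApprox

/-! ### Weak derivatives of functions in the weighted spaces -/

lemma HasWeakDeriv.weightedNorm_eq {α : Fin 3 → ℕ} {u g : E3 → ℝ} (h : HasWeakDeriv α u g)
    (b : ℝ) : weightedNorm b α u = eLpNorm (fun x => ‖x‖ ^ b * g x) 2 (volume.restrict Q) := by
  refine le_antisymm (iInf₂_le g h) (le_iInf₂ fun g' h' => le_of_eq (eLpNorm_congr_ae ?_))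
  filter_upwards [h.ae_unique h'] with x hx
  rw [hx]

lemma exists_hasWeakDeriv {α : Fin 3 → ℕ} {u : E3 → ℝ} {b : ℝ} (h : weightedNorm b α u < ⊤) :
    ∃ g, HasWeakDeriv α u g := by
  by_contra hn
  push Not at hn
  refine h.ne ?_
  simp [weightedNorm, hn]

lemma le_rpow_half_of_sq_le {a b : ℝ≥0∞} (h : a ^ 2 ≤ b) : a ≤ b ^ (1 / 2 : ℝ) := by
  calc a = (a ^ 2) ^ (1 / 2 : ℝ) := by
        rw [← ENNReal.rpow_natCast, ← ENNReal.rpow_mul]; norm_num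
    _ ≤ _ := by gcongr

lemma weightedNorm_le_kSeminorm {α : Fin 3 → ℕ} {s : ℕ} (hα : ∑ i, α i = s) (γ : ℝ)
    (u : E3 → ℝ) : weightedNorm (s - γ) α u ≤ kSeminorm s γ u :=
  le_rpow_half_of_sq_le <| Finset.single_le_sum (f := fun α => weightedNorm (s - γ) α u ^ 2)
    (fun _ _ => zero_le) (Finset.Nat.mem_antidiagonalTuple.2 hα)

lemma weightedNorm_le_double_sum {α : Fin 3 → ℕ} {s : ℕ} (hα : ∑ i, α i ≤ s) (b : ℝ)
    (u : E3 → ℝ) : weightedNorm b α u ≤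
      (∑ k ∈ Finset.range (s + 1), ∑ α ∈ Finset.Nat.antidiagonalTuple 3 k,
        weightedNorm b α u ^ 2) ^ (1 / 2 : ℝ) :=
  le_rpow_half_of_sq_le <|
    (Finset.single_le_sum (f := fun α => weightedNorm b α u ^ 2) (fun _ _ => zero_le)
      (Finset.Nat.mem_antidiagonalTuple.2 rfl)).trans
    (Finset.single_le_sum (f := fun k => ∑ α ∈ Finset.Nat.antidiagonalTuple 3 k,
        weightedNorm b α u ^ 2) (fun _ _ => zero_le) (Finset.mem_range.2 (by omega)))

lemma HasWeakDeriv.eLpNorm_le_h1Norm {α : Fin 3 → ℕ} {u g : E3 → ℝ} (h : HasWeakDeriv α u g)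
    (hα : ∑ i, α i ≤ 1) : eLpNorm g 2 (volume.restrict Q) ≤ h1Norm u := by
  have := weightedNorm_le_double_sum hα 0 u
  rw [h.weightedNorm_eq] at this
  simpa [h1Norm] using this

lemma exists_memLp_of_h1Norm_lt_top {u : E3 → ℝ} (hu : h1Norm u < ⊤) :
    MemLp u 2 (volume.restrict Q) ∧ ∃ g : Fin 3 → E3 → ℝ,
      (∀ i, HasWeakDeriv (Pi.single i 1) u (g i)) ∧ ∀ i, MemLp (g i) 2 (volume.restrict Q) := by
  have hex : ∀ α : Fin 3 → ℕ, ∑ i, α i ≤ 1 → ∃ g, HasWeakDeriv α u g := fun α hα =>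
    exists_hasWeakDeriv ((weightedNorm_le_double_sum hα 0 u).trans_lt hu)
  obtain ⟨g₀, hg₀⟩ := hex 0 (by simp)
  have h0 := hasWeakDeriv_zero hg₀.locInt_fun
  refine ⟨⟨h0.locInt_fun.aestronglyMeasurable, (h0.eLpNorm_le_h1Norm (by simp)).trans_lt hu⟩, ?_⟩
  choose g hg using fun i : Fin 3 => hex (Pi.single i 1) (by simp)
  exact ⟨g, hg, fun i => ⟨(hg i).locInt_deriv.aestronglyMeasurable,
    ((hg i).eLpNorm_le_h1Norm (by simp)).trans_lt hu⟩⟩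

/-- A change of the exponent of the weight. -/
lemma lintegral_weight_le {g : E3 → ℝ} {s : ℕ} (hs : 2 ≤ s) {b c : ℝ} (hb : b ≤ s - 3 / 2)
    (hc : s - 3 / 2 - b ≤ c) {B : ℝ}
    (hg : eLpNorm (fun x => ‖x‖ ^ b * g x) 2 (volume.restrict Q) ≤ ENNReal.ofReal B) (hB : 0 ≤ B) :
    ∫⁻ x in Q, ENNReal.ofReal (‖x‖ ^ (2 * s - 3) * g x ^ 2) ≤
      ENNReal.ofReal ((2 ^ c * B) ^ 2) := by
  rw [eLpNorm_two_le_iff] at hg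
  have h1 : ∀ x ∈ Q, ENNReal.ofReal (‖x‖ ^ (2 * s - 3) * g x ^ 2) ≤
      ENNReal.ofReal ((2 ^ c) ^ 2) * ENNReal.ofReal ((‖x‖ ^ b * g x) ^ 2) := by
    intro x hx
    obtain ⟨hx0, hx2⟩ := Q_norm hx
    rw [← ENNReal.ofReal_mul (by positivity)]
    refine ENNReal.ofReal_le_ofReal ?_
    have e : ‖x‖ ^ (2 * s - 3) = (‖x‖ ^ (s - 3 / 2 - b) * ‖x‖ ^ b) ^ 2 := by
      rw [← Real.rpow_add hx0, ← Real.rpow_natCast, ← Real.rpow_natCast, ← Real.rpow_mul hx0.le]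
      congr 1
      push_cast [Nat.cast_sub (show 3 ≤ 2 * s by omega)]
      ring
    have h2 : ‖x‖ ^ (s - 3 / 2 - b : ℝ) ≤ 2 ^ c :=
      (Real.rpow_le_rpow hx0.le hx2.le (by linarith)).trans
        (Real.rpow_le_rpow_of_exponent_le (by norm_num) hc)
    rw [e, mul_pow, mul_pow (‖x‖ ^ b), mul_assoc]
    gcongr
  calc _ ≤ ∫⁻ x in Q, ENNReal.ofReal ((2 ^ c) ^ 2) * ENNReal.ofReal ((‖x‖ ^ b * g x) ^ 2) :=
        setLIntegral_mono' measurableSet_Q h1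
    _ = ENNReal.ofReal ((2 ^ c) ^ 2) * ∫⁻ x in Q, ENNReal.ofReal ((‖x‖ ^ b * g x) ^ 2) :=
        lintegral_const_mul' _ _ ENNReal.ofReal_ne_top
    _ ≤ ENNReal.ofReal ((2 ^ c) ^ 2) * ENNReal.ofReal B ^ 2 := by gcongr
    _ = _ := by
        rw [← ENNReal.ofReal_pow hB, ← ENNReal.ofReal_mul (by positivity), mul_pow]

/-- Functions of the Gevrey class satisfy the bounds of the class with the critical exponent, for
all orders from two on. -/
theorem MemGevreyClass.exists_critical_bounds {γ C A 𝔡 : ℝ} {u : E3 → ℝ}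
    (hu : MemGevreyClass γ C A 𝔡 u) (hγ : 3 / 2 < γ) (hC : 0 < C) (hA : 0 < A) (h𝔡 : 0 ≤ 𝔡) :
    ∃ C' A' : ℝ, 0 < C' ∧ 1 ≤ A' ∧ ∀ α : Fin 3 → ℕ, 2 ≤ ∑ i, α i → ∃ g, HasWeakDeriv α u g ∧
      ∫⁻ x in Q, ENNReal.ofReal (‖x‖ ^ (2 * (∑ i, α i) - 3) * g x ^ 2) ≤
        ENNReal.ofReal ((C' * A' ^ (∑ i, α i) * ((∑ i, α i).factorial : ℝ) ^ 𝔡) ^ 2) := by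
  -- The orders 2 ≤ s ≤ γ - 3/2 carry no seminorm bound. There are finitely many, and the full norm
  -- of the single admissible order s₀ controls them all.
  set s₀ := ⌊γ - 3 / 2⌋₊ + 1 with hs₀
  have hs₀1 : γ - 3 / 2 < s₀ := by
    have := Nat.lt_floor_add_one (γ - 3 / 2)
    rw [hs₀]; push_cast; exact this
  have hs₀2 : (s₀ : ℝ) ≤ γ - 1 / 2 := by
    have := Nat.floor_le (show 0 ≤ γ - 3 / 2 by linarith)
    rw [hs₀]; push_cast; linarith
  set J := (jNorm s₀ γ u).toReal with hJ
  have hJt := hu.jNorm_lt_top s₀ hs₀1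
  have hJ0 : 0 ≤ J := ENNReal.toReal_nonneg
  refine ⟨2 ^ γ * (C + J), max A 1, by positivity, le_max_right _ _, fun α hα => ?_⟩
  set s := ∑ i, α i with hs
  set G : ℝ := (s.factorial : ℝ) ^ 𝔡 with hG
  have hG1 : 1 ≤ G := Real.one_le_rpow (by exact_mod_cast Nat.factorial_pos s) h𝔡
  have hA1 : (1 : ℝ) ≤ max A 1 ^ s := one_le_pow₀ (le_max_right _ _)
  have hs2 : (2 : ℝ) ≤ s := by exact_mod_cast hα
  have fin : ∀ {g : E3 → ℝ} {B : ℝ}, 0 ≤ B → B ≤ (C + J) * max A 1 ^ s * G →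
      ∫⁻ x in Q, ENNReal.ofReal (‖x‖ ^ (2 * s - 3) * g x ^ 2) ≤
        ENNReal.ofReal ((2 ^ γ * B) ^ 2) →
      ∫⁻ x in Q, ENNReal.ofReal (‖x‖ ^ (2 * s - 3) * g x ^ 2) ≤
        ENNReal.ofReal ((2 ^ γ * (C + J) * max A 1 ^ s * G) ^ 2) := by
    intro g B hB0 hB h
    refine h.trans (ENNReal.ofReal_le_ofReal ?_)
    refine pow_le_pow_left₀ (by positivity) ?_ 2
    calc 2 ^ γ * B ≤ 2 ^ γ * ((C + J) * max A 1 ^ s * G) := by gcongr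
      _ = _ := by ring
  rcases lt_or_ge (γ - 3 / 2) s with h | h
  · have h1 := (weightedNorm_le_kSeminorm (α := α) rfl γ u).trans (hu.kSeminorm_le s h)
    obtain ⟨g, hg⟩ := exists_hasWeakDeriv (h1.trans_lt ENNReal.ofReal_lt_top)
    rw [hg.weightedNorm_eq] at h1
    refine ⟨g, hg, fin (B := C * A ^ s * G) (by positivity) ?_ (lintegral_weight_le hα
      (by linarith) (by linarith) h1 (by positivity))⟩
    have : A ^ s ≤ max A 1 ^ s := pow_le_pow_left₀ hA.le (le_max_left _ _) s
    gcongr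
    linarith
  -- The weight exponent s₀ - γ is at most -1/2, below s - 3/2, so passing to the critical weight is
  -- again a weakening.
  · have hss : s ≤ s₀ := by
      have : (s : ℝ) < s₀ := h.trans_lt hs₀1
      exact_mod_cast this.le
    have h1 : weightedNorm (s₀ - γ) α u ≤ jNorm s₀ γ u := weightedNorm_le_double_sum hss _ u
    obtain ⟨g, hg⟩ := exists_hasWeakDeriv (h1.trans_lt hJt)
    rw [hg.weightedNorm_eq, ← ENNReal.ofReal_toReal hJt.ne] at h1
    refine ⟨g, hg, fin (B := J) hJ0 ?_ (lintegral_weight_le hα (by linarith) (by linarith) h1 hJ0)⟩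
    have h2 : J ≤ C + J := by linarith
    have h3 : (1 : ℝ) ≤ max A 1 ^ s * G := one_le_mul_of_one_le_of_one_le hA1 hG1
    calc J ≤ (C + J) * 1 := by linarith
      _ ≤ (C + J) * (max A 1 ^ s * G) := by gcongr
      _ = _ := by ring

end QTTApprox

namespace QTTApprox

/-! ### Traces on the faces -/

/-- The open unit square. -/
def unitSquare : Set (Fin 2 → ℝ) := {y | ∀ j, y j ∈ Set.Ioo (0 : ℝ) 1}

lemma unitSquare_eq_pi : unitSquare = Set.pi Set.univ fun _ => Set.Ioo (0 : ℝ) 1 := by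
  ext y; simp [unitSquare]

lemma measurableSet_unitSquare : MeasurableSet unitSquare := by
  rw [unitSquare_eq_pi]
  exact MeasurableSet.univ_pi fun _ => measurableSet_Ioo

lemma continuous_facePoint (i : Fin 3) : Continuous (facePoint i) :=
  (PiLp.continuous_toLp 2 _).comp (continuous_const.finInsertNth i continuous_id)

lemma lintegral_Q_eq (i : Fin 3) {F : E3 → ℝ≥0∞} (hF : Measurable F) :
    ∫⁻ x in Q, F x = ∫⁻ y in unitSquare, ∫⁻ t in Set.Ioo (0 : ℝ) 1,
      F (WithLp.toLp 2 (i.insertNth (α := fun _ => ℝ) t y)) := by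
  have hm := PiLp.volume_preserving_ofLp (Fin 3)
  have hFm : Measurable fun z : Fin 3 → ℝ => F (WithLp.toLp 2 z) :=
    hF.comp (PiLp.volume_preserving_toLp (Fin 3)).measurable
  have hpi : MeasurableSet (Set.pi Set.univ fun _ : Fin 3 => Set.Ioo (0 : ℝ) 1) :=
    MeasurableSet.univ_pi fun i => measurableSet_Ioo
  have e1 : ∫⁻ x in Q, F x = ∫⁻ z in Set.pi Set.univ fun _ : Fin 3 => Set.Ioo (0 : ℝ) 1,
      F (WithLp.toLp 2 z) := by
    have hQ : Q = WithLp.ofLp ⁻¹' (Set.pi Set.univ fun _ : Fin 3 => Set.Ioo (0 : ℝ) 1) := by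
      ext x; simp [Q]
    rw [hQ, ← hm.setLIntegral_comp_preimage hpi hFm]
  have hs := (volume_preserving_piFinSuccAbove (fun _ : Fin 3 => ℝ) i).symm
  have hpre : (MeasurableEquiv.piFinSuccAbove (fun _ : Fin 3 => ℝ) i).symm ⁻¹'
      (Set.pi Set.univ fun _ : Fin 3 => Set.Ioo (0 : ℝ) 1) = Set.Ioo (0 : ℝ) 1 ×ˢ unitSquare := by
    ext p
    simp only [Set.mem_preimage, Set.mem_pi, Set.mem_univ, true_implies, Set.mem_prod, unitSquare,
      Set.mem_ofPred_eq]
    rw [i.forall_iff_succAbove]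
    simp [MeasurableEquiv.piFinSuccAbove, Fin.insertNthEquiv]
  rw [e1, ← hs.setLIntegral_comp_preimage hpi hFm, hpre, Measure.volume_eq_prod]
  exact setLIntegral_prod_symm _ (hFm.comp
    (MeasurableEquiv.piFinSuccAbove (fun _ : Fin 3 => ℝ) i).symm.measurable).aemeasurable

/-- The trace inequality for smooth functions. -/
lemma lintegral_face_le {G : E3 → ℝ} (hG : ContDiff ℝ ∞ G) (i : Fin 3) :
    ∫⁻ y in unitSquare, ENNReal.ofReal (G (facePoint i y) ^ 2) ≤
      2 * (∫⁻ x in Q, ENNReal.ofReal (G x ^ 2)) +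
        2 * ∫⁻ x in Q, ENNReal.ofReal (partialDeriv i G x ^ 2) := by
  have hG' := contDiff_partialDeriv hG i
  have hm1 : Measurable fun x => ENNReal.ofReal (G x ^ 2) :=
    ENNReal.measurable_ofReal.comp (hG.continuous.pow 2).measurable
  have e : 2 * (∫⁻ x in Q, ENNReal.ofReal (G x ^ 2)) +
        2 * (∫⁻ x in Q, ENNReal.ofReal (partialDeriv i G x ^ 2)) =
      ∫⁻ x in Q, ENNReal.ofReal (2 * G x ^ 2 + 2 * partialDeriv i G x ^ 2) := by
    rw [← lintegral_const_mul' _ _ (by norm_num), ← lintegral_const_mul' _ _ (by norm_num),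
      ← lintegral_add_left (hm1.const_mul 2)]
    refine lintegral_congr fun x => ?_
    rw [ENNReal.ofReal_add (by positivity) (by positivity), ENNReal.ofReal_mul (by norm_num),
      ENNReal.ofReal_mul (by norm_num)]
    simp
  have hm2 : Measurable fun x => ENNReal.ofReal (2 * G x ^ 2 + 2 * partialDeriv i G x ^ 2) :=
    ENNReal.measurable_ofReal.comp (((hG.continuous.pow 2).const_mul
      2).add ((hG'.continuous.pow 2).const_mul 2)).measurable
  rw [e, lintegral_Q_eq i hm2]
  refine setLIntegral_mono' measurableSet_unitSquare fun y _ => ?_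
  set z : Fin 3 → ℝ := i.insertNth (α := fun _ => ℝ) 1 y with hz
  have hcont : ∀ g : E3 → ℝ, ContDiff ℝ ∞ g →
      Continuous fun t : ℝ => g (WithLp.toLp 2 (Function.update z i t)) := fun g hg =>
    continuous_iff_continuousAt.2 fun t => (hasDerivAt_update_line hg z i t).continuousAt
  -- The one-dimensional Sobolev inequality at the endpoint of the unit segment normal to the face.
  have h1 := sq_le_integral (fun t => hasDerivAt_update_line hG z i t) (hcont _ hG')
    (a := 0) (η := 1) (y := 1) one_pos (by simp)
  have hz1 : Function.update z i 1 = z := by rw [hz, Fin.update_insertNth]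
  rw [hz1] at h1
  refine (ENNReal.ofReal_le_ofReal h1).trans (le_of_eq ?_)
  have hc : Continuous fun t : ℝ => 2 / 1 * G (WithLp.toLp 2 (Function.update z i t)) ^ 2 +
      2 * 1 * partialDeriv i G (WithLp.toLp 2 (Function.update z i t)) ^ 2 :=
    (((hcont _ hG).pow 2).const_mul _).add (((hcont _ hG').pow 2).const_mul _)
  rw [intervalIntegral.integral_of_le (by norm_num), zero_add,
    integral_Ioc_eq_integral_Ioo, ofReal_integral_eq_lintegral_ofReal
      (hc.integrableOn_Icc.mono_set Set.Ioo_subset_Icc_self)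
      (Eventually.of_forall fun t => by positivity)]
  refine lintegral_congr fun t => ?_
  rw [hz, Fin.update_insertNth, div_one, mul_one]

lemma hasWeakDeriv_of_contDiff {φ : E3 → ℝ} (hφ : ContDiff ℝ ∞ φ) (i : Fin 3) :
    HasWeakDeriv (Pi.single i 1) φ (partialDeriv i φ) where
  locInt_fun := hφ.continuous.locallyIntegrable.locallyIntegrableOn _
  locInt_deriv := (contDiff_partialDeriv hφ i).continuous.locallyIntegrable.locallyIntegrableOn _
  integral_eq ψ hψ hc hs := by
    have hψ' := contDiff_partialDeriv hψ i
    have hφ' := contDiff_partialDeriv hφ i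
    have hc' := hasCompactSupport_partialDeriv hc i
    have key := integral_mul_fderiv_eq_neg_fderiv_mul_of_integrable (μ := (volume : Measure E3))
      (f := φ) (g := ψ) (v := unitVec i)
      ((hφ'.continuous.mul hψ.continuous).integrable_of_hasCompactSupport hc.mul_left)
      ((hφ.continuous.mul hψ'.continuous).integrable_of_hasCompactSupport hc'.mul_left)
      ((hφ.continuous.mul hψ.continuous).integrable_of_hasCompactSupport hc.mul_left)
      (fun x _ => (hφ.differentiable (by simp)) x) (fun x _ => (hψ.differentiable (by simp)) x)
    rw [multiDeriv_single, setIntegral_eq_integral_of_forall_compl_eq_zero,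
      setIntegral_eq_integral_of_forall_compl_eq_zero]
    · simpa [partialDeriv] using key
    · intro x hx
      have : ψ x = 0 := image_eq_zero_of_notMem_tsupport fun h => hx (hs h)
      simp [this]
    · intro x hx
      have : partialDeriv i ψ x = 0 := image_eq_zero_of_notMem_tsupport
        fun h => hx (hs (tsupport_partialDeriv _ _ h))
      simp [this]

/-- Smooth functions close to a function with zero trace have a small trace. -/
lemma MemH1Gamma.eLpNorm_face_le {u : E3 → ℝ} (hu : MemH1Gamma u) {g : Fin 3 → E3 → ℝ}
    (hg : ∀ i, HasWeakDeriv (Pi.single i 1) u (g i)) {w : E3 → ℝ} (hw : ContDiff ℝ ∞ w) {ε : ℝ}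
    (hε : 0 < ε) (h0 : eLpNorm (fun x => w x - u x) 2 (volume.restrict Q) ≤ ENNReal.ofReal ε)
    (h1 : ∀ i, eLpNorm (fun x => partialDeriv i w x - g i x) 2 (volume.restrict Q) ≤
      ENNReal.ofReal ε) (i : Fin 3) :
    eLpNorm (fun y => w (facePoint i y)) 2 (volume.restrict unitSquare) ≤
      ENNReal.ofReal (5 * ε) := by
  obtain ⟨φ, hφ, hφu, hφΓ⟩ := hu.trace_eq_zero
  have hε' : 0 < ENNReal.ofReal ε := ENNReal.ofReal_pos.2 hε
  -- One φ n that is ε-close to u in H¹ and has trace at most ε. Then w - φ n and its derivative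
  -- have norm at most 2ε, its trace is at most 4ε, and φ n adds ε.
  obtain ⟨n, hn1, hn2⟩ := ((hφu.eventually_le_const hε').and
    ((hφΓ i).eventually_le_const hε')).exists
  set ψ := φ n with hψ
  have hψs : ContDiff ℝ ∞ ψ := hφ n
  have hψc : LocallyIntegrableOn ψ Q := hψs.continuous.locallyIntegrable.locallyIntegrableOn _
  have b0 : eLpNorm (u - ψ) 2 (volume.restrict Q) ≤ ENNReal.ofReal ε :=
    ((hasWeakDeriv_zero ((hg i).locInt_fun.sub hψc)).eLpNorm_le_h1Norm (by simp)).trans hn1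
  have b1 : eLpNorm (g i - partialDeriv i ψ) 2 (volume.restrict Q) ≤ ENNReal.ofReal ε :=
    (((hg i).sub (hasWeakDeriv_of_contDiff hψs i)).eLpNorm_le_h1Norm (by simp)).trans hn1
  have hum : AEStronglyMeasurable u (volume.restrict Q) := (hg i).locInt_fun.aestronglyMeasurable
  have hgm : AEStronglyMeasurable (g i) (volume.restrict Q) :=
    (hg i).locInt_deriv.aestronglyMeasurable
  have hw' := contDiff_partialDeriv hw i
  have hψ' := contDiff_partialDeriv hψs i
  have two : ENNReal.ofReal ε + ENNReal.ofReal ε = ENNReal.ofReal (2 * ε) := by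
    rw [← ENNReal.ofReal_add hε.le hε.le, two_mul]
  have c0 : eLpNorm (w - ψ) 2 (volume.restrict Q) ≤ ENNReal.ofReal (2 * ε) := by
    have e : w - ψ = (fun x => w x - u x) + (u - ψ) := by funext x; simp
    rw [e, ← two]
    exact (eLpNorm_add_le (hw.continuous.aestronglyMeasurable.sub hum)
      (hum.sub hψs.continuous.aestronglyMeasurable) (by norm_num)).trans (add_le_add h0 b0)
  have hd : partialDeriv i (w - ψ) = partialDeriv i w - partialDeriv i ψ := by
    funext x
    simp only [partialDeriv, Pi.sub_apply]
    rw [fderiv_sub ((hw.differentiable (by simp)) x) ((hψs.differentiable (by simp)) x)]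
    rfl
  have c1 : eLpNorm (partialDeriv i (w - ψ)) 2 (volume.restrict Q) ≤ ENNReal.ofReal (2 * ε) := by
    have e : partialDeriv i (w - ψ) =
        (fun x => partialDeriv i w x - g i x) + (g i - partialDeriv i ψ) := by
      rw [hd]; funext x; simp
    rw [e, ← two]
    exact (eLpNorm_add_le (hw'.continuous.aestronglyMeasurable.sub hgm)
      (hgm.sub hψ'.continuous.aestronglyMeasurable) (by norm_num)).trans (add_le_add (h1 i) b1)
  rw [eLpNorm_two_le_iff] at c0 c1
  have c2 : eLpNorm (fun y => (w - ψ) (facePoint i y)) 2 (volume.restrict unitSquare) ≤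
      ENNReal.ofReal (4 * ε) := by
    rw [eLpNorm_two_le_iff]
    refine (lintegral_face_le (hw.sub hψs) i).trans ?_
    refine (add_le_add (mul_le_mul_right c0 2) (mul_le_mul_right c1 2)).trans (le_of_eq ?_)
    rw [← ENNReal.ofReal_pow (by positivity), ← ENNReal.ofReal_pow (by positivity),
      show (2 : ℝ≥0∞) = ENNReal.ofReal 2 by norm_num, ← ENNReal.ofReal_mul (by norm_num),
      ← ENNReal.ofReal_add (by positivity) (by positivity)]
    congr 1
    ring
  have e : (fun y => w (facePoint i y)) =
      (fun y => (w - ψ) (facePoint i y)) + fun y => ψ (facePoint i y) := by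
    funext y; simp
  rw [e]
  refine (eLpNorm_add_le
    ((hw.continuous.sub hψs.continuous).comp (continuous_facePoint i)).aestronglyMeasurable
    (hψs.continuous.comp (continuous_facePoint i)).aestronglyMeasurable (by norm_num)).trans
    ((add_le_add c2 hn2).trans (le_of_eq ?_))
  rw [← ENNReal.ofReal_add (by positivity) hε.le]
  congr 1
  ring

/-- On a face, the `L²` norm controls the values, given a bound for the gradient. -/
lemma HasPointwiseBounds.face_small {w : E3 → ℝ} {C A 𝔡 : ℝ} (hw : HasPointwiseBounds w C A 𝔡)
    (hC : 0 < C) {δ ε τ : ℝ} (hδ : 0 < δ) (hτ : 0 < τ) (hτ1 : τ ≤ 1) (hτC : 6 * C * τ ≤ δ)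
    (hε : 2 * ε < τ * δ) (hε0 : 0 ≤ ε) {i : Fin 3}
    (h : eLpNorm (fun y => w (facePoint i y)) 2 (volume.restrict unitSquare) ≤ ENNReal.ofReal ε)
    {p : E3} (hp : ∀ j, p j ∈ Set.Icc (0 : ℝ) 1) (hpi : p i = 1) : |w p| ≤ δ := by
  by_contra hcon
  push Not at hcon
  -- A square of side τ in the face, pushed inwards by `min` where necessary and within distance τ
  -- of `p`. There the gradient is at most C, so |w| > δ would force |w| ≥ δ/2 on the square and an
  -- L² norm of at least τδ/2 > ε.
  set a : Fin 2 → ℝ := fun j => min (p (i.succAbove j)) (1 - τ) with ha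
  have ha0 : ∀ j, 0 ≤ a j := fun j => le_min (hp _).1 (by linarith)
  have ha1 : ∀ j, a j + τ ≤ 1 := fun j => by
    have := min_le_right (p (i.succAbove j)) (1 - τ)
    simp only [ha]; linarith
  set S : Set (Fin 2 → ℝ) := Set.pi Set.univ fun j => Set.Ioo (a j) (a j + τ) with hS
  have hSm : MeasurableSet S := MeasurableSet.univ_pi fun _ => measurableSet_Ioo
  have hSsub : S ⊆ unitSquare := fun y hy j => by
    have := hy j (Set.mem_univ _)
    exact ⟨(ha0 j).trans_lt this.1, this.2.trans_le (ha1 j)⟩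
  have hvol : volume S = ENNReal.ofReal (τ ^ 2) := by
    rw [hS, Real.volume_pi_Ioo]
    simp [sq, ENNReal.ofReal_mul hτ.le]
  have hlow : ∀ y ∈ S, ENNReal.ofReal ((δ / 2) ^ 2) ≤ ENNReal.ofReal (w (facePoint i y) ^ 2) := by
    intro y hy
    have hf1 : ∀ j, facePoint i y j ∈ Set.Icc (0 : ℝ) 1 := by
      rw [i.forall_iff_succAbove]
      refine ⟨by simp [facePoint], fun j => ?_⟩
      have := hSsub hy j
      simpa [facePoint] using ⟨this.1.le, this.2.le⟩
    have hfi : facePoint i y i = 1 := by simp [facePoint]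
    have hdist : ∀ j, |p j - facePoint i y j| ≤ τ := by
      rw [i.forall_iff_succAbove]
      refine ⟨by rw [hpi, hfi]; simpa using hτ.le, fun j => ?_⟩
      have hy' := hy j (Set.mem_univ _)
      have e : facePoint i y (i.succAbove j) = y j := by simp [facePoint]
      rw [e, abs_le]
      have h1 := min_le_left (p (i.succAbove j)) (1 - τ)
      have h2 : p (i.succAbove j) ≤ a j + τ := by
        rcases le_total (p (i.succAbove j)) (1 - τ) with hle | hle
        · simp only [ha, min_eq_left hle]; linarith
        · simp only [ha, min_eq_right hle]; linarith [(hp (i.succAbove j)).2]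
      have hy1 := hy'.1
      have hy2 := hy'.2
      simp only [ha] at hy1 hy2 h2
      constructor <;> linarith
    have hd := hw.abs_sub_le hC.le hp hf1 (i := i) (ρ := 1) one_pos (by rw [hpi]) (by rw [hfi])
      hdist
    have h3 : |w p| ≤ |w p - w (facePoint i y)| + |w (facePoint i y)| := by
      have := abs_add_le (w p - w (facePoint i y)) (w (facePoint i y))
      simpa using this
    refine ENNReal.ofReal_le_ofReal ?_
    rw [← sq_abs (w (facePoint i y))]
    refine pow_le_pow_left₀ (by positivity) ?_ 2
    rw [div_one] at hd
    linarith
  rw [eLpNorm_two_le_iff] at h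
  have h1 : ENNReal.ofReal ((δ / 2) ^ 2) * ENNReal.ofReal (τ ^ 2) ≤ ENNReal.ofReal ε ^ 2 := by
    calc _ = ∫⁻ _ in S, ENNReal.ofReal ((δ / 2) ^ 2) := by rw [setLIntegral_const, hvol]
      _ ≤ ∫⁻ y in S, ENNReal.ofReal (w (facePoint i y) ^ 2) := setLIntegral_mono' hSm hlow
      _ ≤ ∫⁻ y in unitSquare, ENNReal.ofReal (w (facePoint i y) ^ 2) := lintegral_mono_set hSsub
      _ ≤ _ := h
  rw [← ENNReal.ofReal_mul (by positivity), ← ENNReal.ofReal_pow hε0, ← mul_pow,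
    ENNReal.ofReal_le_ofReal_iff (by positivity)] at h1
  have h2 := abs_le_of_sq_le_sq h1 hε0
  rw [abs_of_pos (by positivity)] at h2
  linarith

/-- Approximation in `H¹(Q)` by smooth functions with uniform pointwise bounds for the derivatives
and small values on the faces. -/
theorem exists_pointwise_approx {γ C A 𝔡 : ℝ} {u : E3 → ℝ} (hu : MemGevreyClass γ C A 𝔡 u)
    (hγ : 3 / 2 < γ) (hC : 0 < C) (hA : 0 < A) (h𝔡 : 1 ≤ 𝔡) (huΓ : MemH1Gamma u)
    {g : Fin 3 → E3 → ℝ} (hg : ∀ i, HasWeakDeriv (Pi.single i 1) u (g i)) :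
    ∃ C₁ A₁ : ℝ, 0 < C₁ ∧ 1 ≤ A₁ ∧ ∀ δ : ℝ, 0 < δ → ∃ w, HasPointwiseBounds w C₁ A₁ 𝔡 ∧
      eLpNorm (fun x => w x - u x) 2 (volume.restrict Q) ≤ ENNReal.ofReal δ ∧
      (∀ i, eLpNorm (fun x => partialDeriv i w x - g i x) 2 (volume.restrict Q) ≤
        ENNReal.ofReal δ) ∧
      ∀ p : E3, (∀ j, p j ∈ Set.Icc (0 : ℝ) 1) → ∀ i, p i = 1 → |w p| ≤ δ := by
  have hMu : MemLp u 2 (volume.restrict Q) := (exists_memLp_of_h1Norm_lt_top huΓ.h1Norm_lt_top).1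
  have hgt : ∀ i, eLpNorm (g i) 2 (volume.restrict Q) < ⊤ := fun i =>
    ((hg i).eLpNorm_le_h1Norm (by simp)).trans_lt huΓ.h1Norm_lt_top
  have hgL : ∀ i, MemLp (g i) 2 (volume.restrict Q) := fun i =>
    ⟨(hg i).locInt_deriv.aestronglyMeasurable, hgt i⟩
  obtain ⟨C', A', hC', hA', hcrit⟩ := hu.exists_critical_bounds hγ hC hA (by linarith)
  choose! G hG hGb using hcrit
  set M := (h1Norm u).toReal with hM
  have hM0 : 0 ≤ M := ENNReal.toReal_nonneg
  -- The constants are fixed before δ, because mollification worsens every weighted bound by the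
  -- same factor 3 (8 ≤ 3²).
  obtain ⟨C₁, A₁, hC₁, hA₁, H⟩ := exists_pointwiseBounds (C := 3 * C') (A := A') (𝔡 := 𝔡)
    (M := 3 * M) (by positivity) hA' h𝔡 (by positivity)
  refine ⟨C₁, A₁, hC₁, hA₁, fun δ hδ => ?_⟩
  set τ := min 1 (δ / (6 * C₁)) with hτ
  have hτ0 : 0 < τ := lt_min one_pos (by positivity)
  have hτC : 6 * C₁ * τ ≤ δ := by
    calc 6 * C₁ * τ ≤ 6 * C₁ * (δ / (6 * C₁)) := by gcongr; exact min_le_right _ _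
      _ = δ := by field_simp
  -- The trace of `w` is at most 5ε and `HasPointwiseBounds.face_small` requires 2 · 5ε < τδ; the
  -- divisor 20 leaves a factor of two.
  set ε := min δ (τ * δ / 20) with hε
  have hε0 : 0 < ε := lt_min hδ (by positivity)
  have hετ : ε ≤ τ * δ / 20 := min_le_right _ _
  have hεδ : ENNReal.ofReal ε ≤ ENNReal.ofReal δ := ENNReal.ofReal_le_ofReal (min_le_left _ _)
  obtain ⟨w, hw, hw0, hw1, hwb⟩ := exists_smooth_approx hMu hg hgL hε0
  have h8 : (8 : ℝ≥0∞) ≤ ENNReal.ofReal (3 ^ 2) := by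
    rw [show (8 : ℝ≥0∞) = ENNReal.ofReal 8 by norm_num]
    exact ENNReal.ofReal_le_ofReal (by norm_num)
  have hbd : HasL2Bounds w (fun s => 3 * C' * A' ^ s * (s.factorial : ℝ) ^ 𝔡) (3 * M) := by
    refine ⟨hw, fun α hα => ?_, fun i => ?_⟩
    · refine (hwb α (G α) _ (hG α hα) (by omega)).trans ?_
      refine (mul_le_mul' h8 (hGb α hα)).trans (le_of_eq ?_)
      rw [← ENNReal.ofReal_mul (by positivity), ← mul_pow]
      congr 2
      ring
    · have h1 := hwb _ (g i) 0 (hg i) (by simp)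
      simp only [multiDeriv_single, pow_zero, one_mul] at h1
      refine h1.trans ?_
      rw [← eLpNorm_two_sq]
      have h2 : eLpNorm (g i) 2 (volume.restrict Q) ≤ ENNReal.ofReal M := by
        rw [hM, ENNReal.ofReal_toReal huΓ.h1Norm_lt_top.ne]
        exact (hg i).eLpNorm_le_h1Norm (by simp)
      calc _ ≤ ENNReal.ofReal (3 ^ 2) * ENNReal.ofReal M ^ 2 := by gcongr
        _ = _ := by
            rw [← ENNReal.ofReal_pow hM0, ← ENNReal.ofReal_mul (by positivity), ← mul_pow]
  have hpw := H w hbd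
  refine ⟨w, hpw, hw0.trans hεδ, fun i => (hw1 i).trans hεδ, fun p hp i hpi => ?_⟩
  exact hpw.face_small hC₁ hδ hτ0 (min_le_left _ _) hτC (ε := 5 * ε)
    (by nlinarith [mul_pos hτ0 hδ]) (by positivity)
    (huΓ.eLpNorm_face_le hg hw hε0 hw0 hw1 i) hp hpi

end QTTApprox

namespace QTTApprox

/-! ### The approximation and its number of degrees of freedom -/

/-- Nodes off Γ have the Taylor error. At nodes on Γ the coefficient is 0, and `w` is at most δ
there. The origin fits by the definition of `blockTaylor`. -/
lemma isNodalApprox_blockTaylor {w : E3 → ℝ} {C A 𝔡 : ℝ} (hw : HasPointwiseBounds w C A 𝔡)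
    (hC : 0 ≤ C) (hA : 0 ≤ A) {ℓ K s : ℕ} (hs : 2 ≤ s) {δ : ℝ}
    (hin : C * (3 * A / 2 ^ K) ^ s * ((s.factorial : ℝ) ^ 𝔡 / s.factorial) ≤ δ)
    (hΓ : ∀ p : E3, (∀ j, p j ∈ Set.Icc (0 : ℝ) 1) → ∀ i, p i = 1 → |w p| ≤ δ) :
    IsNodalApprox w ℓ (blockTaylor w ℓ K s) δ where
  zero := by
    have : pt ℓ (Pi.single 0 1) = node ℓ 1 0 0 := by simp [pt]
    simp [nodeVal, extendZero, blockTaylor, this]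
  approx p hp0 hp := by
    by_cases h : ∀ j, p j < 2 ^ ℓ
    · have hmax : max (p 0) (max (p 1) (p 2)) ≠ 0 := by
        intro hm
        simp only [Nat.max_eq_zero_iff] at hm
        refine hp0 (funext fun j => ?_)
        fin_cases j
        exacts [hm.1, hm.2.1, hm.2.2]
      have := (blockTaylor_error hw hC hA (K := K) hs (h 0) (h 1) (h 2) hmax).trans hin
      simpa [nodeVal, extendZero, h, pt] using this
    · have hz : nodeVal ℓ (blockTaylor w ℓ K s) p = 0 := by
        rw [nodeVal, extendZero, if_neg]
        rintro ⟨h0, h1, h2⟩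
        refine h fun j => ?_
        fin_cases j <;> assumption
      push Not at h
      obtain ⟨j, hj⟩ := h
      rw [hz, zero_sub, abs_neg]
      refine hΓ _ (fun q => ?_) j ?_
      · rw [pt_apply]
        refine ⟨by positivity, ?_⟩
        rw [div_le_one (by positivity)]
        have hq : ((p q : ℕ) : ℝ) ≤ ((2 ^ ℓ : ℕ) : ℝ) := Nat.cast_le.2 (hp q)
        simpa using hq
      · rw [pt_apply, le_antisymm (hp j) hj]
        push_cast
        exact div_self (by positivity)

lemma factorial_rpow_div_le {s : ℕ} {𝔡 : ℝ} (h𝔡 : 1 ≤ 𝔡) :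
    (s.factorial : ℝ) ^ 𝔡 / s.factorial ≤ ((s : ℝ) ^ (𝔡 - 1)) ^ s := by
  have hf : (0 : ℝ) < s.factorial := by exact_mod_cast s.factorial_pos
  rw [← Real.rpow_sub_one hf.ne', ← Real.rpow_natCast, ← Real.rpow_mul (by positivity),
    mul_comm (𝔡 - 1), Real.rpow_mul (by positivity), Real.rpow_natCast]
  refine Real.rpow_le_rpow hf.le ?_ (by linarith)
  exact_mod_cast Nat.factorial_le_pow s

/-- The factorial excess (s!)^(𝔡-1) is at most s^((𝔡-1)s), so a block ratio 2^-K below a multiple of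
s^(1-𝔡) leaves geometric decay. -/
lemma taylor_factor_le {A 𝔡 : ℝ} (hA : 0 ≤ A) (h𝔡 : 1 ≤ 𝔡) {s K : ℕ}
    (hK : 6 * A * (s : ℝ) ^ (𝔡 - 1) ≤ 2 ^ K) :
    (3 * A / 2 ^ K) ^ s * ((s.factorial : ℝ) ^ 𝔡 / s.factorial) ≤ (1 / 2) ^ s := by
  calc _ ≤ (3 * A / 2 ^ K) ^ s * ((s : ℝ) ^ (𝔡 - 1)) ^ s := by
        gcongr
        exact factorial_rpow_div_le h𝔡
    _ = (3 * A * (s : ℝ) ^ (𝔡 - 1) / 2 ^ K) ^ s := by rw [← mul_pow]; ring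
    _ ≤ _ := by
        refine pow_le_pow_left₀ (by positivity) ?_ s
        rw [div_le_div_iff₀ (by positivity) (by norm_num)]
        linarith

/-- The approximation error in terms of the refinement level. -/
theorem exists_feFun_approx {γ C A 𝔡 : ℝ} {u : E3 → ℝ} (hu : MemGevreyClass γ C A 𝔡 u)
    (hγ : 3 / 2 < γ) (hC : 0 < C) (hA : 0 < A) (h𝔡 : 1 ≤ 𝔡) (huΓ : MemH1Gamma u) :
    ∃ c A₁ : ℝ, 0 < c ∧ 1 ≤ A₁ ∧ ∀ ℓ K : ℕ, 1 ≤ ℓ →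
      6 * A₁ * ((2 * ℓ : ℕ) : ℝ) ^ (𝔡 - 1) ≤ 2 ^ K → ∃ w : E3 → ℝ, ContDiff ℝ ∞ w ∧
        h1Norm (u - feFun ℓ (blockTaylor w ℓ K (2 * ℓ))) ≤
          ENNReal.ofReal (c * ((2 ^ ℓ)⁻¹ : ℝ) ^ (1 / 4 : ℝ)) := by
  obtain ⟨hMu, g, hg, hgL⟩ := exists_memLp_of_h1Norm_lt_top huΓ.h1Norm_lt_top
  obtain ⟨C₁, A₁, hC₁, hA₁, happ⟩ := exists_pointwise_approx hu hγ hC hA h𝔡 huΓ hg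
  obtain ⟨K₀, hK₀, hint⟩ := exists_interpolation_bound
  refine ⟨2 * ((K₀ + 3) * C₁), A₁, by positivity, hA₁, fun ℓ K hℓ hK => ?_⟩
  set h : ℝ := (2 ^ ℓ)⁻¹ with hh
  have hh0 : 0 < h := by positivity
  have hh1 : h ≤ 1 := inv_le_one_of_one_le₀ (one_le_pow₀ (by norm_num))
  have hpow : ((1 : ℝ) / 2) ^ (2 * ℓ) = h ^ 2 := by
    rw [hh, pow_mul', one_div, inv_pow]
  have hδ0 : 0 < C₁ * h ^ 2 := by positivity
  -- Accuracy of order h² because differentiating the interpolant multiplies nodal errors by 2/h.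
  -- The degree bound 2ℓ matches it, as (1/2)^(2ℓ) = h².
  obtain ⟨w, hw, hw0, hw1, hwΓ⟩ := happ (C₁ * h ^ 2) hδ0
  refine ⟨w, hw.smooth, ?_⟩
  set V := blockTaylor w ℓ K (2 * ℓ) with hV
  have hnod : IsNodalApprox w ℓ V (C₁ * h ^ 2) := by
    refine isNodalApprox_blockTaylor hw hC₁.le (by linarith) (by omega) ?_ hwΓ
    rw [mul_assoc, ← hpow]
    gcongr
    exact taylor_factor_le (by linarith) h𝔡 hK
  obtain ⟨hi0, hi1⟩ := hint hw hC₁.le hδ0.le hnod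
  set q := h ^ (1 / 4 : ℝ) with hq
  have hhq : h ≤ q := by
    have := Real.rpow_le_rpow_of_exponent_ge hh0 hh1 (show (1 / 4 : ℝ) ≤ 1 by norm_num)
    rwa [Real.rpow_one] at this
  have hsum : K₀ * C₁ * q + 2 * 2 ^ ℓ * (C₁ * h ^ 2) + C₁ * h ^ 2 ≤ (K₀ + 3) * C₁ * q := by
    have e1 : (2 : ℝ) ^ ℓ * h = 1 := mul_inv_cancel₀ (by positivity)
    have e2 : 2 * 2 ^ ℓ * (C₁ * h ^ 2) = 2 * C₁ * h * (2 ^ ℓ * h) := by ring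
    have e3 : h ^ 2 ≤ h := by nlinarith
    rw [e2, e1]
    nlinarith [mul_le_mul_of_nonneg_left hhq hC₁.le, mul_le_mul_of_nonneg_left e3 hC₁.le]
  have hcomb : ∀ {f₁ f₂ f₃ : E3 → ℝ}, AEStronglyMeasurable f₁ (volume.restrict Q) →
      AEStronglyMeasurable f₂ (volume.restrict Q) → AEStronglyMeasurable f₃ (volume.restrict Q) →
      eLpNorm (fun x => f₃ x - f₂ x) 2 (volume.restrict Q) ≤
        ENNReal.ofReal (K₀ * C₁ * q + 2 * 2 ^ ℓ * (C₁ * h ^ 2)) →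
      eLpNorm (fun x => f₂ x - f₁ x) 2 (volume.restrict Q) ≤ ENNReal.ofReal (C₁ * h ^ 2) →
      eLpNorm (f₁ - f₃) 2 (volume.restrict Q) ≤ ENNReal.ofReal ((K₀ + 3) * C₁ * q) := by
    intro f₁ f₂ f₃ m1 m2 m3 h32 h21
    rw [eLpNorm_sub_comm]
    have e : f₃ - f₁ = (fun x => f₃ x - f₂ x) + fun x => f₂ x - f₁ x := by funext x; simp
    rw [e]
    refine (eLpNorm_add_le (m3.sub m2) (m2.sub m1) (by norm_num)).trans ?_
    refine (add_le_add h32 h21).trans ?_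
    rw [← ENNReal.ofReal_add (by positivity) hδ0.le]
    exact ENNReal.ofReal_le_ofReal hsum
  obtain ⟨D, hD⟩ := feFun_lipschitz ℓ V
  have hvd := hasWeakDeriv_of_lipschitz hD
  have hfin := h1Norm_le ((hg 0).locInt_fun.sub (hvd 0).locInt_fun)
    (g := fun i => g i - fun x => lineDeriv ℝ (feFun ℓ V) x (unitVec i))
    (fun i => (hg i).sub (hvd i))
    (hcomb hMu.1 hw.smooth.continuous.aestronglyMeasurable
      hD.continuous.aestronglyMeasurable hi0 hw0)
    (fun i => hcomb (hgL i).1 (contDiff_partialDeriv hw.smooth i).continuous.aestronglyMeasurable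
      (hvd i).locInt_deriv.aestronglyMeasurable (hi1 i) (hw1 i))
  refine hfin.trans (le_of_eq ?_)
  rw [show (2 : ℝ≥0∞) = ENNReal.ofReal 2 by norm_num, ← ENNReal.ofReal_mul (by norm_num)]
  congr 1
  ring

/-- The number of degrees of freedom of a blockwise polynomial array. -/
lemma IsBlockPoly.exists_admits {K s ℓ : ℕ} {A : ℕ → ℕ → ℕ → ℝ} (hA : IsBlockPoly K s A)
    (F : Format) (hℓ : 1 ≤ ℓ) (hs : 0 < s) {a 𝔡 : ℝ} (ha : 1 ≤ a)
    (hD : (2 ^ (K + 1) * s : ℝ) ≤ a * (ℓ : ℝ) ^ 𝔡) :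
    ∃ N : ℕ, F.Admits ℓ (fun i j k : Fin (2 ^ ℓ) => A i j k) N ∧
      (N : ℝ) ≤ 32 * a ^ 6 * (ℓ : ℝ) ^ F.kappa 𝔡 := by
  have hℓr : (1 : ℝ) ≤ ℓ := by exact_mod_cast hℓ
  have hℓ0 : (0 : ℝ) < ℓ := by linarith
  set D : ℝ := 2 ^ (K + 1) * s with hDdef
  set T : ℝ := (ℓ : ℝ) ^ 𝔡 with hT
  have hT0 : 0 < T := by positivity
  have hs1 : (1 : ℝ) ≤ s := by exact_mod_cast hs
  have hD1 : 1 ≤ D := one_le_mul_of_one_le_of_one_le (one_le_pow₀ (by norm_num)) hs1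
  have hpow : ∀ n m : ℕ, (ℓ : ℝ) ^ (n * 𝔡 + m : ℝ) = T ^ n * (ℓ : ℝ) ^ m := by
    intro n m
    rw [Real.rpow_add hℓ0, Real.rpow_natCast, mul_comm (n : ℝ), Real.rpow_mul hℓ0.le,
      Real.rpow_natCast]
  have ha0 : 0 ≤ a := by linarith
  -- With D at most a ℓ^𝔡, the counts are 24 ℓ³D⁴, 32 ℓD⁶ and 7 ℓ³D³; since a ≥ 1, the constant 32
  -- a⁶ covers all three.
  match F with
  | .qtt =>
    obtain ⟨N, hN, hle⟩ := hA.admitsQTT hℓ hs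
    refine ⟨N, hN, ?_⟩
    have hle' : (N : ℝ) ≤ (ℓ + ℓ + ℓ) * (2 * (2 * ℓ * D ^ 2) * (2 * ℓ * D ^ 2)) := by
      rw [hDdef]
      exact_mod_cast hle
    have e := hpow 4 3
    simp only [Nat.cast_ofNat] at e
    rw [Format.kappa, e]
    calc (N : ℝ) ≤ 24 * (D ^ 4 * (ℓ : ℝ) ^ 3) := hle'.trans (le_of_eq (by ring))
      _ ≤ 24 * ((a * T) ^ 4 * (ℓ : ℝ) ^ 3) := by gcongr
      _ = 24 * a ^ 4 * (T ^ 4 * (ℓ : ℝ) ^ 3) := by ring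
      _ ≤ 32 * a ^ 6 * (T ^ 4 * (ℓ : ℝ) ^ 3) := by gcongr <;> first | assumption | norm_num
  | .qt3 =>
    obtain ⟨N, hN, hle⟩ := hA.admitsQT3 hℓ
    refine ⟨N, hN, ?_⟩
    have hle' : (N : ℝ) ≤ ℓ * (2 ^ 3 * (1 + (2 ^ K * s) ^ 3) * (1 + (2 ^ K * s) ^ 3)) := by
      exact_mod_cast hle
    have hDK : (2 ^ K * s : ℝ) ≤ D := by
      rw [hDdef]
      gcongr
      · norm_num
      · omega
    have h1 : 1 + (2 ^ K * s : ℝ) ^ 3 ≤ 2 * D ^ 3 := by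
      have : (2 ^ K * s : ℝ) ^ 3 ≤ D ^ 3 := by gcongr
      have : (1 : ℝ) ≤ D ^ 3 := one_le_pow₀ hD1
      linarith
    have e := hpow 6 1
    simp only [Nat.cast_ofNat, Nat.cast_one, pow_one] at e
    rw [Format.kappa, e]
    calc (N : ℝ) ≤ ℓ * (2 ^ 3 * (2 * D ^ 3) * (2 * D ^ 3)) := hle'.trans (by gcongr)
      _ = 32 * (D ^ 6 * ℓ) := by ring
      _ ≤ 32 * ((a * T) ^ 6 * ℓ) := by gcongr
      _ = _ := by ring
  | .tqtt =>
    obtain ⟨N, hN, hle⟩ := hA.admitsTQTT hℓ hs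
    refine ⟨N, hN, ?_⟩
    have hle' : (N : ℝ) ≤ (ℓ * D) ^ 3 + 3 * (ℓ * (2 * (ℓ * D) * (ℓ * D))) := by
      rw [hDdef, ← mul_assoc]
      exact_mod_cast hle
    have e := hpow 3 3
    simp only [Nat.cast_ofNat] at e
    rw [Format.kappa, e]
    have hD3 : D ^ 2 ≤ D ^ 3 := pow_le_pow_right₀ hD1 (by norm_num)
    calc (N : ℝ) ≤ D ^ 3 * (ℓ : ℝ) ^ 3 + 6 * (D ^ 2 * (ℓ : ℝ) ^ 3) :=
          hle'.trans (le_of_eq (by ring))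
      _ ≤ D ^ 3 * (ℓ : ℝ) ^ 3 + 6 * (D ^ 3 * (ℓ : ℝ) ^ 3) := by gcongr
      _ = 7 * (D ^ 3 * (ℓ : ℝ) ^ 3) := by ring
      _ ≤ 7 * ((a * T) ^ 3 * (ℓ : ℝ) ^ 3) := by gcongr
      _ = 7 * a ^ 3 * (T ^ 3 * (ℓ : ℝ) ^ 3) := by ring
      _ ≤ 32 * a ^ 6 * (T ^ 3 * (ℓ : ℝ) ^ 3) := by gcongr <;> first | assumption | norm_num

lemma exists_two_pow_near {X : ℝ} (hX : 1 ≤ X) : ∃ K : ℕ, X ≤ 2 ^ K ∧ (2 : ℝ) ^ K ≤ 2 * X := by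
  obtain ⟨n, h1, h2⟩ := exists_nat_pow_near hX (by norm_num : (1 : ℝ) < 2)
  refine ⟨n + 1, h2.le, ?_⟩
  rw [pow_succ]
  linarith

/-- A refinement level that is sufficient for the tolerance `ε`. -/
lemma exists_level {c ε₀ : ℝ} (hc : 0 < c) (hε₀ : 0 < ε₀) (hε₀' : ε₀ < 1) :
    ∃ c₂ : ℝ, 0 < c₂ ∧ ∀ ε : ℝ, 0 < ε → ε ≤ ε₀ → ∃ ℓ : ℕ, 1 ≤ ℓ ∧ (ℓ : ℝ) ≤ c₂ * |Real.log ε| ∧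
      c * ((2 ^ ℓ)⁻¹ : ℝ) ^ (1 / 4 : ℝ) ≤ ε := by
  have hl2 : 0 < Real.log 2 := Real.log_pos (by norm_num)
  have hL0 : 0 < -Real.log ε₀ := by
    have := Real.log_neg hε₀ hε₀'
    linarith
  set R := 4 * |Real.log c| / Real.log 2 + 2 with hR
  have hR0 : 0 < R := by positivity
  -- |log ε| is bounded below by -log ε₀ > 0, so the additive constant `R` can be absorbed into a
  -- multiple of |log ε|.
  refine ⟨4 / Real.log 2 + R / -Real.log ε₀, by positivity, fun ε hε hle => ?_⟩
  have hL : -Real.log ε₀ ≤ |Real.log ε| := by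
    have := Real.log_le_log hε hle
    rw [abs_of_neg (Real.log_neg hε (by linarith))]
    linarith
  set L := |Real.log ε| with hLdef
  have hL1 : 0 < L := hL0.trans_le hL
  -- Any ℓ ≥ x gives c 2^(-ℓ/4) ≤ ε after taking logarithms.
  set x := 4 * (|Real.log c| + L) / Real.log 2 with hx
  have hx0 : 0 ≤ x := by positivity
  refine ⟨⌈x⌉₊ + 1, by omega, ?_, ?_⟩
  · have h1 := Nat.ceil_lt_add_one hx0
    have h2 : R ≤ R / -Real.log ε₀ * L := by
      rw [div_mul_eq_mul_div, le_div_iff₀ hL0]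
      gcongr
    push_cast
    calc (⌈x⌉₊ : ℝ) + 1 ≤ x + 2 := by linarith
      _ = 4 / Real.log 2 * L + R := by rw [hx, hR]; field_simp; ring
      _ ≤ _ := by rw [add_mul]; linarith
  · set ℓ := ⌈x⌉₊ + 1 with hℓ
    have hxl : x ≤ ℓ := by
      have := Nat.le_ceil x
      rw [hℓ]
      push_cast
      linarith
    have h1 : 4 * (|Real.log c| + L) ≤ ℓ * Real.log 2 := by
      rwa [hx, div_le_iff₀ hl2] at hxl
    have e : ((2 ^ ℓ)⁻¹ : ℝ) ^ (1 / 4 : ℝ) = Real.exp (-(ℓ * Real.log 2) / 4) := by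
      rw [Real.rpow_def_of_pos (by positivity), Real.log_inv, Real.log_pow]
      congr 1
      ring
    rw [e]
    nth_rw 1 [← Real.exp_log hc]
    rw [← Real.exp_add]
    rw [← Real.le_log_iff_exp_le hε]
    have h2 := le_abs_self (Real.log c)
    have h3 := neg_abs_le (Real.log ε)
    linarith

end QTTApprox

/-! ### The theorem: balancing refinement level, block size and polynomial degree. -/

theorem mainTheorem1 (F : QTTApprox.Format) (γ C_u A_u 𝔡 ε₀ : ℝ) (hγ : 3 / 2 < γ)
    (hC : 0 < C_u) (hA : 0 < A_u) (h𝔡 : 1 ≤ 𝔡) (hε₀ : 0 < ε₀) (hε₀' : ε₀ < 1)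
    (u : QTTApprox.E3 → ℝ) (hu : QTTApprox.MemGevreyClass γ C_u A_u 𝔡 u)
    (huΓ : QTTApprox.MemH1Gamma u) :
    ∃ C : ℝ, 0 < C ∧ ∀ ε : ℝ, 0 < ε → ε ≤ ε₀ →
      ∃ ℓ : ℕ, 1 ≤ ℓ ∧ ∃ v ∈ QTTApprox.feSpace ℓ,
        QTTApprox.h1Norm (u - v) ≤ ENNReal.ofReal ε ∧
        ∃ N : ℕ, F.Admits ℓ (QTTApprox.analysis ℓ v) N ∧
          (N : ℝ) ≤ C * |Real.log ε| ^ F.kappa 𝔡 := by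
  obtain ⟨c, A₁, hc, hA₁, happ⟩ := QTTApprox.exists_feFun_approx hu hγ hC hA h𝔡 huΓ
  obtain ⟨c₂, hc₂, hlev⟩ := QTTApprox.exists_level hc hε₀ hε₀'
  -- K is chosen with 2^K ≤ 12 A₁ (2ℓ)^(𝔡-1), so that 2^(K+1) · 2ℓ ≤ 24 A₁ (2ℓ)^𝔡 = a ℓ^𝔡.
  set a : ℝ := 24 * A₁ * 2 ^ 𝔡 with ha
  have h2𝔡 : (1 : ℝ) ≤ 2 ^ 𝔡 := Real.one_le_rpow (by norm_num) (by linarith)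
  have ha1 : 1 ≤ a := by nlinarith
  have hκ : 0 ≤ F.kappa 𝔡 := by
    cases F <;> simp only [QTTApprox.Format.kappa] <;> linarith
  refine ⟨32 * a ^ 6 * c₂ ^ F.kappa 𝔡, by positivity, fun ε hε hle => ?_⟩
  obtain ⟨ℓ, hℓ, hℓL, hℓε⟩ := hlev ε hε hle
  have hℓr : (1 : ℝ) ≤ ℓ := by exact_mod_cast hℓ
  have h2ℓ : (1 : ℝ) ≤ ((2 * ℓ : ℕ) : ℝ) := by push_cast; linarith
  have hX1 : 1 ≤ 6 * A₁ * ((2 * ℓ : ℕ) : ℝ) ^ (𝔡 - 1) := by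
    have := Real.one_le_rpow h2ℓ (show 0 ≤ 𝔡 - 1 by linarith)
    nlinarith
  obtain ⟨K, hK1, hK2⟩ := QTTApprox.exists_two_pow_near hX1
  obtain ⟨w, hw, hwu⟩ := happ ℓ K hℓ hK1
  have hpoly := QTTApprox.isBlockPoly_blockTaylor hw ℓ K (s := 2 * ℓ) (by omega)
  have hD : (2 ^ (K + 1) * ((2 * ℓ : ℕ) : ℝ) : ℝ) ≤ a * (ℓ : ℝ) ^ 𝔡 := by
    have e : ((2 * ℓ : ℕ) : ℝ) ^ (𝔡 - 1) * ((2 * ℓ : ℕ) : ℝ) = 2 ^ 𝔡 * (ℓ : ℝ) ^ 𝔡 := by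
      rw [Real.rpow_sub_one (by positivity), div_mul_cancel₀ _ (by positivity)]
      push_cast
      rw [Real.mul_rpow (by norm_num) (by positivity)]
    calc (2 ^ (K + 1) * ((2 * ℓ : ℕ) : ℝ) : ℝ) = 2 * 2 ^ K * ((2 * ℓ : ℕ) : ℝ) := by ring
      _ ≤ 2 * (2 * (6 * A₁ * ((2 * ℓ : ℕ) : ℝ) ^ (𝔡 - 1))) * ((2 * ℓ : ℕ) : ℝ) := by gcongr
      _ = 24 * A₁ * (((2 * ℓ : ℕ) : ℝ) ^ (𝔡 - 1) * ((2 * ℓ : ℕ) : ℝ)) := by ring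
      _ = a * (ℓ : ℝ) ^ 𝔡 := by rw [e, ha]; ring
  obtain ⟨N, hN, hNle⟩ := hpoly.exists_admits F hℓ (by omega) ha1 hD
  refine ⟨ℓ, hℓ, _, QTTApprox.feFun_mem ℓ _, hwu.trans (ENNReal.ofReal_le_ofReal hℓε), N, ?_, ?_⟩
  · rw [QTTApprox.analysis_feFun]
    exact hN
  · refine hNle.trans ?_
    calc 32 * a ^ 6 * (ℓ : ℝ) ^ F.kappa 𝔡 ≤ 32 * a ^ 6 * (c₂ * |Real.log ε|) ^ F.kappa 𝔡 := by
          gcongr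
      _ = 32 * a ^ 6 * c₂ ^ F.kappa 𝔡 * |Real.log ε| ^ F.kappa 𝔡 := by
          rw [Real.mul_rpow hc₂.le (abs_nonneg _)]
          ring
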